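/- Let $Act$ be an infinite set of visible actions and let $\tau\notin Act$ be the invisible action. A labelled transition system (LTS) is a tuple $L=(S,\Sigma,\Delta,\hat s)$ with $\Sigma=\Sigma(L)\subseteq Act$ (the alphabet), $\Delta\subseteq S\times(\Sigma\cup\{\tau\})\times S$ and $\hat s\in S$. *Operators.* Action prefix $a.L$ ($a\in Act$) adds $a$ to the alphabet and adds a new initial state with a single transition, labelled $a$, to $\hat s$. Hiding $L\setminus A$ replaces all labels from $A\subseteq Act$ by $\tau$ and has alphabet $\Sigma\setminus A$. Relational renaming $L\Phi$ ($\Phi\subseteq Act\times Act$) replaces each transition $(s,a,s')$ with $a\ne\tau$ by the transitions $(s,b,s')$ with $(a,b)\in\Phi$, or keeps it if no pair in $\Phi$ has first component $a$; its alphabet is renamed in the same way. In the parallel composition $L_1\,||\,L_2$, with alphabet $\Sigma_1\cup\Sigma_2$, actions in $\Sigma_1\cap\Sigma_2$ are executed jointly, and other actions and $\tau$ by one component alone. A *congruence* is an equivalence relation $\cong$ on LTSs such that $L\cong L'$ implies $a.L\cong a.L'$, $L\setminus A\cong L'\setminus A$, $L\Phi\cong L'\Phi$, $L\,||\,M\cong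 L'\,||\,M$ and $M\,||\,L\cong M\,||\,L'$ for all $a,A,\Phi,M$. *Semantic sets.* For $\sigma\in\Sigma^*$ write $s\stackrel{\sigma}{\Rightarrow}s'$ if some finite path from $s$ to $s'$ has $\sigma$ as its sequence of non-$\tau$ labels. Let - $Tr(L)$ be the set of $\sigma\in\Sigma^*$ with $\hat s\stackrel{\sigma}{\Rightarrow}s$ for some $s$; - $Div(L)$ be the set of $\sigma\in\Sigma^*$ with $\hat s\stackrel{\sigma}{\Rightarrow}s$ for some $s$ from which an infinite path of $\tau$-transitions starts; - $Inf(L)$ be the set of infinite sequences of visible actions executed along infinite paths from $\hat s$; - $Sf(L)$ be the set of $(\sigma,A)$ with $\sigma\in\Sigma^*$, $A\subseteq\Sigma$ and $\hat s\stackrel{\sigma}{\Rightarrow}s$ for some $s$ without outgoing transitions labelled by elements of $A\cup\{\tau\}$; - $minD(L)$ be the set of elements of $Div(L)$ none of whose proper prefixes is in $Div(L)$; - $extT(L)$ be the set of $\sigma\in\Sigma^*$ with a (not necessarily proper) prefix in $minD(L)$; - $anI(L)$, $eanI(L)$, $aenI(L)$ be the sets of those $\xi\in Inf(L)$ of which,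 respectively, no prefix, only finitely many prefixes, not all but finitely many prefixes, are in $Div(L)$ (prefixes here are finite); - $anF(L)=\{(\sigma,A)\in Sf(L)\mid\sigma\notin extT(L)\}$; - $snF(L)=\{(\sigma,A)\in Sf(L)\mid\sigma\notin Div(L)\wedge\forall a\in A:\sigma a\notin Div(L)\}$. A relation $\cong$ *preserves* $X$ if $L\cong L'$ implies $X(L)=X(L')$. The equivalence *induced by* $X_1,\dots,X_k$ relates $L$ and $L'$ if and only if $X_i(L)=X_i(L')$ for all $i$. *CFFD-equivalence* is induced by $\Sigma,Sf,Div,Inf$. *Livelock* is the one-state LTS with empty alphabet and a $\tau$-loop; *bothlock* is obtained from it by adding a $\tau$-transition to a second, deadlocked state. **Theorem.** Let $\cong$ be a congruence that is implied by CFFD-equivalence and relates livelock and bothlock. If $\cong$ preserves the sets in the first column of some row of the table but does not preserve any of the sets in the second column, then $\cong$ is the equivalence induced by the sets in the third column of that row. | row | preserves | does not preserve | induced by | |---|---|---|---| | 1 | $anF,minD$ | $Tr$ | $\Sigma,anF,minD,anI$ | | 2 | $Tr,anF,minD$ | $Div,Inf$ | $\Sigma,Tr,anF,minD,anI$ | |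 3 | $anF,minD,Inf$ | $Div$ | $\Sigma,Tr,anF,minD,Inf$ | | 4 | $anF,Div$ | $snF,aenI$ | $\Sigma,Tr,anF,Div,eanI$ | | 5 | $anF,Div,aenI$ | $snF,Inf$ | $\Sigma,Tr,anF,Div,aenI$ | | 6 | $anF,Div,Inf$ | $snF$ | $\Sigma,Tr,anF,Div,Inf$ | In particular, if $\cong$ preserves $anF$ but not $snF$, then $\cong$ is one of the six equivalences in the third column. The equivalence of row 1 is strictly weaker than each of the other five: each of them implies it, and it implies none of them. It is the failures-divergences equivalence of CSP in the following sense. Let $CDiv(L)=extT(L)$ and $CFail(L)=Sf(L)\cup(CDiv(L)\times 2^{\Sigma(L)})$. Then the equivalence of row 1 is induced by $\Sigma,CFail,CDiv,anI$. Moreover, if in $L$ and $L'$ every state has only finitely many immediate successor states, then $L$ and $L'$ are related by the equivalence of row 1 if and only if $\Sigma(L)=\Sigma(L')$, $CFail(L)=CFail(L')$ and $CDiv(L)=CDiv(L')$. -/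

import Mathlib

universe u v

/-- A labelled transition system whose visible actions are taken from `Act`.
A label is an element of `Option Act`: `none` is the invisible action `τ`, and `some a` is the
visible action `a`. -/
structure LTS (Act : Type u) where
  State : Type v
  alphabet : Set Act
  step : State → Option Act → State → Prop
  init : State
  step_alphabet : ∀ {s : State} {a : Act} {s' : State}, step s (some a) s' → a ∈ alphabet

namespace LTS

variable {Act : Type u}

/-! ### The operators -/

/-- Action prefix `a.L`; the new initial state is `none`. -/
def actPrefix (a : Act) (L : LTS.{u, v} Act) : LTS.{u, v} Act where
  State := Option L.State
  alphabet := L.alphabet ∪ {a}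
  step s x s' :=
    (∃ t t', s = some t ∧ s' = some t' ∧ L.step t x t') ∨
      (s = none ∧ x = some a ∧ s' = some L.init)
  init := none
  step_alphabet := by
    rintro s b s' (⟨t, t', -, -, h⟩ | ⟨-, h, -⟩)
    · exact Or.inl (L.step_alphabet h)
    · exact Or.inr (Option.some.inj h)

/-- Hiding `L \ A`. -/
def hide (L : LTS.{u, v} Act) (A : Set Act) : LTS.{u, v} Act where
  State := L.State
  alphabet := L.alphabet \ A
  step s x s' := ∃ y, L.step s y s' ∧ ((x = y ∧ y ∉ some '' A) ∨ (x = none ∧ y ∈ some '' A))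
  init := L.init
  step_alphabet := by
    rintro s a s' ⟨y, h, ⟨rfl, hA⟩ | ⟨h0, -⟩⟩
    · exact ⟨L.step_alphabet h, fun ha => hA ⟨a, ha, rfl⟩⟩
    · exact absurd h0 (by simp)

/-- The relation `Φ(a, b)` between visible actions that is used in renaming: an action outside
the domain of `Φ` keeps its name. -/
def RenamesTo (Φ : Set (Act × Act)) (a b : Act) : Prop :=
  (a, b) ∈ Φ ∨ (a = b ∧ ∀ c, (a, c) ∉ Φ)

/-- Relational renaming `L Φ`; `τ` is never renamed and nothing is renamed to `τ`. -/
def rename (L : LTS.{u, v} Act) (Φ : Set (Act × Act)) : LTS.{u, v} Act where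
  State := L.State
  alphabet := {b | ∃ a ∈ L.alphabet, RenamesTo Φ a b}
  step s x s' :=
    (x = none ∧ L.step s none s') ∨
      (∃ a b, x = some b ∧ L.step s (some a) s' ∧ RenamesTo Φ a b)
  init := L.init
  step_alphabet := by
    rintro s c s' (⟨h, -⟩ | ⟨a, b, hb, h, hΦ⟩)
    · exact absurd h (by simp)
    · obtain rfl := Option.some.inj hb
      exact ⟨a, L.step_alphabet h, hΦ⟩

/-- Parallel composition `L₁ || L₂`. -/
def par (L₁ L₂ : LTS.{u, v} Act) : LTS.{u, v} Act where
  State := L₁.State × L₂.State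
  alphabet := L₁.alphabet ∪ L₂.alphabet
  step s x s' :=
    (x ∉ some '' L₂.alphabet ∧ L₁.step s.1 x s'.1 ∧ s'.2 = s.2) ∨
    (x ∉ some '' L₁.alphabet ∧ L₂.step s.2 x s'.2 ∧ s'.1 = s.1) ∨
    (x ∈ some '' (L₁.alphabet ∩ L₂.alphabet) ∧ L₁.step s.1 x s'.1 ∧ L₂.step s.2 x s'.2)
  init := (L₁.init, L₂.init)
  step_alphabet := by
    rintro s a s' (⟨-, h, -⟩ | ⟨-, h, -⟩ | ⟨-, h, -⟩)
    · exact Or.inl (L₁.step_alphabet h)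
    · exact Or.inr (L₂.step_alphabet h)
    · exact Or.inl (L₁.step_alphabet h)

/-- The equivalence relation `r` is a congruence for the four operators. -/
structure IsCongruence (r : LTS.{u, v} Act → LTS.{u, v} Act → Prop) : Prop where
  equivalence : Equivalence r
  actPrefix : ∀ (a : Act) {L L' : LTS.{u, v} Act}, r L L' → r (L.actPrefix a) (L'.actPrefix a)
  hide : ∀ (A : Set Act) {L L' : LTS.{u, v} Act}, r L L' → r (L.hide A) (L'.hide A)
  rename : ∀ (Φ : Set (Act × Act)) {L L' : LTS.{u, v} Act},
    r L L' → r (L.rename Φ) (L'.rename Φ)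
  par_right : ∀ (M : LTS.{u, v} Act) {L L' : LTS.{u, v} Act}, r L L' → r (L.par M) (L'.par M)
  par_left : ∀ (M : LTS.{u, v} Act) {L L' : LTS.{u, v} Act}, r L L' → r (M.par L) (M.par L')

/-! ### Livelock and bothlock -/

/-- The livelock: empty alphabet, one state, and a `τ`-loop. -/
def livelock (Act : Type u) : LTS.{u, v} Act where
  State := PUnit
  alphabet := ∅
  step _ x _ := x = none
  init := PUnit.unit
  step_alphabet h := absurd h (by simp)

/-- The bothlock: empty alphabet, an initial state `false` that has a `τ`-loop and
a `τ`-transition to the deadlocked state `true`. -/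
def bothlock (Act : Type u) : LTS.{u, v} Act where
  State := ULift Bool
  alphabet := ∅
  step s x _ := s.down = false ∧ x = none
  init := ⟨false⟩
  step_alphabet h := absurd h.2 (by simp)

/-! ### Traces, divergences, failures -/

/-- `L.Weak s σ s'` means that there is a finite path from `s` to `s'` whose sequence of visible
labels is `σ`. -/
inductive Weak (L : LTS.{u, v} Act) : L.State → List Act → L.State → Prop
  | refl (s : L.State) : Weak L s [] s
  | tau {s s' s'' : L.State} {σ : List Act} :
      L.step s none s' → Weak L s' σ s'' → Weak L s σ s''
  | vis {s s' s'' : L.State} {a : Act} {σ : List Act} :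
      L.step s (some a) s' → Weak L s' σ s'' → Weak L s (a :: σ) s''

/-- An infinite path of `τ`-transitions starts at `s`. -/
def Diverges (L : LTS.{u, v} Act) (s : L.State) : Prop :=
  ∃ p : ℕ → L.State, p 0 = s ∧ ∀ i, L.step (p i) none (p (i + 1))

/-- Traces. -/
def Tr (L : LTS.{u, v} Act) : Set (List Act) := {σ | ∃ s, L.Weak L.init σ s}

/-- Divergence traces. -/
def Div (L : LTS.{u, v} Act) : Set (List Act) := {σ | ∃ s, L.Weak L.init σ s ∧ L.Diverges s}

/-- Infinite traces; the sequence `a₁ a₂ ⋯` is the function `ξ` with `ξ i = aᵢ₊₁`. -/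
def Inf (L : LTS.{u, v} Act) : Set (ℕ → Act) :=
  {ξ | ∃ p q : ℕ → L.State, p 0 = L.init ∧
    ∀ i, L.Weak (p i) [] (q i) ∧ L.step (q i) (some (ξ i)) (p (i + 1))}

/-- Stable failures. -/
def Sf (L : LTS.{u, v} Act) : Set (List Act × Set Act) :=
  {f | f.2 ⊆ L.alphabet ∧ ∃ s, L.Weak L.init f.1 s ∧
    (∀ s', ¬ L.step s none s') ∧ ∀ a ∈ f.2, ∀ s', ¬ L.step s (some a) s'}

/-- The prefix of length `n` of an infinite sequence. -/
def initSeg (ξ : ℕ → Act) (n : ℕ) : List Act := (List.range n).map ξ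

/-- Minimal divergence traces. -/
def minD (L : LTS.{u, v} Act) : Set (List Act) :=
  {σ | σ ∈ L.Div ∧ ∀ ρ, ρ <+: σ → ρ ≠ σ → ρ ∉ L.Div}

/-- Finite extensions of minimal divergence traces. -/
def extT (L : LTS.{u, v} Act) : Set (List Act) :=
  {σ | (∀ a ∈ σ, a ∈ L.alphabet) ∧ ∃ ρ, ρ <+: σ ∧ ρ ∈ L.minD}

/-- Infinite extensions of minimal divergence traces. -/
def extI (L : LTS.{u, v} Act) : Set (ℕ → Act) :=
  {ξ | (∀ i, ξ i ∈ L.alphabet) ∧ ∃ n, initSeg ξ n ∈ L.minD}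

/-- Always-nondivergent infinite traces. -/
def anI (L : LTS.{u, v} Act) : Set (ℕ → Act) := L.Inf \ L.extI

/-- Eventually-always-nondivergent infinite traces. -/
def eanI (L : LTS.{u, v} Act) : Set (ℕ → Act) :=
  {ξ | ξ ∈ L.Inf ∧ ∃ n, ∀ i ≥ n, initSeg ξ i ∉ L.Div}

/-- Always-eventually-nondivergent infinite traces. -/
def aenI (L : LTS.{u, v} Act) : Set (ℕ → Act) :=
  {ξ | ξ ∈ L.Inf ∧ ∀ n, ∃ i ≥ n, initSeg ξ i ∉ L.Div}

/-- Nondivergent failures. -/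
def nF (L : LTS.{u, v} Act) : Set (List Act × Set Act) := {f | f ∈ L.Sf ∧ f.1 ∉ L.Div}

/-- Strongly nondivergent failures. -/
def snF (L : LTS.{u, v} Act) : Set (List Act × Set Act) :=
  {f | f ∈ L.nF ∧ ∀ a ∈ f.2, f.1 ++ [a] ∉ L.Div}

/-- Always nondivergent failures. -/
def anF (L : LTS.{u, v} Act) : Set (List Act × Set Act) := {f | f ∈ L.Sf ∧ f.1 ∉ L.extT}

/-- The divergences of the failures-divergences model of CSP. -/
def CDiv (L : LTS.{u, v} Act) : Set (List Act) := L.extT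

/-- The failures of the failures-divergences model of CSP. -/
def CFail (L : LTS.{u, v} Act) : Set (List Act × Set Act) :=
  L.Sf ∪ {f | f.1 ∈ L.CDiv ∧ f.2 ⊆ L.alphabet}

/-- Every state has finitely many immediate successors. -/
def FinitelyBranching (L : LTS.{u, v} Act) : Prop :=
  ∀ s, {s' | ∃ x, L.step s x s'}.Finite

/-! ### Equivalences -/

/-- `r` preserves the set-valued function `X`. -/
def Preserves {β : Type*} (r : LTS.{u, v} Act → LTS.{u, v} Act → Prop)
    (X : LTS.{u, v} Act → β) : Prop :=
  ∀ L L', r L L' → X L = X L'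

/-- CFFD-equivalence: the equivalence induced by `Σ`, `Sf`, `Div` and `Inf`. -/
def CFFD (L L' : LTS.{u, v} Act) : Prop :=
  L.alphabet = L'.alphabet ∧ L.Sf = L'.Sf ∧ L.Div = L'.Div ∧ L.Inf = L'.Inf

/-- The six equivalences, in the order of the rows of the table. -/
def RowEquiv : Fin 6 → LTS.{u, v} Act → LTS.{u, v} Act → Prop
  | 0, L, L' => L.alphabet = L'.alphabet ∧ L.anF = L'.anF ∧ L.minD = L'.minD ∧ L.anI = L'.anI
  | 1, L, L' => L.alphabet = L'.alphabet ∧ L.Tr = L'.Tr ∧ L.anF = L'.anF ∧ L.minD = L'.minD ∧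
      L.anI = L'.anI
  | 2, L, L' => L.alphabet = L'.alphabet ∧ L.Tr = L'.Tr ∧ L.anF = L'.anF ∧ L.minD = L'.minD ∧
      L.Inf = L'.Inf
  | 3, L, L' => L.alphabet = L'.alphabet ∧ L.Tr = L'.Tr ∧ L.anF = L'.anF ∧ L.Div = L'.Div ∧
      L.eanI = L'.eanI
  | 4, L, L' => L.alphabet = L'.alphabet ∧ L.Tr = L'.Tr ∧ L.anF = L'.anF ∧ L.Div = L'.Div ∧
      L.aenI = L'.aenI
  | 5, L, L' => L.alphabet = L'.alphabet ∧ L.Tr = L'.Tr ∧ L.anF = L'.anF ∧ L.Div = L'.Div ∧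
      L.Inf = L'.Inf

/-- The failures-divergences equivalence of CSP, for finitely branching systems. -/
def FDEquiv (L L' : LTS.{u, v} Act) : Prop :=
  L.alphabet = L'.alphabet ∧ L.CFail = L'.CFail ∧ L.CDiv = L'.CDiv

end LTS

/-!
Let `r` be a congruence that is implied by CFFD-equivalence, relates livelock and bothlock, and
preserves `anF`. The classification says that `r` can forget only what a few normal forms forget.

*Contexts.* Since `Act` is infinite, the operators are able to implement every *monitor*, an
automaton that watches the visible steps of a system, decides which of them may happen, and relabels
or hides them (`Monitor.obs_eq`): the steps are renamed to codes of pairs of an old and a new label,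
the monitor synchronizes with these codes, and the codes are then hidden or decoded. Hence a
congruence is closed under observation by monitors (`IsCongruence.obs`).

*What has to be preserved.* A `tracker` is a monitor that follows a given sequence of actions and
shows some positions of it as one action `h`. Trackers show that `r` preserves the alphabet, `minD`
and `anI`, and that it preserves `eanI` if it preserves `Div`. They also condense a failure of `r` to
preserve `Tr`, `Div`, `snF`, `Inf` or `aenI` into two related systems `Z`, `Z'` over the alphabet
`{h}` of which only one shows a certain behaviour (`exists_witness_Tr` and its companions).

*What can be forgotten.* A `speculator` is a monitor that simulates a system `L` and is allowed, when
`L` diverges, to abandon the simulation: it takes orders from an observed system and then makes up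
a continuation, or resumes `L` in another state that is reachable by the same trace. Such a state is
chosen from the set of all states reachable by the trace, which is the only memory that is needed, so
the universe of states is not left. With livelock and bothlock as observed systems one obtains that
stable failures at divergence traces are irrelevant for `r` (`rel_of_nF_eq`). With `Z` and `Z'` from
above as observed systems, the speculation changes nothing relevant under orders from `Z'`, while
under orders from `Z` it adds to `L` all behaviour of a certain kind (`rel_specSys`). So `L` is
related to a normal form from which that kind of information has been erased: everything beyond
the minimal divergence traces if `Tr` is not preserved (`exists_rel_chaos`), or else the
distinction between divergence traces and other traces that extend divergence traces
(`exists_rel_div`), the failures of the latter (`exists_rel_snF`), or the infinite traces with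
almost all (`exists_rel_Inf`) or infinitely many (`exists_rel_aenI`) prefixes divergent. In each
row of the classification, the normal forms of two systems agree as soon as the sets of the row do.

For `aenI`, orders have to tell whether a divergence is about to come: `exists_witness_aenI` shows
an action exactly where divergence of the current prefix begins or ends, so that the parity of the
number of orders carries this information.

The comparison with the failures-divergences model is direct, apart from Kőnig's lemma
(`mem_Inf_of_finitelyBranching`), by which the finite traces of a finitely branching system determine
its infinite ones away from divergences.
-/

namespace LTS

variable {Act : Type u}

/-! ### Paths, divergence and infinite traces -/

theorem Weak.trans {L : LTS.{u, v} Act} {s t w : L.State} {σ ρ : List Act}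
    (h : L.Weak s σ t) (h' : L.Weak t ρ w) : L.Weak s (σ ++ ρ) w := by
  induction h with
  | refl => exact h'
  | tau h1 _ ih => exact .tau h1 (ih h')
  | vis h1 _ ih => exact .vis h1 (ih h')

theorem Weak.trans_nil {L : LTS.{u, v} Act} {s t w : L.State} {σ : List Act}
    (h : L.Weak s σ t) (h' : L.Weak t [] w) : L.Weak s σ w := by
  simpa using h.trans h'

theorem Weak.single_tau {L : LTS.{u, v} Act} {s t : L.State} (h : L.step s none t) :
    L.Weak s [] t := .tau h (.refl _)

theorem Weak.single {L : LTS.{u, v} Act} {s t : L.State} {a : Act} (h : L.step s (some a) t) :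
    L.Weak s [a] t := .vis h (.refl _)

theorem Weak.split {L : LTS.{u, v} Act} {s w : L.State} {σ ρ : List Act}
    (h : L.Weak s (σ ++ ρ) w) : ∃ t, L.Weak s σ t ∧ L.Weak t ρ w := by
  generalize hκ : σ ++ ρ = κ at h
  induction h generalizing σ with
  | refl s =>
    obtain ⟨rfl, rfl⟩ := List.append_eq_nil_iff.1 hκ
    exact ⟨s, .refl _, .refl _⟩
  | tau h1 _ ih =>
    obtain ⟨t, ht, ht'⟩ := ih hκ
    exact ⟨t, .tau h1 ht, ht'⟩
  | @vis s s' s'' a κ h1 h2 ih =>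
    cases σ with
    | nil =>
      obtain rfl : ρ = a :: κ := hκ
      exact ⟨s, .refl _, .vis h1 h2⟩
    | cons b σ =>
      rw [List.cons_append, List.cons_eq_cons] at hκ
      obtain ⟨rfl, hκ'⟩ := hκ
      obtain ⟨t, ht, ht'⟩ := ih hκ'
      exact ⟨t, .vis h1 ht, ht'⟩

theorem Weak.split_vis {L : LTS.{u, v} Act} {s w : L.State} {a : Act} {σ : List Act}
    (h : L.Weak s (a :: σ) w) :
    ∃ t t', L.Weak s [] t ∧ L.step t (some a) t' ∧ L.Weak t' σ w := by
  generalize hκ : a :: σ = κ at h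
  induction h with
  | refl s => cases hκ
  | tau h1 _ ih =>
    obtain ⟨t, t', ht, ht', ht''⟩ := ih hκ
    exact ⟨t, t', .tau h1 ht, ht', ht''⟩
  | @vis s s' s'' a κ h1 h2 ih =>
    obtain ⟨rfl, rfl⟩ := List.cons_eq_cons.1 hκ
    exact ⟨s, s', .refl _, h1, h2⟩

theorem Weak.mem_alphabet {L : LTS.{u, v} Act} {s t : L.State} {σ : List Act}
    (h : L.Weak s σ t) : ∀ a ∈ σ, a ∈ L.alphabet := by
  induction h with
  | refl => simp
  | tau h1 _ ih => exact ih
  | vis h1 _ ih =>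
    intro b hb
    rcases List.mem_cons.1 hb with rfl | hb
    · exact L.step_alphabet h1
    · exact ih b hb

/-- A state is nondivergent iff it is accessible for the reversed `τ`-steps; this turns the
nonexistence of infinite `τ`-paths into an induction principle. -/
theorem not_diverges_iff_acc {L : LTS.{u, v} Act} {s : L.State} :
    ¬ L.Diverges s ↔ Acc (fun t' t => L.step t none t') s := by
  rw [acc_iff_isEmpty_descending_chain, ← not_nonempty_iff, not_iff_not]
  exact ⟨fun ⟨p, h⟩ => ⟨p, h⟩, fun ⟨p, h⟩ => ⟨p, h⟩⟩

theorem Diverges.of_forall_step {L : LTS.{u, v} Act} (G : L.State → Prop)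
    (hG : ∀ s, G s → ∃ s', L.step s none s' ∧ G s') {s : L.State} (hs : G s) :
    L.Diverges s := by
  choose! f hf hf' using hG
  have hi : ∀ i, G (f^[i] s) := fun i => by
    induction i with
    | zero => exact hs
    | succ i ih => rw [Function.iterate_succ_apply']; exact hf' _ ih
  refine ⟨fun i => f^[i] s, rfl, fun i => ?_⟩
  simp only [Function.iterate_succ_apply']
  exact hf _ (hi i)

theorem Diverges.exists_step {L : LTS.{u, v} Act} {s : L.State} (h : L.Diverges s) :
    ∃ s', L.step s none s' ∧ L.Diverges s' := by
  obtain ⟨p, rfl, hp⟩ := h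
  exact ⟨p 1, hp 0, fun i => p (i + 1), rfl, fun i => hp (i + 1)⟩

theorem exists_stable_of_not_diverges {L : LTS.{u, v} Act} {s : L.State} (h : ¬ L.Diverges s) :
    ∃ t, L.Weak s [] t ∧ ∀ t', ¬ L.step t none t' := by
  have := not_diverges_iff_acc.1 h
  clear h
  induction this with
  | intro s _ ih =>
    by_cases hs : ∃ s', L.step s none s'
    · obtain ⟨s', hs'⟩ := hs
      obtain ⟨t, ht, ht'⟩ := ih s' hs'
      exact ⟨t, .tau hs' ht, ht'⟩
    · exact ⟨s, .refl _, fun t' ht' => hs ⟨t', ht'⟩⟩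

theorem nil_mem_Tr (L : LTS.{u, v} Act) : [] ∈ L.Tr := ⟨_, .refl _⟩

theorem Div_subset_Tr (L : LTS.{u, v} Act) : L.Div ⊆ L.Tr := fun _ ⟨s, h, _⟩ => ⟨s, h⟩

theorem Tr_of_prefix {L : LTS.{u, v} Act} {ρ σ : List Act} (h : ρ <+: σ) (hσ : σ ∈ L.Tr) :
    ρ ∈ L.Tr := by
  obtain ⟨κ, rfl⟩ := h
  obtain ⟨s, hs⟩ := hσ
  obtain ⟨t, ht, -⟩ := hs.split
  exact ⟨t, ht⟩

theorem mem_alphabet_of_mem_Tr {L : LTS.{u, v} Act} {σ : List Act} (h : σ ∈ L.Tr) :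
    ∀ a ∈ σ, a ∈ L.alphabet := h.choose_spec.mem_alphabet

theorem Sf_fst_mem_Tr {L : LTS.{u, v} Act} {f : List Act × Set Act} (h : f ∈ L.Sf) :
    f.1 ∈ L.Tr := ⟨_, h.2.choose_spec.1⟩

theorem mem_Sf_empty_of_not_mem_Div {L : LTS.{u, v} Act} {σ : List Act} (h : σ ∈ L.Tr)
    (h' : σ ∉ L.Div) : (σ, (∅ : Set Act)) ∈ L.Sf := by
  obtain ⟨s, hs⟩ := h
  obtain ⟨t, ht, ht'⟩ := exists_stable_of_not_diverges (L := L) (s := s) fun hd => h' ⟨s, hs, hd⟩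
  exact ⟨Set.empty_subset _, t, hs.trans_nil ht, ht', by simp⟩

theorem exists_minD_prefix {L : LTS.{u, v} Act} {σ : List Act} (h : σ ∈ L.Div) :
    ∃ ρ, ρ <+: σ ∧ ρ ∈ L.minD := by
  induction hn : σ.length using Nat.strong_induction_on generalizing σ with
  | _ n ih =>
    by_cases hm : σ ∈ L.minD
    · exact ⟨σ, List.prefix_rfl, hm⟩
    · simp only [minD, Set.mem_ofPred_eq, not_and, not_forall, not_not] at hm
      obtain ⟨ρ, hρ, hne, hd⟩ := hm h
      have hlt : ρ.length < n := hn ▸ lt_of_le_of_ne hρ.length_le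
        fun he => hne (hρ.eq_of_length he)
      obtain ⟨κ, hκ, hκ'⟩ := ih _ hlt hd rfl
      exact ⟨κ, hκ.trans hρ, hκ'⟩

theorem minD_subset_Div (L : LTS.{u, v} Act) : L.minD ⊆ L.Div := fun _ h => h.1

/-- Minimality may be dropped in the definition of `extT`. -/
theorem mem_extT_iff {L : LTS.{u, v} Act} {σ : List Act} :
    σ ∈ L.extT ↔ (∀ a ∈ σ, a ∈ L.alphabet) ∧ ∃ ρ, ρ <+: σ ∧ ρ ∈ L.Div := by
  refine ⟨fun ⟨h, ρ, h1, h2⟩ => ⟨h, ρ, h1, h2.1⟩, fun ⟨h, ρ, h1, h2⟩ => ⟨h, ?_⟩⟩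
  obtain ⟨κ, hκ, hκ'⟩ := exists_minD_prefix h2
  exact ⟨κ, hκ.trans h1, hκ'⟩

theorem Div_subset_extT (L : LTS.{u, v} Act) : L.Div ⊆ L.extT := fun σ h =>
  mem_extT_iff.2 ⟨mem_alphabet_of_mem_Tr (L.Div_subset_Tr h), σ, List.prefix_rfl, h⟩

theorem extT_eq_of_minD_eq {L L' : LTS.{u, v} Act} (hA : L.alphabet = L'.alphabet)
    (h : L.minD = L'.minD) : L.extT = L'.extT := by
  simp only [extT, hA, h]

theorem extI_eq_of_minD_eq {L L' : LTS.{u, v} Act} (hA : L.alphabet = L'.alphabet)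
    (h : L.minD = L'.minD) : L.extI = L'.extI := by
  simp only [extI, hA, h]

theorem minD_eq_of_Div_eq {L L' : LTS.{u, v} Act} (h : L.Div = L'.Div) : L.minD = L'.minD := by
  simp only [minD, h]

theorem length_initSeg (ξ : ℕ → Act) (n : ℕ) : (initSeg ξ n).length = n := by
  simp [initSeg]

theorem initSeg_succ (ξ : ℕ → Act) (n : ℕ) : initSeg ξ (n + 1) = initSeg ξ n ++ [ξ n] := by
  simp [initSeg, List.range_succ]

theorem initSeg_add (ξ : ℕ → Act) (n m : ℕ) :
    initSeg ξ (n + m) = initSeg ξ n ++ initSeg (fun i => ξ (n + i)) m := by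
  induction m with
  | zero => simp [initSeg]
  | succ m ih => rw [← add_assoc, initSeg_succ, ih, initSeg_succ, List.append_assoc]

theorem initSeg_prefix (ξ : ℕ → Act) {n m : ℕ} (h : n ≤ m) : initSeg ξ n <+: initSeg ξ m := by
  obtain ⟨k, rfl⟩ := Nat.exists_eq_add_of_le h
  exact ⟨_, (initSeg_add ξ n k).symm⟩

theorem eq_initSeg_of_prefix {ξ : ℕ → Act} {n : ℕ} {ρ : List Act} (h : ρ <+: initSeg ξ n) :
    ρ = initSeg ξ ρ.length := by
  have hle := h.length_le
  rw [length_initSeg] at hle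
  exact List.IsPrefix.eq_of_length
    (List.prefix_of_prefix_length_le h (initSeg_prefix ξ hle) (by simp [length_initSeg]))
    (by simp [length_initSeg])

/-- Minimality may be dropped in the definition of `extI`. -/
theorem mem_extI_iff {L : LTS.{u, v} Act} {ξ : ℕ → Act} :
    ξ ∈ L.extI ↔ (∀ i, ξ i ∈ L.alphabet) ∧ ∃ n, initSeg ξ n ∈ L.Div := by
  refine ⟨fun ⟨h, n, h1⟩ => ⟨h, n, h1.1⟩, fun ⟨h, n, h1⟩ => ⟨h, ?_⟩⟩
  obtain ⟨κ, hκ, hκ'⟩ := exists_minD_prefix h1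
  exact ⟨κ.length, eq_initSeg_of_prefix hκ ▸ hκ'⟩

/-- `ξ` is executed along an infinite path from `s`. -/
def InfFrom (L : LTS.{u, v} Act) (s : L.State) (ξ : ℕ → Act) : Prop :=
  ∃ p : ℕ → L.State, p 0 = s ∧ ∀ i, L.Weak (p i) [ξ i] (p (i + 1))

theorem mem_Inf_iff {L : LTS.{u, v} Act} {ξ : ℕ → Act} : ξ ∈ L.Inf ↔ L.InfFrom L.init ξ := by
  constructor
  · rintro ⟨p, q, h0, h⟩
    exact ⟨p, h0, fun i => (h i).1.trans (.single (h i).2)⟩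
  · rintro ⟨p, h0, h⟩
    choose q p' hq hs hp' using fun i => (h i).split_vis
    refine ⟨fun i => Nat.casesOn i L.init p', q, rfl, fun i => ⟨?_, hs i⟩⟩
    cases i with
    | zero => simpa [h0] using hq 0
    | succ i => exact (hp' i).trans_nil (hq (i + 1))

/-- An infinite execution exists if an invariant `G` can be maintained from action to action. -/
theorem InfFrom.of_forall_weak {L : LTS.{u, v} Act} {ξ : ℕ → Act} (G : ℕ → L.State → Prop)
    (hG : ∀ n s, G n s → ∃ s', L.Weak s [ξ n] s' ∧ G (n + 1) s') {s : L.State} {n : ℕ}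
    (hs : G n s) : L.InfFrom s fun i => ξ (n + i) := by
  choose! f hf hf' using hG
  let p : ℕ → L.State := fun i => Nat.rec s (fun i t => f (n + i) t) i
  have hi : ∀ i, G (n + i) (p i) := fun i => by
    induction i with
    | zero => exact hs
    | succ i ih => exact hf' _ _ ih
  exact ⟨p, rfl, fun i => hf _ _ (hi i)⟩

theorem InfFrom.weak_initSeg {L : LTS.{u, v} Act} {ξ : ℕ → Act} {p : ℕ → L.State}
    (h : ∀ i, L.Weak (p i) [ξ i] (p (i + 1))) (n : ℕ) : L.Weak (p 0) (initSeg ξ n) (p n) := by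
  induction n with
  | zero => exact .refl _
  | succ n ih => rw [initSeg_succ]; exact ih.trans (h n)

/-- An infinite trace of `L` may be glued from a finite trace and an infinite continuation. -/
theorem mem_Inf_of_weak {L : LTS.{u, v} Act} {ξ : ℕ → Act} {n : ℕ} {s : L.State}
    (h : L.Weak L.init (initSeg ξ n) s) (h' : L.InfFrom s fun i => ξ (n + i)) : ξ ∈ L.Inf := by
  obtain ⟨p, hp0, hp⟩ := h'
  rw [mem_Inf_iff]
  have := InfFrom.of_forall_weak (L := L) (ξ := ξ) (s := L.init) (n := 0)
    (fun m t => (m ≤ n ∧ L.Weak t ((initSeg ξ n).drop m) s) ∨ ∃ i, m = n + i ∧ t = p i) ?_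
    (Or.inl ⟨Nat.zero_le _, by simpa using h⟩)
  · simpa using this
  · have key : ∀ i, ∃ s', L.Weak (p i) [ξ (n + i)] s' ∧ ((n + i + 1 ≤ n ∧
        L.Weak s' ((initSeg ξ n).drop (n + i + 1)) s) ∨
          ∃ j, n + i + 1 = n + j ∧ s' = p j) :=
      fun i => ⟨p (i + 1), hp i, Or.inr ⟨i + 1, by omega, rfl⟩⟩
    rintro m t (⟨hm, ht⟩ | ⟨i, rfl, rfl⟩)
    · rcases hm.lt_or_eq with hm | rfl
      · rw [List.drop_eq_getElem_cons (by simpa [length_initSeg] using hm)] at ht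
        have he : (initSeg ξ n)[m]'(by simpa [length_initSeg] using hm) = ξ m := by
          simp [initSeg]
        rw [he, ← List.singleton_append] at ht
        obtain ⟨w, hw, hw'⟩ := ht.split
        exact ⟨w, hw, Or.inl ⟨hm, hw'⟩⟩
      · -- glue the `τ`-moves that follow the last visible action of the finite part
        rw [List.drop_of_length_le (by simp [length_initSeg])] at ht
        obtain ⟨s', hs', h2⟩ := key 0
        exact ⟨s', by simpa using ht.trans (hp0 ▸ hs'), by simpa using h2⟩
    · exact key i

theorem initSeg_mem_Tr_of_mem_Inf {L : LTS.{u, v} Act} {ξ : ℕ → Act} (h : ξ ∈ L.Inf) (n : ℕ) :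
    initSeg ξ n ∈ L.Tr := by
  obtain ⟨p, h0, hp⟩ := mem_Inf_iff.1 h
  exact ⟨p n, h0 ▸ InfFrom.weak_initSeg hp n⟩

theorem mem_alphabet_of_forall_initSeg {L : LTS.{u, v} Act} {ξ : ℕ → Act}
    (h : ∀ n, initSeg ξ n ∈ L.Tr) (i : ℕ) : ξ i ∈ L.alphabet :=
  mem_alphabet_of_mem_Tr (h (i + 1)) _ (by simp [initSeg_succ])

/-- The states that `L` can reach from `U` by a trace. -/
def post (L : LTS.{u, v} Act) (U : Set L.State) (σ : List Act) : Set L.State :=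
  {t | ∃ s ∈ U, L.Weak s σ t}

/-- The states that `L` can reach by `σ`. -/
def after (L : LTS.{u, v} Act) (σ : List Act) : Set L.State := {t | L.Weak L.init σ t}

theorem post_after (L : LTS.{u, v} Act) (σ ρ : List Act) :
    L.post (L.after σ) ρ = L.after (σ ++ ρ) := by
  ext t
  exact ⟨fun ⟨s, hs, h⟩ => hs.trans h, fun h => h.split⟩

theorem exists_diverges_mem_after {L : LTS.{u, v} Act} {σ : List Act} :
    (∃ s ∈ L.after σ, L.Diverges s) ↔ σ ∈ L.Div := Iff.rfl

/-! ### Monitors: a normal form for contexts -/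

/-- A context built from the operators, in a normal form. The monitor makes the moves `solo`
on its own. Through `sync q a x q'` it moves from `q` to `q'` jointly with an `a`-step of the
observed system, the joint step being labelled `x`. -/
structure Monitor (Act : Type u) where
  State : Type v
  alphabet : Set Act
  solo : State → Option Act → State → Prop
  sync : State → Act → Option Act → State → Prop
  init : State
  solo_alphabet : ∀ {q : State} {b : Act} {q' : State}, solo q (some b) q' → b ∈ alphabet
  sync_alphabet : ∀ {q : State} {a b : Act} {q' : State}, sync q a (some b) q' → b ∈ alphabet

/-- The system `Z` observed by the monitor `M`. -/
def Monitor.obs (M : Monitor.{u, v} Act) (Z : LTS.{u, v} Act) : LTS.{u, v} Act where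
  State := M.State × Z.State
  alphabet := M.alphabet
  step c x c' :=
    (M.solo c.1 x c'.1 ∧ c'.2 = c.2) ∨
    (x = none ∧ Z.step c.2 none c'.2 ∧ c'.1 = c.1) ∨
    ∃ a, Z.step c.2 (some a) c'.2 ∧ M.sync c.1 a x c'.1
  init := (M.init, Z.init)
  step_alphabet := by
    rintro c a c' (⟨h, -⟩ | ⟨h, -⟩ | ⟨a, -, h⟩)
    · exact M.solo_alphabet h
    · exact absurd h (by simp)
    · exact M.sync_alphabet h

/-- An infinite set of actions has room for codes of all the labels that occur in the
implementation of a monitor. This is the only use of the infinity of `Act` beyond the existence of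
two actions. -/
theorem exists_label_injection (Act : Type u) [Infinite Act] :
    ∃ f : (Act × Option Act) ⊕ Act → Act, Function.Injective f := by
  have h : Cardinal.mk ((Act × Option Act) ⊕ Act) ≤ Cardinal.mk Act := by
    have h0 := Cardinal.aleph0_le_mk Act
    have h1 : Cardinal.mk Act + 1 = Cardinal.mk Act := Cardinal.add_one_eq h0
    simp only [Cardinal.mk_sum, Cardinal.mk_prod, Cardinal.lift_id, Cardinal.mk_option, h1]
    rw [Cardinal.mul_eq_self h0, Cardinal.add_eq_self h0]
  obtain ⟨f⟩ := h
  exact ⟨f, f.injective⟩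

theorem eq_of_step_iff {S : Type v} {A A' : Set Act} {st st' : S → Option Act → S → Prop} {i : S}
    (hA : A = A') (hs : ∀ s x s', st s x s' ↔ st' s x s')
    (h : ∀ {s : S} {a : Act} {s' : S}, st s (some a) s' → a ∈ A)
    (h' : ∀ {s : S} {a : Act} {s' : S}, st' s (some a) s' → a ∈ A') :
    (⟨S, A, st, i, h⟩ : LTS.{u, v} Act) = ⟨S, A', st', i, h'⟩ := by
  obtain rfl := hA
  obtain rfl : st = st' := by
    funext s x s'
    exact propext (hs s x s')
  rfl

/-- The labels that a monitor may give to its steps. -/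
def Monitor.Label (M : Monitor.{u, v} Act) (x : Option Act) : Prop :=
  x = none ∨ ∃ b ∈ M.alphabet, x = some b

theorem Monitor.label_of_sync (M : Monitor.{u, v} Act) {q q' : M.State} {a : Act}
    {x : Option Act} (h : M.sync q a x q') : M.Label x := by
  cases x with
  | none => exact Or.inl rfl
  | some b => exact Or.inr ⟨b, M.sync_alphabet h, rfl⟩

/-- The monitor as an LTS. Its joint steps carry labels that encode the pair `(a, x)`. -/
def Monitor.toLTS (M : Monitor.{u, v} Act) (f : (Act × Option Act) ⊕ Act → Act) (B : Set Act) :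
    LTS.{u, v} Act where
  State := M.State
  alphabet := {c | ∃ a ∈ B, ∃ x, M.Label x ∧ c = f (Sum.inl (a, x))} ∪
    {c | ∃ b ∈ M.alphabet, c = f (Sum.inr b)}
  step q y q' :=
    (y = none ∧ M.solo q none q') ∨
    (∃ b, y = some (f (Sum.inr b)) ∧ M.solo q (some b) q') ∨
    ∃ a ∈ B, ∃ x, y = some (f (Sum.inl (a, x))) ∧ M.sync q a x q'
  init := M.init
  step_alphabet := by
    rintro q c q' (⟨h, -⟩ | ⟨b, h, h'⟩ | ⟨a, ha, x, h, h'⟩)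
    · exact absurd h (by simp)
    · exact Or.inr ⟨b, M.solo_alphabet h', Option.some.inj h⟩
    · exact Or.inl ⟨a, ha, x, M.label_of_sync h', Option.some.inj h⟩

/-- Observation by a monitor is a composition of renaming, parallel composition and hiding: every
`a` of `Z` is first renamed to all the codes of pairs `(a, x)`, the monitor decides which of them
may happen, and then the pairs `(a, none)` are hidden and the pairs `(a, some b)` become `b`. -/
theorem Monitor.obs_eq (M : Monitor.{u, v} Act) (Z : LTS.{u, v} Act)
    {f : (Act × Option Act) ⊕ Act → Act} (hf : Function.Injective f) :
    M.obs Z = (((M.toLTS f Z.alphabet).par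
      (Z.rename {p | ∃ x, M.Label x ∧ p.2 = f (Sum.inl (p.1, x))})).hide
        {c | ∃ a, c = f (Sum.inl (a, none))}).rename
          {p | (∃ a, p.1 = f (Sum.inl (a, some p.2))) ∨ p.1 = f (Sum.inr p.2)} := by
  have hR : ∀ a c, RenamesTo {p | ∃ x, M.Label x ∧ p.2 = f (Sum.inl (p.1, x))} a c ↔
      ∃ x, M.Label x ∧ c = f (Sum.inl (a, x)) := by
    intro a c
    refine ⟨?_, fun h => Or.inl h⟩
    rintro (h | ⟨-, h⟩)
    · exact h
    · exact absurd (⟨none, Or.inl rfl, rfl⟩ : ∃ x, M.Label x ∧ _ = f (Sum.inl (a, x))) (h _)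
  have hl : ∀ a b c, RenamesTo {p : Act × Act |
      (∃ a, p.1 = f (Sum.inl (a, some p.2))) ∨ p.1 = f (Sum.inr p.2)}
        (f (Sum.inl (a, some b))) c ↔ c = b := by
    intro a b c
    constructor
    · rintro ((⟨a', h⟩ | h) | ⟨-, h⟩)
      · have := hf h; simp_all
      · have := hf h; simp_all
      · exact absurd (Or.inl ⟨a, rfl⟩) (h b)
    · rintro rfl
      exact Or.inl (Or.inl ⟨a, rfl⟩)
  have hr : ∀ b c, RenamesTo {p : Act × Act |
      (∃ a, p.1 = f (Sum.inl (a, some p.2))) ∨ p.1 = f (Sum.inr p.2)}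
        (f (Sum.inr b)) c ↔ c = b := by
    intro b c
    constructor
    · rintro ((⟨a', h⟩ | h) | ⟨-, h⟩)
      · have := hf h; simp_all
      · have := hf h; simp_all
      · exact absurd (Or.inr rfl) (h b)
    · rintro rfl
      exact Or.inl (Or.inr rfl)
  have hZA : (Z.rename {p | ∃ x, M.Label x ∧ p.2 = f (Sum.inl (p.1, x))}).alphabet =
      {c | ∃ a ∈ Z.alphabet, ∃ x, M.Label x ∧ c = f (Sum.inl (a, x))} := by
    ext c
    exact exists_congr fun a => and_congr_right fun _ => hR a c
  refine eq_of_step_iff ?_ ?_ ?_ ?_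
  · ext b
    constructor
    · intro hb
      refine ⟨f (Sum.inr b), ⟨Or.inl (Or.inr ⟨b, hb, rfl⟩), ?_⟩, (hr b b).2 rfl⟩
      rintro ⟨a, h⟩
      have := hf h; simp_all
    · rintro ⟨c, ⟨hc, hc'⟩, hcb⟩
      rw [show ((M.toLTS f Z.alphabet).par _).alphabet = _ ∪ _ from rfl, hZA] at hc
      rcases hc with (⟨a, ha, x, hx, rfl⟩ | ⟨b', hb', rfl⟩) | ⟨a, ha, x, hx, rfl⟩
      · rcases hx with rfl | ⟨b', hb', rfl⟩
        · exact absurd ⟨a, rfl⟩ hc'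
        · rw [hl] at hcb; exact hcb ▸ hb'
      · rw [hr] at hcb; exact hcb ▸ hb'
      · rcases hx with rfl | ⟨b', hb', rfl⟩
        · exact absurd ⟨a, rfl⟩ hc'
        · rw [hl] at hcb; exact hcb ▸ hb'
  · rintro ⟨q, z⟩ x ⟨q', z'⟩
    have hpar : ∀ y, ((M.toLTS f Z.alphabet).par
        (Z.rename {p | ∃ x, M.Label x ∧ p.2 = f (Sum.inl (p.1, x))})).step (q, z) y (q', z') ↔
        (y = none ∧ M.solo q none q' ∧ z' = z) ∨
        (∃ b, y = some (f (Sum.inr b)) ∧ M.solo q (some b) q' ∧ z' = z) ∨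
        (y = none ∧ Z.step z none z' ∧ q' = q) ∨
        ∃ a x, y = some (f (Sum.inl (a, x))) ∧ Z.step z (some a) z' ∧ M.sync q a x q' := by
      intro y
      simp only [par, hZA]
      constructor
      · rintro (⟨hy, (⟨rfl, h⟩ | ⟨b, rfl, h⟩ | ⟨a, ha, x, rfl, h⟩), hz⟩ |
          ⟨hy, (⟨rfl, h⟩ | ⟨a, c, rfl, h, h'⟩), hz⟩ |
          ⟨⟨c, hc, rfl⟩, (⟨h0, h⟩ | ⟨b, hb, h⟩ | ⟨a, ha, x, hx, h⟩), h'⟩)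
        · exact Or.inl ⟨rfl, h, hz⟩
        · exact Or.inr (Or.inl ⟨b, rfl, h, hz⟩)
        · exact absurd ⟨_, ⟨a, ha, x, M.label_of_sync h, rfl⟩, rfl⟩ hy
        · exact Or.inr (Or.inr (Or.inl ⟨rfl, h, hz⟩))
        · obtain ⟨x, hx, rfl⟩ := (hR _ _).1 h'
          exact absurd ⟨_, Or.inl ⟨a, Z.step_alphabet h, x, hx, rfl⟩, rfl⟩ hy
        · exact absurd h0 (by simp)
        · obtain ⟨a, -, x, -, rfl⟩ := hc.2
          have := hf (Option.some.inj hb); simp_all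
        · obtain rfl := Option.some.inj hx
          rcases h' with ⟨h0, -⟩ | ⟨a', c', h1, h2, h3⟩
          · exact absurd h0 (by simp)
          · obtain rfl := Option.some.inj h1
            obtain ⟨x', -, h4⟩ := (hR _ _).1 h3
            have h5 := hf h4
            simp only [Sum.inl.injEq, Prod.mk.injEq] at h5
            obtain ⟨rfl, rfl⟩ := h5
            exact Or.inr (Or.inr (Or.inr ⟨a, x, rfl, h2, h⟩))
      · rintro (⟨rfl, h, hz⟩ | ⟨b, rfl, h, hz⟩ | ⟨rfl, h, hz⟩ | ⟨a, x, rfl, h, h'⟩)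
        · exact Or.inl ⟨by simp, Or.inl ⟨rfl, h⟩, hz⟩
        · refine Or.inl ⟨?_, Or.inr (Or.inl ⟨b, rfl, h⟩), hz⟩
          rintro ⟨c, ⟨a, -, x, -, rfl⟩, hc⟩
          have := hf (Option.some.inj hc); simp_all
        · exact Or.inr (Or.inl ⟨by simp, Or.inl ⟨rfl, h⟩, hz⟩)
        · have hx := M.label_of_sync h'
          have ha := Z.step_alphabet h
          exact Or.inr (Or.inr ⟨⟨_, ⟨Or.inl ⟨a, ha, x, hx, rfl⟩, ⟨a, ha, x, hx, rfl⟩⟩, rfl⟩,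
            Or.inr (Or.inr ⟨a, ha, x, rfl, h'⟩),
            Or.inr ⟨a, _, rfl, h, (hR _ _).2 ⟨x, hx, rfl⟩⟩⟩)
    have hhide : ∀ y, ((∃ w, ((M.toLTS f Z.alphabet).par
        (Z.rename {p | ∃ x, M.Label x ∧ p.2 = f (Sum.inl (p.1, x))})).step (q, z) w (q', z') ∧
          ((y = w ∧ w ∉ some '' {c | ∃ a, c = f (Sum.inl (a, none))}) ∨
            (y = none ∧ w ∈ some '' {c | ∃ a, c = f (Sum.inl (a, none))}))) ↔
        (y = none ∧ M.solo q none q' ∧ z' = z) ∨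
        (∃ b, y = some (f (Sum.inr b)) ∧ M.solo q (some b) q' ∧ z' = z) ∨
        (y = none ∧ Z.step z none z' ∧ q' = q) ∨
        (∃ a, y = none ∧ Z.step z (some a) z' ∧ M.sync q a none q') ∨
        ∃ a b, y = some (f (Sum.inl (a, some b))) ∧ Z.step z (some a) z' ∧
          M.sync q a (some b) q') := by
      intro y
      simp only [hpar]
      constructor
      · rintro ⟨w, h, (⟨rfl, hw⟩ | ⟨rfl, c, ⟨a, rfl⟩, rfl⟩)⟩
        · rcases h with ⟨rfl, h⟩ | ⟨b, rfl, h⟩ | ⟨rfl, h⟩ | ⟨a, x, rfl, h⟩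
          · exact Or.inl ⟨rfl, h⟩
          · exact Or.inr (Or.inl ⟨b, rfl, h⟩)
          · exact Or.inr (Or.inr (Or.inl ⟨rfl, h⟩))
          · cases x with
            | none => exact absurd ⟨_, ⟨a, rfl⟩, rfl⟩ hw
            | some b => exact Or.inr (Or.inr (Or.inr (Or.inr ⟨a, b, rfl, h⟩)))
        · rcases h with ⟨h0, -⟩ | ⟨b, hb, -⟩ | ⟨h0, h⟩ | ⟨a', x, hx, h⟩
          · exact absurd h0 (by simp)
          · have := hf (Option.some.inj hb); simp_all
          · exact absurd h0 (by simp)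
          · have h5 := hf (Option.some.inj hx)
            simp only [Sum.inl.injEq, Prod.mk.injEq] at h5
            obtain ⟨rfl, rfl⟩ := h5
            exact Or.inr (Or.inr (Or.inr (Or.inl ⟨a, rfl, h⟩)))
      · rintro (⟨rfl, h⟩ | ⟨b, rfl, h⟩ | ⟨rfl, h⟩ | ⟨a, rfl, h⟩ | ⟨a, b, rfl, h⟩)
        · exact ⟨_, Or.inl ⟨rfl, h⟩, Or.inl ⟨rfl, by simp⟩⟩
        · refine ⟨_, Or.inr (Or.inl ⟨b, rfl, h⟩), Or.inl ⟨rfl, ?_⟩⟩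
          rintro ⟨c, ⟨a, rfl⟩, hc⟩
          have := hf (Option.some.inj hc); simp_all
        · exact ⟨_, Or.inr (Or.inr (Or.inl ⟨rfl, h⟩)), Or.inl ⟨rfl, by simp⟩⟩
        · exact ⟨_, Or.inr (Or.inr (Or.inr ⟨a, none, rfl, h⟩)), Or.inr ⟨rfl, _, ⟨a, rfl⟩, rfl⟩⟩
        · refine ⟨_, Or.inr (Or.inr (Or.inr ⟨a, some b, rfl, h⟩)), Or.inl ⟨rfl, ?_⟩⟩
          rintro ⟨c, ⟨a, rfl⟩, hc⟩
          have := hf (Option.some.inj hc); simp_all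
    constructor
    · rintro (⟨h, hz⟩ | ⟨rfl, h⟩ | ⟨a, h, h'⟩)
      · cases x with
        | none => exact Or.inl ⟨rfl, (hhide none).2 (Or.inl ⟨rfl, h, hz⟩)⟩
        | some b =>
          exact Or.inr ⟨_, b, rfl, (hhide _).2 (Or.inr (Or.inl ⟨b, rfl, h, hz⟩)), (hr b b).2 rfl⟩
      · exact Or.inl ⟨rfl, (hhide none).2 (Or.inr (Or.inr (Or.inl ⟨rfl, h⟩)))⟩
      · cases x with
        | none =>
          exact Or.inl ⟨rfl, (hhide none).2 (Or.inr (Or.inr (Or.inr (Or.inl ⟨a, rfl, h, h'⟩))))⟩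
        | some b =>
          exact Or.inr ⟨_, b, rfl, (hhide _).2
            (Or.inr (Or.inr (Or.inr (Or.inr ⟨a, b, rfl, h, h'⟩)))), (hl a b b).2 rfl⟩
    · rintro (⟨rfl, h⟩ | ⟨c, b, rfl, h, hcb⟩)
      · rcases (hhide none).1 h with ⟨-, h⟩ | ⟨b, hb, -⟩ | ⟨-, h⟩ | ⟨a, -, h⟩ | ⟨a, b, hb, -⟩
        · exact Or.inl h
        · exact absurd hb (by simp)
        · exact Or.inr (Or.inl ⟨rfl, h⟩)
        · exact Or.inr (Or.inr ⟨a, h⟩)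
        · exact absurd hb (by simp)
      · rcases (hhide (some c)).1 h with ⟨h0, -⟩ | ⟨b', hb, h2⟩ | ⟨h0, -⟩ | ⟨a, h0, -⟩ |
          ⟨a, b', hb, h2⟩
        · exact absurd h0 (by simp)
        · obtain rfl := Option.some.inj hb
          obtain rfl := (hr _ _).1 hcb
          exact Or.inl h2
        · exact absurd h0 (by simp)
        · exact absurd h0 (by simp)
        · obtain rfl := Option.some.inj hb
          obtain rfl := (hl _ _ _).1 hcb
          exact Or.inr (Or.inr ⟨a, h2⟩)
  · exact fun h => (M.obs Z).step_alphabet h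
  · exact fun h => (LTS.rename (LTS.hide (LTS.par _ _) _) _).step_alphabet h

/-- The alphabets are required to agree because the codes of joint steps in `Monitor.toLTS` range
over the alphabet of the observed system. -/
theorem IsCongruence.obs [Infinite Act] {r : LTS.{u, v} Act → LTS.{u, v} Act → Prop}
    (hr : IsCongruence r) (M : Monitor.{u, v} Act) {Z Z' : LTS.{u, v} Act}
    (hA : Z.alphabet = Z'.alphabet) (h : r Z Z') : r (M.obs Z) (M.obs Z') := by
  obtain ⟨f, hf⟩ := exists_label_injection Act
  rw [M.obs_eq Z hf, M.obs_eq Z' hf, hA]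
  exact hr.rename _ (hr.hide _ (hr.par_left _ (hr.rename _ h)))

/-! ### Trackers: monitors that follow a given sequence of actions -/

open Classical in
/-- The tracker counts the visible actions of the observed system and lets the `i`-th one pass only
if it belongs to `F i`. It shows that action as `h` if `i ∈ V` and hides it otherwise. At the
positions in `D` the tracker has a `τ`-loop. -/
def tracker (h : Act) (F : ℕ → Set Act) (V D : Set ℕ) : Monitor.{u, v} Act where
  State := ULift.{v} ℕ
  alphabet := {h}
  solo i x j := i.down ∈ D ∧ x = none ∧ j = i
  sync i a x j := a ∈ F i.down ∧ j = ⟨i.down + 1⟩ ∧ x = if i.down ∈ V then some h else none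
  init := ⟨0⟩
  solo_alphabet h := absurd h.2.1 (by simp)
  sync_alphabet := by
    rintro i a b j ⟨-, -, h⟩
    split_ifs at h
    exact Option.some.inj h

open Classical in
/-- The number of actions that the tracker has shown when it is at position `i`. -/
noncomputable def shown (V : Set ℕ) (i : ℕ) : ℕ := Nat.count (· ∈ V) i

@[simp]
theorem shown_zero (V : Set ℕ) : shown V 0 = 0 := by classical exact Nat.count_zero _

theorem shown_succ_of_mem {V : Set ℕ} {i : ℕ} (hi : i ∈ V) : shown V (i + 1) = shown V i + 1 := by
  rw [shown, shown, Nat.count_succ, if_pos hi]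

theorem shown_succ_of_notMem {V : Set ℕ} {i : ℕ} (hi : i ∉ V) : shown V (i + 1) = shown V i := by
  rw [shown, shown, Nat.count_succ, if_neg hi, add_zero]

theorem shown_mono (V : Set ℕ) : Monotone (shown V) := by
  classical exact Nat.count_monotone _

theorem shown_eq_zero {V : Set ℕ} {i : ℕ} (hi : ∀ k < i, k ∉ V) : shown V i = 0 := by
  classical
  rw [shown, Nat.count_iff_forall_not]
  exact fun k => hi k

/-- The list `ρ` is let pass by the tracker. -/
def Fits (F : ℕ → Set Act) (ρ : List Act) : Prop := ∀ k a, ρ[k]? = some a → a ∈ F k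

theorem Fits.of_append {F : ℕ → Set Act} {ρ κ : List Act} (h : Fits F (ρ ++ κ)) : Fits F ρ := by
  intro k a hk
  refine h k a ?_
  obtain ⟨hlt, -⟩ := List.getElem?_eq_some_iff.1 hk
  rw [List.getElem?_append_left hlt, hk]

theorem Fits.snoc {F : ℕ → Set Act} {ρ : List Act} {a : Act} (h : Fits F ρ)
    (ha : a ∈ F ρ.length) : Fits F (ρ ++ [a]) := by
  intro k b hk
  rcases lt_trichotomy k ρ.length with hlt | rfl | hlt
  · rw [List.getElem?_append_left hlt] at hk
    exact h k b hk
  · rw [List.getElem?_append_right le_rfl] at hk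
    obtain rfl : a = b := by simpa using hk
    exact ha
  · rw [List.getElem?_eq_none (by simp; omega)] at hk
    cases hk

section Track

variable {h : Act} {F : ℕ → Set Act} {V D : Set ℕ} {L : LTS.{u, v} Act}

open Classical in
theorem track_weak_of_weak {s t : L.State} {ρ : List Act} (hw : L.Weak s ρ t) (i : ℕ)
    (hρ : ∀ k a, ρ[k]? = some a → a ∈ F (i + k)) :
    ((tracker h F V D).obs L).Weak (⟨i⟩, s)
      (List.replicate (shown V (i + ρ.length) - shown V i) h)
      (⟨i + ρ.length⟩, t) := by
  induction hw generalizing i with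
  | refl s => simpa using Weak.refl _
  | @tau s s' s'' ρ h1 _ ih =>
    have hstep : ((tracker h F V D).obs L).step (⟨i⟩, s) none (⟨i⟩, s') :=
      Or.inr (Or.inl ⟨rfl, h1, rfl⟩)
    exact .tau hstep (ih i hρ)
  | @vis s s' s'' a ρ h1 _ ih =>
    have ha : a ∈ F i := hρ 0 a rfl
    have h2 := ih (i + 1) fun k b hk => by
      have := hρ (k + 1) b (by simpa using hk)
      rwa [← add_assoc, add_right_comm] at this
    have he : i + 1 + ρ.length = i + (a :: ρ).length := by
      rw [List.length_cons]; omega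
    rw [he] at h2
    have hm : shown V (i + 1) ≤ shown V (i + (a :: ρ).length) :=
      shown_mono V (by rw [List.length_cons]; omega)
    have hstep : ((tracker h F V D).obs L).step (⟨i⟩, s) (if i ∈ V then some h else none)
        (⟨i + 1⟩, s') := Or.inr (Or.inr ⟨a, h1, ha, rfl, rfl⟩)
    split_ifs at hstep with hV
    · rw [shown_succ_of_mem hV] at h2 hm
      have : shown V (i + (a :: ρ).length) - shown V i =
          (shown V (i + (a :: ρ).length) - (shown V i + 1)) + 1 := by omega
      rw [this, List.replicate_succ]
      exact .vis hstep h2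
    · rw [shown_succ_of_notMem hV] at h2
      exact .tau hstep h2

/-- The executions of a tracked system: it has made a trace that fits, and shows `h` as often as
the position prescribes. -/
theorem track_weak_iff {κ : List Act} {i : ULift.{v} ℕ} {s : L.State} :
    ((tracker h F V D).obs L).Weak ((tracker h F V D).obs L).init κ (i, s) ↔
      ∃ ρ : List Act, ρ.length = i.down ∧ Fits F ρ ∧ L.Weak L.init ρ s ∧
        κ = List.replicate (shown V i.down) h := by
  constructor
  · have key : ∀ {c c' : ((tracker h F V D).obs L).State} {κ' : List Act},
        ((tracker h F V D).obs L).Weak c κ' c' → ∀ κ₀ : List Act,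
        (∃ ρ : List Act, ρ.length = c.1.down ∧ Fits F ρ ∧ L.Weak L.init ρ c.2 ∧
          κ₀ = List.replicate (shown V c.1.down) h) →
        ∃ ρ : List Act, ρ.length = c'.1.down ∧ Fits F ρ ∧ L.Weak L.init ρ c'.2 ∧
          κ₀ ++ κ' = List.replicate (shown V c'.1.down) h := by
      intro c c' κ' hw
      induction hw with
      | refl c => intro κ₀ h0; simpa using h0
      | tau h1 _ ih =>
        rintro κ₀ ⟨ρ, hl, hF, hρ, hκ⟩
        refine ih κ₀ ?_
        rcases h1 with ⟨⟨-, -, h2⟩, h3⟩ | ⟨-, h2, h3⟩ | ⟨a, h2, h3, h4, h5⟩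
        · rw [h2, h3]; exact ⟨ρ, hl, hF, hρ, hκ⟩
        · rw [h3]; exact ⟨ρ, hl, hF, hρ.trans_nil (.single_tau h2), hκ⟩
        · refine ⟨ρ ++ [a], by simp [h4, hl], hF.snoc (hl ▸ h3), hρ.trans (.single h2), ?_⟩
          split_ifs at h5 with hV
          rw [h4, shown_succ_of_notMem hV, hκ]
      | @vis c c₁ c₂ b κ' h1 _ ih =>
        rintro κ₀ ⟨ρ, hl, hF, hρ, hκ⟩
        rw [← List.singleton_append, ← List.append_assoc]
        refine ih _ ?_
        rcases h1 with ⟨⟨-, h2, -⟩, h3⟩ | ⟨h2, -⟩ | ⟨a, h2, h3, h4, h5⟩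
        · exact absurd h2 (by simp)
        · exact absurd h2 (by simp)
        · refine ⟨ρ ++ [a], by simp [h4, hl], hF.snoc (hl ▸ h3), hρ.trans (.single h2), ?_⟩
          split_ifs at h5 with hV
          obtain rfl := Option.some.inj h5
          rw [h4, shown_succ_of_mem hV, hκ, List.replicate_succ']
    intro hw
    simpa using key hw [] ⟨[], rfl, fun k a hk => by simp at hk, .refl _, by
      show _ = List.replicate (shown V 0) h
      simp⟩
  · rintro ⟨ρ, hl, hF, hρ, rfl⟩
    have := track_weak_of_weak (h := h) (V := V) (D := D) hρ 0
      (fun k a hk => by rw [Nat.zero_add]; exact hF k a hk)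
    simp only [Nat.zero_add, hl, shown_zero, Nat.sub_zero] at this
    exact this

theorem track_diverges_of_diverges {s : L.State} (hs : L.Diverges s) (i : ULift.{v} ℕ) :
    ((tracker h F V D).obs L).Diverges (i, s) :=
  Diverges.of_forall_step (fun c : ULift ℕ × L.State => c.1 = i ∧ L.Diverges c.2)
    (fun c hc => by
      obtain ⟨s', h1, h2⟩ := hc.2.exists_step
      exact ⟨(i, s'), Or.inr (Or.inl ⟨rfl, h1, hc.1.symm⟩), rfl, h2⟩) ⟨rfl, hs⟩

theorem track_diverges_of_mem {s : L.State} {i : ULift.{v} ℕ} (hi : i.down ∈ D) :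
    ((tracker h F V D).obs L).Diverges (i, s) :=
  Diverges.of_forall_step (fun c : ULift ℕ × L.State => c.1 = i)
    (fun c hc => ⟨c, Or.inl ⟨⟨hc ▸ hi, rfl, rfl⟩, rfl⟩, hc⟩) rfl

/-- A divergence of a tracked system is either one of the system or goes on after a hidden
action. -/
theorem track_diverges_step {s : L.State} {i : ℕ} (hi : i ∉ D) (hs : ¬ L.Diverges s)
    (hd : ((tracker h F V D).obs L).Diverges (⟨i⟩, s)) :
    i ∉ V ∧ ∃ a ∈ F i, ∃ t, L.Weak s [a] t ∧
      ((tracker h F V D).obs L).Diverges (⟨i + 1⟩, t) := by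
  have hacc := not_diverges_iff_acc.1 hs
  clear hs
  induction hacc with
  | intro s _ ih =>
    obtain ⟨⟨j, t⟩, h1, h2⟩ := hd.exists_step
    rcases h1 with ⟨⟨h3, -⟩, -⟩ | ⟨-, h3, h4⟩ | ⟨a, h3, h4, h5, h6⟩
    · exact absurd h3 hi
    · obtain rfl : j = ⟨i⟩ := h4
      obtain ⟨hV, a, ha, w, hw, hw'⟩ := ih t h3 h2
      exact ⟨hV, a, ha, w, .tau h3 hw, hw'⟩
    · obtain rfl : j = ⟨i + 1⟩ := h5
      refine ⟨fun hV => ?_, a, h4, t, .single h3, h2⟩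
      rw [if_pos hV] at h6
      exact absurd h6 (by simp)

/-- If the system does not diverge along a divergence of the tracked system, then the tracker
hides one action after the other. -/
theorem track_diverges_forever {ρ : List Act} {s : L.State}
    (hL : ∀ κ, ρ <+: κ → Fits F κ → κ ∉ L.Div) (hρ : Fits F ρ) (hs : L.Weak L.init ρ s)
    (hd : ((tracker h F V ∅).obs L).Diverges (⟨ρ.length⟩, s)) {n : ℕ} (hn : ρ.length ≤ n) :
    n ∉ V ∧ (F n).Nonempty := by
  have key : ∃ κ, ρ <+: κ ∧ κ.length = n ∧ Fits F κ ∧ ∃ t, L.Weak L.init κ t ∧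
      ((tracker h F V ∅).obs L).Diverges (⟨n⟩, t) := by
    induction n, hn using Nat.le_induction with
    | base => exact ⟨ρ, List.prefix_rfl, rfl, hρ, s, hs, hd⟩
    | succ n _ ih =>
      obtain ⟨κ, h1, h2, h3, t, h4, h5⟩ := ih
      obtain ⟨-, a, ha, w, hw, hw'⟩ := track_diverges_step (Set.notMem_empty _)
        (fun h6 => hL κ h1 h3 ⟨t, h4, h6⟩) h5
      exact ⟨κ ++ [a], h1.trans (List.prefix_append _ _), by simp [h2],
        h3.snoc (h2 ▸ ha), w, h4.trans hw, hw'⟩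
  obtain ⟨κ, h1, h2, h3, t, h4, h5⟩ := key
  obtain ⟨h6, a, ha, -⟩ := track_diverges_step (Set.notMem_empty _)
        (fun h6 => hL κ h1 h3 ⟨t, h4, h6⟩) h5
  exact ⟨h6, a, ha⟩

end Track

/-- The tracker follows `σ` and then allows one more action, from `A`. -/
def finTrack (σ : List Act) (A : Set Act) (k : ℕ) : Set Act :=
  {a | σ[k]? = some a ∨ (k = σ.length ∧ a ∈ A)}

/-- The tracker follows the infinite sequence `ξ`. -/
def infTrack (ξ : ℕ → Act) (k : ℕ) : Set Act := {ξ k}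

theorem fits_finTrack {σ ρ : List Act} {A : Set Act} :
    Fits (finTrack σ A) ρ ↔ ρ <+: σ ∨ ∃ a ∈ A, ρ = σ ++ [a] := by
  constructor
  · intro hF
    induction ρ using List.reverseRecOn with
    | nil => exact Or.inl List.nil_prefix
    | append_singleton ρ b ih =>
      have hb := hF ρ.length b (by simp)
      rcases ih hF.of_append with h | ⟨a, -, rfl⟩
      · rcases hb with hb | ⟨hb, hA⟩
        · left
          obtain ⟨κ, rfl⟩ := h
          rw [List.getElem?_append_right le_rfl, Nat.sub_self] at hb
          cases κ with
          | nil => simp at hb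
          | cons c κ =>
            obtain rfl : c = b := by simpa using hb
            exact ⟨κ, by simp⟩
        · obtain rfl := h.eq_of_length hb
          exact Or.inr ⟨b, hA, rfl⟩
      · rcases hb with hb | ⟨hb, -⟩
        · rw [List.getElem?_eq_none (by simp)] at hb
          cases hb
        · simp at hb
  · rintro (⟨κ, rfl⟩ | ⟨a, ha, rfl⟩) k b hk
    · obtain ⟨hlt, -⟩ := List.getElem?_eq_some_iff.1 hk
      left
      rw [List.getElem?_append_left hlt, hk]
    · rcases lt_or_ge k σ.length with hlt | hge
      · rw [List.getElem?_append_left hlt] at hk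
        exact Or.inl hk
      · right
        obtain ⟨hlt, hk'⟩ := List.getElem?_eq_some_iff.1 hk
        obtain rfl : k = σ.length := by simp at hlt; omega
        refine ⟨rfl, ?_⟩
        simp at hk'
        exact hk' ▸ ha

theorem fits_infTrack {ξ : ℕ → Act} {ρ : List Act} :
    Fits (infTrack ξ) ρ ↔ ρ = initSeg ξ ρ.length := by
  constructor
  · intro hF
    refine List.ext_getElem (by simp [length_initSeg]) fun k h1 h2 => ?_
    have : ρ[k] = ξ k := hF k _ (List.getElem?_eq_getElem h1)
    rw [this]
    simp [initSeg]
  · intro hρ k a hk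
    rw [hρ] at hk
    simp only [initSeg, List.getElem?_map, Option.map_eq_some_iff] at hk
    obtain ⟨j, hj, rfl⟩ := hk
    obtain ⟨hlt, hj'⟩ := List.getElem?_eq_some_iff.1 hj
    simp at hj'
    exact hj' ▸ rfl

section InfTrack

variable {h : Act} {ξ : ℕ → Act} {V D : Set ℕ} {L : LTS.{u, v} Act}

theorem infTrack_weak_iff {κ : List Act} {i : ULift.{v} ℕ} {s : L.State} :
    ((tracker h (infTrack ξ) V D).obs L).Weak ((tracker h (infTrack ξ) V D).obs L).init κ (i, s) ↔
      L.Weak L.init (initSeg ξ i.down) s ∧ κ = List.replicate (shown V i.down) h := by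
  rw [track_weak_iff]
  constructor
  · rintro ⟨ρ, hl, hF, hρ, hκ⟩
    rw [fits_infTrack, hl] at hF
    exact ⟨hF ▸ hρ, hκ⟩
  · rintro ⟨hρ, hκ⟩
    exact ⟨_, length_initSeg _ _, fits_infTrack.2 (by rw [length_initSeg]), hρ, hκ⟩

/-- A tracker along `ξ` turns an infinite execution of `ξ` that is hidden from some point on into a
divergence; apart from that it only has the divergences of the system. -/
theorem infTrack_diverges {i : ℕ} {s : L.State} (hs : L.Weak L.init (initSeg ξ i) s)
    (hd : ((tracker h (infTrack ξ) V ∅).obs L).Diverges (⟨i⟩, s)) :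
    (∃ n ≥ i, initSeg ξ n ∈ L.Div) ∨ (ξ ∈ L.Inf ∧ ∀ n ≥ i, n ∉ V) := by
  by_contra! hcon
  obtain ⟨h1, h2⟩ := hcon
  have hI : ξ ∈ L.Inf := by
    refine mem_Inf_of_weak hs (InfFrom.of_forall_weak (fun n t => i ≤ n ∧
      L.Weak L.init (initSeg ξ n) t ∧ ((tracker h (infTrack ξ) V ∅).obs L).Diverges (⟨n⟩, t)) ?_
        ⟨le_rfl, hs, hd⟩)
    rintro n t ⟨hn, ht, htd⟩
    obtain ⟨-, a, rfl, w, hw, hw'⟩ := track_diverges_step (Set.notMem_empty _)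
      (fun h3 => h1 n hn ⟨t, ht, h3⟩) htd
    exact ⟨w, hw, by omega, by rw [initSeg_succ]; exact ht.trans hw, hw'⟩
  obtain ⟨n, hn, hV⟩ := h2 hI
  refine (track_diverges_forever (h := h) (V := V) (F := infTrack ξ) (ρ := initSeg ξ i) ?_ ?_ hs
    (by rwa [length_initSeg]) (by rwa [length_initSeg])).1 hV
  · intro κ hκ hF
    rw [fits_infTrack] at hF
    have := hκ.length_le
    rw [length_initSeg] at this
    rw [hF]
    exact h1 _ this
  · rw [fits_infTrack, length_initSeg]

theorem replicate_mem_Div_infTrack_of_Inf (hξ : ξ ∈ L.Inf) {n : ℕ} (hn : ∀ k ≥ n, k ∉ V) :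
    List.replicate (shown V n) h ∈ ((tracker h (infTrack ξ) V D).obs L).Div := by
  obtain ⟨p, q, hp0, hpq⟩ := hξ
  have hp : ∀ i, L.Weak (p i) [ξ i] (p (i + 1)) := fun i => (hpq i).1.trans (.single (hpq i).2)
  refine ⟨(⟨n⟩, p n), infTrack_weak_iff.2 ⟨hp0 ▸ InfFrom.weak_initSeg hp n, rfl⟩, ?_⟩
  refine Diverges.of_forall_step
    (fun c : ULift ℕ × L.State => n ≤ c.1.down ∧ L.Weak c.2 [] (q c.1.down)) ?_
    ⟨le_rfl, (hpq n).1⟩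
  rintro ⟨⟨i⟩, s⟩ ⟨hi, hs⟩
  generalize hκ : ([] : List Act) = κ at hs
  obtain ⟨w, hw⟩ : ∃ w, w = q i := ⟨_, rfl⟩
  change L.Weak s κ (q i) at hs
  rw [← hw] at hs
  cases hs with
  | refl =>
    subst hw
    refine ⟨(⟨i + 1⟩, p (i + 1)), Or.inr (Or.inr ⟨ξ i, (hpq i).2, rfl, rfl, ?_⟩), ?_, ?_⟩
    · rw [if_neg (hn i hi)]
    · show n ≤ i + 1
      exact Nat.le_succ_of_le hi
    · exact (hpq (i + 1)).1
  | tau h1 h2 => exact ⟨(⟨i⟩, _), Or.inr (Or.inl ⟨rfl, h1, rfl⟩), hi, hw ▸ hκ ▸ h2⟩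
  | vis => cases hκ

/-- A nonempty trace of a tracked system contains a step of the system by the next action of `ξ`,
which may have been hidden. -/
theorem infTrack_first_action {c c' : ((tracker h (infTrack ξ) V D).obs L).State} {κ : List Act}
    (hw : ((tracker h (infTrack ξ) V D).obs L).Weak c κ c') (hκ : κ ≠ []) :
    ∃ w κ', L.Weak c.2 [ξ c.1.down] w ∧
      ((tracker h (infTrack ξ) V D).obs L).Weak (⟨c.1.down + 1⟩, w) κ' c' ∧
        (κ' = κ ∨ κ' = κ.tail) := by
  induction hw with
  | refl => exact absurd rfl hκ
  | @tau c₀ c₁ c₂ κ h1 h2 ih =>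
    rcases h1 with ⟨⟨-, -, h3⟩, h4⟩ | ⟨-, h3, h4⟩ | ⟨a, h3, h4, h5, h6⟩
    · obtain ⟨w, κ', h7, h8, h9⟩ := ih hκ
      rw [h3] at h7 h8
      rw [h4] at h7
      exact ⟨w, κ', h7, h8, h9⟩
    · obtain ⟨w, κ', h7, h8, h9⟩ := ih hκ
      rw [h4] at h7 h8
      exact ⟨w, κ', .tau h3 h7, h8, h9⟩
    · obtain rfl : a = ξ c₀.1.down := h4
      refine ⟨c₁.2, κ, .single h3, ?_, Or.inl rfl⟩
      rw [← h5]
      exact h2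
  | @vis c₀ c₁ c₂ b κ h1 h2 ih =>
    rcases h1 with ⟨⟨-, h3, -⟩, -⟩ | ⟨h3, -⟩ | ⟨a, h3, h4, h5, h6⟩
    · exact absurd h3 (by simp)
    · exact absurd h3 (by simp)
    · obtain rfl : a = ξ c₀.1.down := h4
      refine ⟨c₁.2, κ, .single h3, ?_, Or.inr rfl⟩
      rw [← h5]
      exact h2

theorem mem_Inf_of_infTrack {η : ℕ → Act} (hη : η ∈ ((tracker h (infTrack ξ) V D).obs L).Inf) :
    ξ ∈ L.Inf := by
  rw [mem_Inf_iff] at hη ⊢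
  have := InfFrom.of_forall_weak (L := L) (ξ := ξ) (n := 0) (s := L.init)
    (fun n s => ∃ η, ((tracker h (infTrack ξ) V D).obs L).InfFrom (⟨n⟩, s) η) ?_ ⟨η, hη⟩
  · simpa using this
  rintro n s ⟨η, p, hp0, hp⟩
  obtain ⟨w, κ', h1, h2, h3⟩ := infTrack_first_action (hp 0) (by simp)
  rw [hp0] at h1 h2
  rcases h3 with rfl | rfl
  · refine ⟨w, h1, η, fun i => Nat.casesOn i (⟨n + 1⟩, w) fun i => p (i + 1), rfl, fun i => ?_⟩
    cases i with
    | zero => exact h2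
    | succ i => exact hp (i + 1)
  · refine ⟨w, h1, fun i => η (i + 1),
      fun i => Nat.casesOn i (⟨n + 1⟩, w) fun i => p (i + 2), rfl, fun i => ?_⟩
    cases i with
    | zero => exact h2.trans (hp 1)
    | succ i => exact hp (i + 2)

theorem const_mem_Inf_infTrack (hξ : ξ ∈ L.Inf) (hV : V.Infinite) :
    (fun _ => h) ∈ ((tracker h (infTrack ξ) V D).obs L).Inf := by
  classical
  obtain ⟨p, hp0, hp⟩ := mem_Inf_iff.1 hξ
  have hseg : ∀ i j, i ≤ j → ((tracker h (infTrack ξ) V D).obs L).Weak (⟨i⟩, p i)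
      (List.replicate (shown V j - shown V i) h) (⟨j⟩, p j) := by
    intro i j hij
    induction j, hij using Nat.le_induction with
    | base => simpa using Weak.refl _
    | succ j hij ih =>
      have h1 := track_weak_of_weak (h := h) (F := infTrack ξ) (V := V) (D := D) (hp j) j (by
        intro k a hk
        cases k with
        | zero => simp at hk; exact hk ▸ rfl
        | succ k => simp at hk)
      have h2 := ih.trans h1
      have hm := shown_mono V hij
      have hm' := shown_mono V (Nat.le_succ j)
      rw [← List.replicate_add, List.length_singleton, add_comm,
        Nat.sub_add_sub_cancel hm' hm] at h2
      exact h2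
  rw [mem_Inf_iff]
  have := InfFrom.of_forall_weak (L := (tracker h (infTrack ξ) V D).obs L) (ξ := fun _ => h)
    (n := 0) (s := ((tracker h (infTrack ξ) V D).obs L).init)
    (fun _ c => ∃ j m, ((tracker h (infTrack ξ) V D).obs L).Weak c (List.replicate m h) (⟨j⟩, p j))
    ?_ ⟨0, 0, hp0 ▸ .refl _⟩
  · exact this
  rintro - c ⟨j, m, hc⟩
  obtain ⟨j', m', hc'⟩ : ∃ j' m', ((tracker h (infTrack ξ) V D).obs L).Weak c
      (List.replicate (m' + 1) h) (⟨j'⟩, p j') := by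
    obtain ⟨k, hk, hjk⟩ := hV.exists_gt j
    have h1 := hc.trans (hseg j (k + 1) (by omega))
    rw [← List.replicate_add] at h1
    have hm := shown_mono V hjk.le
    rw [shown_succ_of_mem hk, Nat.sub_add_comm hm, ← add_assoc] at h1
    exact ⟨k + 1, m + (shown V k - shown V j), h1⟩
  rw [List.replicate_succ, ← List.singleton_append] at hc'
  obtain ⟨w, hw, hw'⟩ := hc'.split
  exact ⟨w, hw, j', m', hw'⟩

end InfTrack

/-! ### What a congruence that preserves `anF` preserves -/

theorem exists_of_not_preserves {β : Type*} {r : LTS.{u, v} Act → LTS.{u, v} Act → Prop}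
    (hr : Equivalence r) {X : LTS.{u, v} Act → Set β} (hX : ¬ Preserves r X) :
    ∃ L L', r L L' ∧ ∃ x ∈ X L, x ∉ X L' := by
  by_contra! hcon
  exact hX fun L L' h => Set.Subset.antisymm (hcon L L' h) (hcon L' L (hr.symm h))

/-- Initially `b.L` does not diverge and refuses every other action of its alphabet. -/
theorem anF_actPrefix {a b : Act} (hab : a ≠ b) {L : LTS.{u, v} Act} :
    (([] : List Act), ({a} : Set Act)) ∈ (L.actPrefix b).anF ↔ a ∈ L.alphabet := by
  have hstep : ∀ s, ¬ (L.actPrefix b).step (none : Option L.State) none s := by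
    rintro s (⟨t, t', h, -⟩ | ⟨-, h, -⟩)
    · exact absurd h (by simp)
    · exact absurd h (by simp)
  have hnd : ([] : List Act) ∉ (L.actPrefix b).Div := by
    rintro ⟨s, hs, hd⟩
    generalize hκ : ([] : List Act) = κ at hs
    cases hs with
    | refl =>
      obtain ⟨s', h, -⟩ := hd.exists_step
      exact hstep s' h
    | tau h _ => exact hstep _ h
    | vis => cases hκ
  constructor
  · rintro ⟨⟨h, -⟩, -⟩
    rcases h rfl with h | h
    · exact h
    · exact absurd h hab
  · intro h
    refine ⟨⟨fun c hc => Or.inl (hc ▸ h), none, .refl _, hstep, ?_⟩, ?_⟩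
    · rintro c rfl s (⟨t, t', h0, -⟩ | ⟨-, h0, -⟩)
      · exact absurd h0 (by simp)
      · exact hab (Option.some.inj h0)
    · intro h0
      obtain ⟨-, ρ, hρ, hd⟩ := mem_extT_iff.1 h0
      rw [List.prefix_nil.1 hρ] at hd
      exact hnd hd

theorem alphabet_eq_of_preserves_anF [Nontrivial Act]
    {r : LTS.{u, v} Act → LTS.{u, v} Act → Prop} (hr : IsCongruence r) (hF : Preserves r anF)
    {L L' : LTS.{u, v} Act} (h : r L L') : L.alphabet = L'.alphabet := by
  ext a
  obtain ⟨b, hb⟩ := exists_ne a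
  rw [← anF_actPrefix hb.symm (L := L), ← anF_actPrefix hb.symm (L := L'),
    hF _ _ (hr.actPrefix b h)]

theorem const_notMem_Inf {Z : LTS.{u, v} Act} {h : Act} {n : ℕ}
    (hn : ∀ κ ∈ Z.Tr, κ.length ≤ n) : (fun _ => h) ∉ Z.Inf := by
  intro hI
  have := hn _ (initSeg_mem_Tr_of_mem_Inf hI (n + 1))
  rw [length_initSeg] at this
  omega

section Preservation

variable [Infinite Act]

/-- If `σ` is a minimal divergence trace of one of two related systems and no prefix of `σ` is a
divergence trace of the other one, then following `σ` invisibly yields an initial divergence from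
the former system and a stable failure from the latter. -/
theorem preserves_minD_of_anF {r : LTS.{u, v} Act → LTS.{u, v} Act → Prop} (hr : IsCongruence r)
    (hF : Preserves r anF) : Preserves r minD := by
  have key : ∀ n, ∀ σ : List Act, σ.length = n → ∀ L L', r L L' → σ ∈ L.minD → σ ∈ L'.minD := by
    intro n
    induction n using Nat.strong_induction_on with
    | _ n ih =>
      intro σ hσn L L' h hσ
      by_contra hσ'
      obtain ⟨a₀⟩ : Nonempty Act := inferInstance
      have hno : ∀ ρ, ρ <+: σ → ρ ∉ L'.Div := by
        intro ρ hρ hd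
        obtain ⟨κ, hκ, hκ'⟩ := exists_minD_prefix hd
        by_cases he : κ = σ
        · exact hσ' (he ▸ hκ')
        · have hlt : κ.length < n := hσn ▸ lt_of_le_of_ne (hκ.trans hρ).length_le
            fun h0 => he ((hκ.trans hρ).eq_of_length h0)
          exact hσ.2 κ (hκ.trans hρ) he (ih _ hlt κ rfl L' L (hr.equivalence.symm h) hκ').1
      have hr' := hr.obs (tracker a₀ (finTrack σ ∅) ∅ ∅)
        (alphabet_eq_of_preserves_anF hr hF h) h
      have hdiv : [] ∈ ((tracker a₀ (finTrack σ ∅) ∅ ∅).obs L).Div := by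
        obtain ⟨s, hs, hd⟩ := hσ.1
        refine ⟨(⟨σ.length⟩, s), track_weak_iff.2 ⟨σ, rfl, ?_, hs, ?_⟩,
          track_diverges_of_diverges hd _⟩
        · exact fits_finTrack.2 (Or.inl List.prefix_rfl)
        · rw [shown_eq_zero (by simp), List.replicate_zero]
      have hndiv : [] ∉ ((tracker a₀ (finTrack σ ∅) ∅ ∅).obs L').Div := by
        rintro ⟨⟨⟨i⟩, s⟩, hs, hd⟩
        obtain ⟨ρ, rfl, hρF, hρ, -⟩ := track_weak_iff.1 hs
        have hle : ∀ κ, Fits (finTrack σ ∅) κ → κ <+: σ := fun κ hκ => by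
          simpa using fits_finTrack.1 hκ
        obtain ⟨-, a, ha⟩ := track_diverges_forever (fun κ _ hκ => hno κ (hle κ hκ)) hρF hρ hd
          (hle ρ hρF).length_le
        rcases ha with ha | ⟨-, ha⟩
        · simp at ha
        · exact ha
      have hmem : (([] : List Act), (∅ : Set Act)) ∈
          ((tracker a₀ (finTrack σ ∅) ∅ ∅).obs L').anF := by
        refine ⟨mem_Sf_empty_of_not_mem_Div (nil_mem_Tr _) hndiv, fun h0 => ?_⟩
        obtain ⟨-, ρ, hρ, hd⟩ := mem_extT_iff.1 h0
        rw [List.prefix_nil.1 hρ] at hd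
        exact hndiv hd
      rw [← hF _ _ hr'] at hmem
      exact hmem.2 (Div_subset_extT _ hdiv)
  intro L L' h
  ext σ
  exact ⟨key _ σ rfl L L' h, key _ σ rfl L' L (hr.equivalence.symm h)⟩

/-- A tracker that hides all of `ξ` turns the execution of `ξ` into an initial divergence, which is
a minimal one and hence preserved. -/
theorem preserves_anI {r : LTS.{u, v} Act → LTS.{u, v} Act → Prop} (hr : IsCongruence r)
    (hF : Preserves r anF) : Preserves r anI := by
  have key : ∀ L L', r L L' → L.anI ⊆ L'.anI := by
    intro L L' h ξ hξ
    obtain ⟨a₀⟩ : Nonempty Act := inferInstance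
    have hA := alphabet_eq_of_preserves_anF hr hF h
    have hE := extI_eq_of_minD_eq hA (preserves_minD_of_anF hr hF _ _ h)
    have hr' := hr.obs (tracker a₀ (infTrack ξ) ∅ ∅) hA h
    have hm := preserves_minD_of_anF hr hF _ _ hr'
    have h1 : [] ∈ ((tracker a₀ (infTrack ξ) ∅ ∅).obs L).Div := by
      simpa using replicate_mem_Div_infTrack_of_Inf (h := a₀) (V := ∅) (D := ∅) (n := 0) hξ.1
        (by simp)
    have h2 : [] ∈ ((tracker a₀ (infTrack ξ) ∅ ∅).obs L').Div := by
      apply minD_subset_Div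
      rw [← hm]
      exact ⟨h1, fun ρ hρ hne => absurd (List.prefix_nil.1 hρ) hne⟩
    obtain ⟨⟨⟨i⟩, s⟩, hs, hd⟩ := h2
    have hξ' : ξ ∉ L'.extI := hE ▸ hξ.2
    rcases infTrack_diverges (infTrack_weak_iff.1 hs).1 hd with ⟨n, -, hn⟩ | ⟨h3, -⟩
    · refine absurd (mem_extI_iff.2 ⟨?_, n, hn⟩) hξ'
      rw [← hA]
      exact mem_alphabet_of_forall_initSeg (initSeg_mem_Tr_of_mem_Inf hξ.1)
    · exact ⟨h3, hξ'⟩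
  exact fun L L' h => (key L L' h).antisymm (key L' L (hr.equivalence.symm h))

/-- If no prefix of `ξ` of length at least `n` is a divergence trace, then a tracker that hides `ξ`
from position `n` on diverges after `n` shown actions iff `ξ` is an infinite trace. -/
theorem preserves_eanI_of_Div {r : LTS.{u, v} Act → LTS.{u, v} Act → Prop}
    (hr : IsCongruence r) (hF : Preserves r anF) (hD : Preserves r Div) : Preserves r eanI := by
  classical
  have key : ∀ L L', r L L' → L.eanI ⊆ L'.eanI := by
    rintro L L' h ξ ⟨hξ, n, hn⟩
    obtain ⟨a₀⟩ : Nonempty Act := inferInstance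
    have hA := alphabet_eq_of_preserves_anF hr hF h
    have hr' := hr.obs (tracker a₀ (infTrack ξ) {k | k < n} ∅) hA h
    have h1 := replicate_mem_Div_infTrack_of_Inf (h := a₀) (V := {k | k < n}) (D := ∅) hξ (n := n)
      (by simp)
    rw [hD _ _ hr'] at h1
    rw [hD _ _ h] at hn
    obtain ⟨⟨⟨i⟩, s⟩, hs, hd⟩ := h1
    obtain ⟨h2, h3⟩ := infTrack_weak_iff.1 hs
    have hni : n ≤ i := by
      have h4 := congrArg List.length h3
      simp only [List.length_replicate] at h4
      by_contra! hlt
      have h5 := shown_succ_of_mem (V := {k | k < n}) hlt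
      have h6 := shown_mono {k | k < n} (Nat.succ_le_of_lt hlt)
      rw [Nat.succ_eq_add_one] at h6
      omega
    refine ⟨?_, n, hn⟩
    rcases infTrack_diverges h2 hd with ⟨m, hm, hm'⟩ | ⟨h3, -⟩
    · exact absurd hm' (hn m (hni.trans hm))
    · exact h3
  exact fun L L' h => (key L L' h).antisymm (key L' L (hr.equivalence.symm h))

end Preservation

/-! ### Related systems that differ in a prescribed way -/

/-- If the tracker shows only the last action of `σ`, then the tracked system shows `h` exactly when
all of `σ` has been executed. -/
theorem finTrack_last_weak {h : Act} {σ : List Act} (hσ : σ ≠ []) {D : Set ℕ}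
    {L : LTS.{u, v} Act} {κ : List Act} {i : ULift.{v} ℕ} {s : L.State}
    (hw : ((tracker h (finTrack σ ∅) {σ.length - 1} D).obs L).Weak
      ((tracker h (finTrack σ ∅) {σ.length - 1} D).obs L).init κ (i, s)) :
    (i.down < σ.length ∧ κ = []) ∨ (i.down = σ.length ∧ κ = [h] ∧ L.Weak L.init σ s) := by
  classical
  obtain ⟨ρ, hl, hF, hρ, rfl⟩ := track_weak_iff.1 hw
  have hpre : ρ <+: σ := by simpa using fits_finTrack.1 hF
  have hpos := List.length_pos_iff.2 hσ
  rcases hpre.length_le.lt_or_eq with hlt | heq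
  · left
    have : shown {σ.length - 1} i.down = 0 := by
      refine shown_eq_zero fun k hk hk' => ?_
      rw [Set.mem_singleton_iff] at hk'
      omega
    exact ⟨hl ▸ hlt, by rw [this, List.replicate_zero]⟩
  · right
    obtain rfl := hpre.eq_of_length heq
    refine ⟨hl.symm, ?_, hρ⟩
    have h1 : shown {ρ.length - 1} (ρ.length - 1) = 0 := by
      refine shown_eq_zero fun k hk hk' => ?_
      rw [Set.mem_singleton_iff] at hk'
      omega
    have h2 : shown {ρ.length - 1} (ρ.length - 1 + 1) = 1 := by
      rw [shown_succ_of_mem (Set.mem_singleton _), h1]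
    rw [Nat.sub_add_cancel hpos] at h2
    rw [← hl, h2]
    rfl

theorem finTrack_last_reach {h : Act} {σ : List Act} (hσ : σ ≠ []) {D : Set ℕ}
    {L : LTS.{u, v} Act} {s : L.State} (hs : L.Weak L.init σ s) :
    ((tracker h (finTrack σ ∅) {σ.length - 1} D).obs L).Weak
      ((tracker h (finTrack σ ∅) {σ.length - 1} D).obs L).init [h] (⟨σ.length⟩, s) := by
  classical
  have h1 := track_weak_iff (h := h) (V := {σ.length - 1}) (D := D) (F := finTrack σ ∅)
    (i := ⟨σ.length⟩) (s := s)
    (κ := List.replicate (shown {σ.length - 1} σ.length) h) |>.2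
      ⟨σ, rfl, fits_finTrack.2 (Or.inl List.prefix_rfl), hs, rfl⟩
  rcases finTrack_last_weak hσ h1 with ⟨h2, -⟩ | ⟨-, h2, -⟩
  · exact absurd h2 (lt_irrefl _)
  · exact h2 ▸ h1

section Witness

variable [Infinite Act]

/-- The tracker shows only the last action of a trace that is not preserved, and has `τ`-loops
everywhere so as to diverge there. -/
theorem exists_witness_Tr {r : LTS.{u, v} Act → LTS.{u, v} Act → Prop} (hr : IsCongruence r)
    (hF : Preserves r anF) (hT : ¬ Preserves r Tr) (h : Act) :
    ∃ Z Z' : LTS.{u, v} Act, r Z Z' ∧ [h] ∈ Z.Div ∧ [h] ∉ Z'.Tr := by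
  obtain ⟨L, L', hL, σ, ⟨s, hs⟩, hσ'⟩ := exists_of_not_preserves hr.equivalence hT
  have hne : σ ≠ [] := by
    rintro rfl
    exact hσ' (nil_mem_Tr _)
  refine ⟨_, _, hr.obs (tracker h (finTrack σ ∅) {σ.length - 1} Set.univ)
    (alphabet_eq_of_preserves_anF hr hF hL) hL,
    ⟨_, finTrack_last_reach hne hs, track_diverges_of_mem (Set.mem_univ _)⟩, ?_⟩
  rintro ⟨⟨i, t⟩, ht⟩
  rcases finTrack_last_weak hne ht with ⟨-, h1⟩ | ⟨-, -, h1⟩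
  · cases h1
  · exact hσ' ⟨t, h1⟩

/-- The tracker shows only the last action of a divergence trace that is not preserved. This trace
is not empty, as `minD` is preserved. -/
theorem exists_witness_Div {r : LTS.{u, v} Act → LTS.{u, v} Act → Prop} (hr : IsCongruence r)
    (hF : Preserves r anF) (hD : ¬ Preserves r Div) (h : Act) :
    ∃ Z Z' : LTS.{u, v} Act, r Z Z' ∧ [h] ∈ Z.Div ∧ [h] ∉ Z'.Div ∧
      (fun _ => h) ∉ Z.Inf ∧ (fun _ => h) ∉ Z'.Inf := by
  obtain ⟨L, L', hL, σ, hσ, hσ'⟩ := exists_of_not_preserves hr.equivalence hD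
  have hne : σ ≠ [] := by
    rintro rfl
    refine hσ' (minD_subset_Div _ ?_)
    rw [← preserves_minD_of_anF hr hF _ _ hL]
    exact ⟨hσ, fun ρ hρ hne => absurd (List.prefix_nil.1 hρ) hne⟩
  have hI : ∀ L : LTS.{u, v} Act, (fun _ => h) ∉
      ((tracker h (finTrack σ ∅) {σ.length - 1} ∅).obs L).Inf := by
    refine fun L => const_notMem_Inf (n := 1) ?_
    rintro κ ⟨⟨i, t⟩, ht⟩
    rcases finTrack_last_weak hne ht with ⟨-, rfl⟩ | ⟨-, rfl, -⟩ <;> simp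
  obtain ⟨s, hs, hd⟩ := hσ
  refine ⟨_, _, hr.obs (tracker h (finTrack σ ∅) {σ.length - 1} ∅)
    (alphabet_eq_of_preserves_anF hr hF hL) hL,
    ⟨_, finTrack_last_reach hne hs, track_diverges_of_diverges hd _⟩, ?_, hI _, hI _⟩
  rintro ⟨⟨⟨i⟩, t⟩, ht, htd⟩
  rcases finTrack_last_weak hne ht with ⟨-, h1⟩ | ⟨h0, -, h1⟩
  · cases h1
  · obtain rfl : i = σ.length := h0
    obtain ⟨-, a, ha, -⟩ := track_diverges_step (Set.notMem_empty _)
      (fun h2 => hσ' ⟨t, h1, h2⟩) htd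
    rcases ha with ha | ⟨-, ha⟩
    · simp at ha
    · exact ha

/-- For a failure `(σ, A)` that is not preserved, the tracker shows only the last action of `σ` and
one further action from `A`, both as `h`. -/
theorem exists_witness_snF {r : LTS.{u, v} Act → LTS.{u, v} Act → Prop} (hr : IsCongruence r)
    (hF : Preserves r anF) (hD : Preserves r Div) (hS : ¬ Preserves r snF) (h : Act) :
    ∃ Z Z' : LTS.{u, v} Act, r Z Z' ∧
      (∃ z, Z.Weak Z.init [h] z ∧ (∀ z', ¬ Z.step z none z') ∧ ∀ z', ¬ Z.step z (some h) z') ∧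
      (¬ ∃ z, Z'.Weak Z'.init [h] z ∧ (∀ z', ¬ Z'.step z none z') ∧
        ∀ z', ¬ Z'.step z (some h) z') ∧
      ([h] ∉ Z.Div ∧ [h, h] ∉ Z.Div ∧ (fun _ => h) ∉ Z.Inf) ∧
      ([h] ∉ Z'.Div ∧ [h, h] ∉ Z'.Div ∧ (fun _ => h) ∉ Z'.Inf) := by
  classical
  obtain ⟨L, L', hL, ⟨σ, A⟩, ⟨⟨hSf, hnD⟩, hsn⟩, hσ'⟩ := exists_of_not_preserves hr.equivalence hS
  simp only at hnD hsn
  have hDL := hD _ _ hL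
  have hA := alphabet_eq_of_preserves_anF hr hF hL
  have hSf' : (σ, A) ∉ L'.Sf := fun h0 => hσ' ⟨⟨h0, hDL ▸ hnD⟩, fun a ha => hDL ▸ hsn a ha⟩
  have hne : σ ≠ [] := by
    rintro rfl
    have h1 : (([] : List Act), A) ∈ L.anF := by
      refine ⟨hSf, fun h0 => ?_⟩
      obtain ⟨-, ρ, hρ, hd⟩ := mem_extT_iff.1 h0
      rw [List.prefix_nil.1 hρ] at hd
      exact hnD hd
    rw [hF _ _ hL] at h1
    exact hSf' h1.1
  have hpos := List.length_pos_iff.2 hne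
  set N := σ.length with hN
  -- one action is shown before position `N` is reached, and one more after it
  have hc0 : ∀ i < N, shown {N - 1, N} i = 0 := by
    intro i hi
    refine shown_eq_zero ?_
    rintro k hk (rfl | rfl) <;> omega
  have hc1 : shown {N - 1, N} N = 1 := by
    have h1 := shown_succ_of_mem (V := {N - 1, N}) (Set.mem_insert (N - 1) _)
    rwa [hc0 (N - 1) (by omega), Nat.sub_add_cancel hpos] at h1
  have hc2 : shown {N - 1, N} (N + 1) = 2 := by
    rw [shown_succ_of_mem (by simp), hc1]
  have hreach : ∀ (L : LTS.{u, v} Act) (κ : List Act) (i : ULift.{v} ℕ) (s : L.State),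
      ((tracker h (finTrack σ A) {N - 1, N} ∅).obs L).Weak
        ((tracker h (finTrack σ A) {N - 1, N} ∅).obs L).init κ (i, s) →
      (i.down < N ∧ κ = []) ∨ (i.down = N ∧ κ = [h] ∧ L.Weak L.init σ s) ∨
        (i.down = N + 1 ∧ κ = [h, h] ∧ ∃ a ∈ A, L.Weak L.init (σ ++ [a]) s) := by
    intro L κ i s hw
    obtain ⟨ρ, hl, hρF, hρ, rfl⟩ := track_weak_iff.1 hw
    rcases fits_finTrack.1 hρF with hpre | ⟨a, ha, rfl⟩
    · rcases hpre.length_le.lt_or_eq with hlt | heq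
      · exact Or.inl ⟨hl ▸ hlt, by rw [← hl, hc0 _ hlt]; rfl⟩
      · obtain rfl := hpre.eq_of_length heq
        exact Or.inr (Or.inl ⟨hl.symm, by rw [← hl, hc1]; rfl, hρ⟩)
    · rw [List.length_append, List.length_singleton] at hl
      exact Or.inr (Or.inr ⟨hl.symm, by rw [← hl, hc2]; rfl, a, ha, hρ⟩)
  have hnd : ∀ L : LTS.{u, v} Act, σ ∉ L.Div → (∀ a ∈ A, σ ++ [a] ∉ L.Div) →
      [h] ∉ ((tracker h (finTrack σ A) {N - 1, N} ∅).obs L).Div ∧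
      [h, h] ∉ ((tracker h (finTrack σ A) {N - 1, N} ∅).obs L).Div ∧
      (fun _ => h) ∉ ((tracker h (finTrack σ A) {N - 1, N} ∅).obs L).Inf := by
    intro L h1 h2
    refine ⟨?_, ?_, const_notMem_Inf (n := 2) ?_⟩
    · rintro ⟨⟨⟨i⟩, t⟩, ht, htd⟩
      rcases hreach L _ _ _ ht with ⟨-, h3⟩ | ⟨h3, -, h4⟩ | ⟨-, h3, -⟩
      · cases h3
      · obtain rfl : i = N := h3
        exact (track_diverges_step (Set.notMem_empty _) (fun h5 => h1 ⟨t, h4, h5⟩) htd).1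
          (by simp)
      · cases h3
    · rintro ⟨⟨⟨i⟩, t⟩, ht, htd⟩
      rcases hreach L _ _ _ ht with ⟨-, h3⟩ | ⟨-, h3, -⟩ | ⟨h3, -, a, ha, h4⟩
      · cases h3
      · cases h3
      · obtain rfl : i = N + 1 := h3
        obtain ⟨-, b, hb, -⟩ := track_diverges_step (Set.notMem_empty _)
          (fun h5 => h2 a ha ⟨t, h4, h5⟩) htd
        rcases hb with hb | ⟨hb, -⟩
        · rw [List.getElem?_eq_none (by omega)] at hb
          cases hb
        · omega
    · rintro κ ⟨⟨i, t⟩, ht⟩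
      rcases hreach L _ _ _ ht with ⟨-, rfl⟩ | ⟨-, rfl, -⟩ | ⟨-, rfl, -⟩ <;> simp
  refine ⟨_, _, hr.obs (tracker h (finTrack σ A) {N - 1, N} ∅) hA hL, ?_, ?_,
    hnd L hnD hsn, hnd L' (hDL ▸ hnD) (fun a ha => hDL ▸ hsn a ha)⟩
  · obtain ⟨-, s, hs, hst, hsA⟩ := hSf
    refine ⟨(⟨N⟩, s), track_weak_iff.2 ⟨σ, rfl, fits_finTrack.2 (Or.inl List.prefix_rfl), hs, ?_⟩,
      ?_, ?_⟩
    · show _ = List.replicate (shown {N - 1, N} N) h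
      rw [hc1]
      rfl
    all_goals
      rintro ⟨j, t⟩ (⟨⟨h1, -⟩, -⟩ | ⟨-, h1, -⟩ | ⟨a, h1, h2, -⟩)
      · exact h1
      · exact hst _ h1
      · rcases h2 with h2 | ⟨-, h2⟩
        · rw [List.getElem?_eq_none (by show σ.length ≤ N; omega)] at h2
          cases h2
        · exact hsA a h2 _ h1
  · rintro ⟨⟨⟨i⟩, t⟩, ht, ht1, ht2⟩
    rcases hreach L' _ _ _ ht with ⟨-, h3⟩ | ⟨h3, -, h4⟩ | ⟨-, h3, -⟩
    · cases h3
    · obtain rfl : i = N := h3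
      refine hSf' ⟨hA ▸ hSf.1, t, h4, fun t' ht' => ht1 (⟨N⟩, t') (Or.inr (Or.inl ⟨rfl, ht', rfl⟩)),
        fun a ha t' ht' => ht2 (⟨N + 1⟩, t') (Or.inr (Or.inr ⟨a, ht', Or.inr ⟨rfl, ha⟩, rfl, ?_⟩))⟩
      rw [if_pos (by simp)]
    · cases h3

theorem exists_witness_Inf {r : LTS.{u, v} Act → LTS.{u, v} Act → Prop} (hr : IsCongruence r)
    (hF : Preserves r anF) (hI : ¬ Preserves r Inf) (h : Act) :
    ∃ Z Z' : LTS.{u, v} Act, r Z Z' ∧ (fun _ => h) ∈ Z.Inf ∧ (fun _ => h) ∉ Z'.Inf := by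
  obtain ⟨L, L', hL, ξ, hξ, hξ'⟩ := exists_of_not_preserves hr.equivalence hI
  exact ⟨_, _, hr.obs (tracker h (infTrack ξ) Set.univ ∅)
    (alphabet_eq_of_preserves_anF hr hF hL) hL, const_mem_Inf_infTrack hξ Set.infinite_univ,
    fun h1 => hξ' (mem_Inf_of_infTrack h1)⟩

/-- The tracker shows the action that leads from prefix `i` to prefix `i + 1` of `ξ` iff exactly
one of these prefixes is a divergence trace, so that the number of shown actions reveals whether
the current prefix is one. -/
theorem exists_witness_aenI {r : LTS.{u, v} Act → LTS.{u, v} Act → Prop} (hr : IsCongruence r)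
    (hF : Preserves r anF) (hD : Preserves r Div) (hI : ¬ Preserves r aenI) (h : Act) :
    ∃ Z Z' : LTS.{u, v} Act, r Z Z' ∧ (fun _ => h) ∈ Z.Inf ∧ (fun _ => h) ∉ Z'.Inf ∧
      (∀ k, Odd k → List.replicate k h ∉ Z.Div) ∧ (∀ k, Odd k → List.replicate k h ∉ Z'.Div) := by
  classical
  obtain ⟨L, L', hL, ξ, ⟨hξ, hinf⟩, hξ'⟩ := exists_of_not_preserves hr.equivalence hI
  have hDL := hD _ _ hL
  have hξI : ξ ∉ L'.Inf := fun h0 => hξ' ⟨h0, hDL ▸ hinf⟩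
  have hinf' : ∀ n, ∃ i ≥ n, initSeg ξ i ∈ L.Div := by
    by_contra! hcon
    have h1 : ξ ∈ L.eanI := ⟨hξ, hcon⟩
    rw [preserves_eanI_of_Div hr hF hD _ _ hL] at h1
    exact hξI h1.1
  obtain ⟨n₀, -, hn₀⟩ := hinf' 0
  set V : Set ℕ := {i | n₀ ≤ i ∧ ¬ (initSeg ξ i ∈ L.Div ↔ initSeg ξ (i + 1) ∈ L.Div)} with hV
  have hVinf : V.Infinite := by
    rw [Set.infinite_iff_exists_gt]
    intro n
    by_contra! hcon
    have hconst : ∀ i ≥ max (n + 1) n₀, (initSeg ξ i ∈ L.Div ↔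
        initSeg ξ (max (n + 1) n₀) ∈ L.Div) := by
      intro i hi
      induction i, hi using Nat.le_induction with
      | base => rfl
      | succ i hi ih =>
        rw [← ih]
        by_contra hne
        have : i ≤ n := hcon i ⟨le_trans (le_max_right _ _) hi, fun h0 => hne h0.symm⟩
        have := le_trans (le_max_left (n + 1) n₀) hi
        omega
    obtain ⟨i, hi, hi'⟩ := hinf (max (n + 1) n₀)
    obtain ⟨j, hj, hj'⟩ := hinf' (max (n + 1) n₀)
    exact hi' ((hconst i hi).2 ((hconst j hj).1 hj'))
  have hpar : ∀ i, (Odd (shown V i) ↔ n₀ ≤ i ∧ initSeg ξ i ∉ L.Div) := by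
    have hlow : ∀ i ≤ n₀, shown V i = 0 := fun i hi => by
      refine shown_eq_zero fun k hk hk' => ?_
      have := hk'.1
      omega
    intro i
    rcases le_total i n₀ with hi | hi
    · rw [hlow i hi]
      simp only [Nat.not_odd_zero, false_iff, not_and, not_not]
      intro h1
      rwa [le_antisymm hi h1]
    · induction i, hi using Nat.le_induction with
      | base => rw [hlow n₀ le_rfl]; simp [hn₀]
      | succ i hi ih =>
        simp only [hi, true_and] at ih
        simp only [le_trans hi (Nat.le_succ i), true_and]
        by_cases hiV : i ∈ V
        · have := hiV.2
          rw [shown_succ_of_mem hiV, Nat.odd_add_one, ih]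
          tauto
        · have h1 : initSeg ξ i ∈ L.Div ↔ initSeg ξ (i + 1) ∈ L.Div := by
            by_contra hne
            exact hiV ⟨hi, hne⟩
          rw [shown_succ_of_notMem hiV, ih, h1]
  have hodd : ∀ L₁ : LTS.{u, v} Act, L₁.Div = L.Div → ∀ k, Odd k →
      List.replicate k h ∉ ((tracker h (infTrack ξ) V ∅).obs L₁).Div := by
    rintro L₁ hL₁ k hk ⟨⟨⟨i⟩, s⟩, hs, hd⟩
    obtain ⟨h1, h2⟩ := infTrack_weak_iff.1 hs
    obtain rfl : k = shown V i := by simpa using congrArg List.length h2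
    -- the divergence would hide one action after the other, but some action has to be shown
    obtain ⟨m, hm, hmV⟩ : ∃ m, i ≤ m ∧ m ∈ V := by
      obtain ⟨m, hm, hm'⟩ := hVinf.exists_gt i
      exact ⟨m, hm'.le, hm⟩
    have key : ∀ n, i ≤ n → n ≤ m → shown V n = shown V i →
        ∀ t, L₁.Weak L₁.init (initSeg ξ n) t →
        ¬ ((tracker h (infTrack ξ) V ∅).obs L₁).Diverges (⟨n⟩, t) := by
      intro n hin hnm
      induction hnm using Nat.decreasingInduction with
      | self =>
        intro hc t ht htd
        have hnd : initSeg ξ m ∉ L.Div := ((hpar m).1 (hc ▸ hk)).2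
        exact (track_diverges_step (Set.notMem_empty _)
          (fun h3 => hnd (hL₁ ▸ ⟨t, ht, h3⟩)) htd).1 hmV
      | of_succ n hnm ih =>
        intro hc t ht htd
        have hnd : initSeg ξ n ∉ L.Div := ((hpar n).1 (hc ▸ hk)).2
        obtain ⟨hnV, a, rfl, w, hw, hw'⟩ := track_diverges_step (Set.notMem_empty _)
          (fun h3 => hnd (hL₁ ▸ ⟨t, ht, h3⟩)) htd
        refine ih (by omega) ?_ w (by rw [initSeg_succ]; exact ht.trans hw) hw'
        rw [shown_succ_of_notMem hnV, hc]
    exact key i le_rfl hm rfl s h1 hd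
  exact ⟨_, _, hr.obs (tracker h (infTrack ξ) V ∅) (alphabet_eq_of_preserves_anF hr hF hL) hL,
    const_mem_Inf_infTrack hξ hVinf, fun h1 => hξI (mem_Inf_of_infTrack h1), hodd L rfl,
    hodd L' hDL.symm⟩

end Witness

/-! ### Speculation: contexts that change the behaviour of a system beyond its divergences -/

/-- The phases of speculation over a system with states `S`. Here `U` is the set of the states that
the system may have reached by the current trace; it stands for the trace itself, which need not
fit in the universe of `S`. In phase `run` the system is followed faithfully, in phase `wait` it
has been abandoned in favour of `U`, in phase `spec` a continuation is made up (the number bounds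
its length), and in phase `fin` the system has been resumed in a state of `U`. -/
inductive Phase (S : Type v) : Type v
  | run (s : S) (U : Set S)
  | wait (U : Set S)
  | spec (U : Set S) (n : ℕ)
  | fin (s : S)

/-- How phase `wait` may be left: `direct` leads to phase `fin`, the other modes lead to phase
`spec`, which cannot be left in mode `lock`, can be left for phase `fin` in mode `ret`, and can be
left for phase `wait` in mode `loop`. -/
inductive Mode
  | direct
  | lock
  | ret
  | loop

/-- The speculation steps that do not involve the observed system. -/
inductive SpecSolo (L : LTS.{u, v} Act) (dec : Prop) (P : Set L.State → Prop) :
    Phase L.State → Option Act → Phase L.State → Prop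
  | run {s x s'} (U : Set L.State) :
      L.step s x s' → SpecSolo L dec P (.run s U) x (.run s' (L.post U x.toList))
  | spec {U a n n'} : a ∈ L.alphabet → (dec → n' < n) → P (L.post U [a]) →
      SpecSolo L dec P (.spec U n) (some a) (.spec (L.post U [a]) n')
  | fin {s x s'} : L.step s x s' → SpecSolo L dec P (.fin s) x (.fin s')

/-- The speculation steps that are triggered by the observed system. -/
inductive SpecSync (L : LTS.{u, v} Act) (m : Mode) : Phase L.State → Phase L.State → Prop
  | guess {s} (U : Set L.State) : L.Diverges s → SpecSync L m (.run s U) (.wait U)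
  | direct {U t} : m = .direct → t ∈ U → SpecSync L m (.wait U) (.fin t)
  | spec {U} (n : ℕ) : m ≠ .direct → SpecSync L m (.wait U) (.spec U n)
  | loop {U n} : m = .loop → (∃ s ∈ U, L.Diverges s) → SpecSync L m (.spec U n) (.wait U)
  | ret {U t n} : m = .ret → t ∈ U → SpecSync L m (.spec U n) (.fin t)

/-- The monitor that speculates about `L` and takes its orders, all of them `h`, from the observed
system. Made-up continuations stay within `P`, and if `dec` holds they are finite between two
orders. -/
def speculator (h : Act) (L : LTS.{u, v} Act) (m : Mode) (dec : Prop) (P : Set L.State → Prop) :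
    Monitor.{u, v} Act where
  State := Phase L.State
  alphabet := L.alphabet
  solo := SpecSolo L dec P
  sync q a x q' := a = h ∧ x = none ∧ SpecSync L m q q'
  init := .run L.init (L.after [])
  solo_alphabet := by
    intro q b q' hq
    cases hq with
    | run U hs => exact L.step_alphabet hs
    | spec ha => exact ha
    | fin hs => exact L.step_alphabet hs
  sync_alphabet := fun hq => absurd hq.2.1 (by simp)

/-- Speculation about `L` under orders from `Z`, which starts working when the first order is
given. -/
def specSys (h : Act) (L : LTS.{u, v} Act) (m : Mode) (dec : Prop) (P : Set L.State → Prop)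
    (Z : LTS.{u, v} Act) : LTS.{u, v} Act :=
  (speculator h L m dec P).obs (Z.actPrefix h)

/-- What is known about a speculation state that is reached by the trace `σ`. -/
def SpecInv (h : Act) (L : LTS.{u, v} Act) (m : Mode) (P : Set L.State → Prop)
    (Z : LTS.{u, v} Act) (σ : List Act) : Phase L.State → Option Z.State → Prop
  | .run s U, z => z = none ∧ L.Weak L.init σ s ∧ U = L.after σ
  | .wait U, z => U = L.after σ ∧ σ ∈ L.Div ∧ ∃ z' k, z = some z' ∧
      Z.Weak Z.init (List.replicate k h) z' ∧ (m = .loop ∨ k = 0) ∧ Even k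
  | .spec U _, z => m ≠ .direct ∧ U = L.after σ ∧ σ ∈ L.extT ∧ (P U ∨ σ ∈ L.Div) ∧ ∃ z' k,
      z = some z' ∧ Z.Weak Z.init (List.replicate k h) z' ∧ (m = .loop ∨ k = 1) ∧ Odd k
  | .fin s, z => L.Weak L.init σ s ∧ σ ∈ L.extT ∧ ∃ z' k, z = some z' ∧
      Z.Weak Z.init (List.replicate k h) z' ∧ ((m = .direct ∧ k = 1) ∨ (m = .ret ∧ k = 2))

section Speculation

variable {h : Act} {L : LTS.{u, v} Act} {m : Mode} {dec : Prop} {P : Set L.State → Prop}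
  {Z : LTS.{u, v} Act}

theorem extT_snoc {σ : List Act} {a : Act} (hσ : σ ∈ L.extT) (ha : a ∈ L.alphabet) :
    σ ++ [a] ∈ L.extT := by
  obtain ⟨h1, ρ, h2, h3⟩ := hσ
  refine ⟨fun b hb => ?_, ρ, h2.trans (List.prefix_append _ _), h3⟩
  rcases List.mem_append.1 hb with hb | hb
  · exact h1 b hb
  · exact List.mem_singleton.1 hb ▸ ha

theorem specSys_inv_step {σ : List Act} {q q' : Phase L.State} {z z' : Option Z.State}
    {x : Option Act} (hI : SpecInv h L m P Z σ q z)
    (hs : (specSys h L m dec P Z).step (q, z) x (q', z')) :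
    SpecInv h L m P Z (σ ++ x.toList) q' z' := by
  rcases hs with ⟨h1, h2⟩ | ⟨rfl, h1, h2⟩ | ⟨a, h1, rfl, rfl, h2⟩
  · obtain rfl : z' = z := h2
    cases h1 with
    | @run s x s' U h1 =>
      obtain ⟨hz, hw, rfl⟩ := hI
      refine ⟨hz, ?_, post_after _ _ _⟩
      cases x with
      | none => simpa using hw.trans_nil (.single_tau h1)
      | some a => exact hw.trans (.single h1)
    | @spec U a n n' ha hn hP =>
      obtain ⟨hm, rfl, hσ, -, z', k, hz⟩ := hI
      exact ⟨hm, post_after _ _ _, extT_snoc hσ ha, Or.inl hP, z', k, hz⟩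
    | @fin s x s' h1 =>
      obtain ⟨hw, hσ, hz⟩ := hI
      cases x with
      | none => simpa using ⟨hw.trans_nil (.single_tau h1), hσ, hz⟩
      | some a => exact ⟨hw.trans (.single h1), extT_snoc hσ (L.step_alphabet h1), hz⟩
  · obtain rfl : q' = q := h2
    simp only [Option.toList_none, List.append_nil]
    rcases h1 with ⟨w, w', rfl, rfl, h1⟩ | ⟨-, h0, -⟩
    · cases q' with
      | run s U => exact absurd hI.1 (by simp)
      | wait U =>
        obtain ⟨hU, hσ, z', k, hz, hk, hkm⟩ := hI
        obtain rfl := Option.some.inj hz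
        exact ⟨hU, hσ, w', k, rfl, hk.trans_nil (.single_tau h1), hkm⟩
      | spec U n =>
        obtain ⟨hm, hU, hσ, hP, z', k, hz, hk, hkm⟩ := hI
        obtain rfl := Option.some.inj hz
        exact ⟨hm, hU, hσ, hP, w', k, rfl, hk.trans_nil (.single_tau h1), hkm⟩
      | fin s =>
        obtain ⟨hw, hσ, z', k, hz, hk, hkm⟩ := hI
        obtain rfl := Option.some.inj hz
        exact ⟨hw, hσ, w', k, rfl, hk.trans_nil (.single_tau h1), hkm⟩
    · exact absurd h0 (by simp)
  · simp only [Option.toList_none, List.append_nil]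
    rcases h1 with ⟨w, w', hw, hw', h1⟩ | ⟨h3, -, h4⟩
    · obtain rfl : z = some w := hw
      obtain rfl : z' = some w' := hw'
      have hstep : ∀ k, Z.Weak Z.init (List.replicate k a) w →
          Z.Weak Z.init (List.replicate (k + 1) a) w' := fun k hk => by
        rw [List.replicate_succ']
        exact hk.trans (.single h1)
      cases h2 with
      | guess U hd => exact absurd hI.1 (by simp)
      | direct hm ht =>
        obtain ⟨rfl, hσ, w₀, k, hz, hk, hkm, -⟩ := hI
        obtain rfl := Option.some.inj hz
        obtain rfl : k = 0 := by
          rcases hkm with hkm | hkm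
          · rw [hm] at hkm; cases hkm
          · exact hkm
        exact ⟨ht, L.Div_subset_extT hσ, w', 1, rfl, hstep 0 hk, Or.inl ⟨hm, rfl⟩⟩
      | spec n hm =>
        obtain ⟨hU, hσ, w₀, k, hz, hk, hkm, hev⟩ := hI
        obtain rfl := Option.some.inj hz
        refine ⟨hm, hU, L.Div_subset_extT hσ, Or.inr hσ, w', k + 1, rfl, hstep k hk, ?_,
          hev.add_one⟩
        rcases hkm with hkm | rfl
        · exact Or.inl hkm
        · exact Or.inr rfl
      | loop hm hd =>
        obtain ⟨-, rfl, -, -, w₀, k, hz, hk, -, hodd⟩ := hI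
        obtain rfl := Option.some.inj hz
        exact ⟨rfl, exists_diverges_mem_after.1 hd, w', k + 1, rfl, hstep k hk, Or.inl hm,
          hodd.add_one⟩
      | ret hm ht =>
        obtain ⟨-, rfl, hσ, -, w₀, k, hz, hk, hkm, -⟩ := hI
        obtain rfl := Option.some.inj hz
        obtain rfl : k = 1 := by
          rcases hkm with hkm | hkm
          · rw [hm] at hkm; cases hkm
          · exact hkm
        exact ⟨ht, hσ, w', 2, rfl, hstep 1 hk, Or.inr ⟨hm, rfl⟩⟩
    · obtain rfl : z = none := h3
      obtain rfl : z' = some Z.init := h4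
      cases h2 with
      | guess U hd =>
        obtain ⟨-, hw, rfl⟩ := hI
        exact ⟨rfl, ⟨_, hw, hd⟩, _, 0, rfl, .refl _, Or.inr rfl, Even.zero⟩
      | direct =>
        obtain ⟨_, _, _, _, h0, -⟩ := hI
        cases h0
      | spec =>
        obtain ⟨_, _, _, _, h0, -⟩ := hI
        cases h0
      | loop =>
        obtain ⟨_, _, _, _, _, _, h0, -⟩ := hI
        cases h0
      | ret =>
        obtain ⟨_, _, _, _, _, _, h0, -⟩ := hI
        cases h0

theorem specSys_inv_weak {c c' : (specSys h L m dec P Z).State} {σ ρ : List Act}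
    (hw : (specSys h L m dec P Z).Weak c ρ c') (hI : SpecInv h L m P Z σ c.1 c.2) :
    SpecInv h L m P Z (σ ++ ρ) c'.1 c'.2 := by
  induction hw generalizing σ with
  | refl => simpa using hI
  | tau h1 _ ih => simpa using ih (specSys_inv_step hI h1)
  | vis h1 _ ih => simpa using ih (specSys_inv_step hI h1)

/-- All reachable states of a speculation satisfy the invariant. -/
theorem specSys_inv {c : Phase L.State × Option Z.State} {σ : List Act}
    (hw : (specSys h L m dec P Z).Weak (specSys h L m dec P Z).init σ c) :
    SpecInv h L m P Z σ c.1 c.2 := by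
  have h0 : SpecInv h L m P Z [] (.run L.init (L.after [])) none := ⟨rfl, .refl _, rfl⟩
  exact specSys_inv_weak hw h0

/-! ### Divergences of speculation -/

theorem specSys_not_diverges_fin {s : L.State} {z : Z.State} (hs : ¬ L.Diverges s)
    (hz : ¬ Z.Diverges z) : ¬ (specSys h L m dec P Z).Diverges (.fin s, some z) := by
  have key := (not_diverges_iff_acc.1 hs).prod_gameAdd (not_diverges_iff_acc.1 hz)
  generalize hp : (s, z) = p at key
  clear hs hz
  induction key generalizing s z with
  | intro p _ ih =>
    subst hp
    intro hd
    obtain ⟨⟨q, w⟩, h1, h2⟩ := hd.exists_step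
    rcases h1 with ⟨h1, h3⟩ | ⟨-, h1, h3⟩ | ⟨a, -, -, -, h3⟩
    · obtain rfl : w = some z := h3
      cases h1 with
      | fin h1 => exact ih _ (.fst h1) rfl h2
    · obtain rfl : q = .fin s := h3
      rcases h1 with ⟨w', w'', hw, hw', h1⟩ | ⟨-, h0, -⟩
      · obtain rfl : z = w' := Option.some.inj hw
        obtain rfl : w = some w'' := hw'
        exact ih _ (.snd h1) rfl h2
      · exact absurd h0 (by simp)
    · cases h3

/-- A speculation state that is reached by a nondivergent trace of `L` can only diverge because
`Z` does. -/
theorem specSys_not_diverges {σ : List Act} (hσ : σ ∉ L.Div)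
    (hspec : ∀ U n z, SpecInv h L m P Z σ (.spec U n) (some z) → ¬ Z.Diverges z)
    (hfin : ∀ s z, SpecInv h L m P Z σ (.fin s) (some z) → ¬ Z.Diverges z)
    {c : Phase L.State × Option Z.State} (hI : SpecInv h L m P Z σ c.1 c.2) :
    ¬ (specSys h L m dec P Z).Diverges c := by
  obtain ⟨q, z⟩ := c
  have hF : ∀ s z, SpecInv h L m P Z σ (.fin s) z →
      ¬ (specSys h L m dec P Z).Diverges (.fin s, z) := by
    intro s z hI
    obtain ⟨z', k, rfl, -⟩ := hI.2.2
    exact specSys_not_diverges_fin (fun hd => hσ ⟨s, hI.1, hd⟩) (hfin s z' hI)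
  cases q with
  | run s U =>
    obtain rfl : z = none := hI.1
    have hs : ¬ L.Diverges s := fun hd => hσ ⟨s, hI.2.1, hd⟩
    have hacc := not_diverges_iff_acc.1 hs
    clear hs
    induction hacc generalizing U with
    | intro s _ ih =>
      intro hd
      obtain ⟨⟨q, w⟩, h1, h2⟩ := hd.exists_step
      have hI' := specSys_inv_step hI h1
      simp only [Option.toList_none, List.append_nil] at hI'
      rcases h1 with ⟨h1, h3⟩ | ⟨-, h1, h3⟩ | ⟨a, -, -, -, h1⟩
      · obtain rfl : w = none := h3
        cases h1 with
        | run U h1 => exact ih _ h1 _ hI' h2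
      · rcases h1 with ⟨w', w'', h0, -⟩ | ⟨-, h0, -⟩ <;> exact absurd h0 (by simp)
      · cases h1 with
        | guess U hd' => exact hσ ⟨s, hI.2.1, hd'⟩
  | wait U => exact absurd hI.2.1 hσ
  | spec U n =>
    obtain ⟨z', k, rfl, -⟩ := hI.2.2.2.2
    have hacc := not_diverges_iff_acc.1 (hspec U n z' hI)
    induction hacc with
    | intro z _ ih =>
      intro hd
      obtain ⟨⟨q, w⟩, h1, h2⟩ := hd.exists_step
      have hI' := specSys_inv_step hI h1
      simp only [Option.toList_none, List.append_nil] at hI'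
      rcases h1 with ⟨h1, h3⟩ | ⟨-, h1, h3⟩ | ⟨a, -, -, -, h1⟩
      · cases h1
      · obtain rfl : q = .spec U n := h3
        rcases h1 with ⟨w', w'', hw, hw', h1⟩ | ⟨-, h0, -⟩
        · obtain rfl : z = w' := Option.some.inj hw
          obtain rfl : w = some w'' := hw'
          exact ih _ h1 hI' h2
        · exact absurd h0 (by simp)
      · cases h1 with
        | loop => exact hσ hI'.2.1
        | ret => exact hF _ _ hI' h2
  | fin s => exact hF s z hI

theorem specSys_weak_run {s t : L.State} {σ : List Act} (hw : L.Weak s σ t) (ρ : List Act) :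
    (specSys h L m dec P Z).Weak (.run s (L.after ρ), none) σ
      (.run t (L.after (ρ ++ σ)), none) := by
  induction hw generalizing ρ with
  | refl => simpa using Weak.refl _
  | @tau s s' s'' σ h1 _ ih =>
    have h2 : (specSys h L m dec P Z).step (.run s (L.after ρ), none) none
        (.run s' (L.after ρ), none) := by
      have := SpecSolo.run (dec := dec) (P := P) (L.after ρ) h1
      rw [post_after, Option.toList_none, List.append_nil] at this
      exact Or.inl ⟨this, rfl⟩
    exact .tau h2 (ih ρ)
  | @vis s s' s'' a σ h1 _ ih =>
    have h2 : (specSys h L m dec P Z).step (.run s (L.after ρ), none) (some a)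
        (.run s' (L.after (ρ ++ [a])), none) := by
      have := SpecSolo.run (dec := dec) (P := P) (L.after ρ) h1
      rw [post_after] at this
      exact Or.inl ⟨this, rfl⟩
    have h3 := ih (ρ ++ [a])
    rw [List.append_assoc, List.singleton_append] at h3
    exact .vis h2 h3

theorem specSys_reach_run {s : L.State} {σ : List Act} (hw : L.Weak L.init σ s) :
    (specSys h L m dec P Z).Weak (specSys h L m dec P Z).init σ (.run s (L.after σ), none) :=
  specSys_weak_run hw []

theorem specSys_weak_fin {s t : L.State} {σ : List Act} (hw : L.Weak s σ t)
    (z : Option Z.State) : (specSys h L m dec P Z).Weak (.fin s, z) σ (.fin t, z) := by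
  induction hw with
  | refl => exact .refl _
  | @tau s s' s'' σ h1 _ ih =>
    have h2 : (specSys h L m dec P Z).step (.fin s, z) none (.fin s', z) :=
      Or.inl ⟨.fin h1, rfl⟩
    exact .tau h2 ih
  | @vis s s' s'' a σ h1 _ ih =>
    have h2 : (specSys h L m dec P Z).step (.fin s, z) (some a) (.fin s', z) :=
      Or.inl ⟨.fin h1, rfl⟩
    exact .vis h2 ih

theorem specSys_weak_sync {q q' : Phase L.State} {z z' : Z.State} (hq : SpecSync L m q q')
    (hz : Z.Weak z [h] z') : (specSys h L m dec P Z).Weak (q, some z) [] (q', some z') := by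
  have hτ : ∀ (q : Phase L.State) {z z' : Z.State} {κ : List Act}, κ = [] → Z.Weak z κ z' →
      (specSys h L m dec P Z).Weak (q, some z) [] (q, some z') := by
    intro q z z' κ hκ hw
    induction hw with
    | refl => exact .refl _
    | @tau w w' w'' σ h1 _ ih =>
      have h2 : (specSys h L m dec P Z).step (q, some w) none (q, some w') :=
        Or.inr (Or.inl ⟨rfl, Or.inl ⟨w, w', rfl, rfl, h1⟩, rfl⟩)
      exact .tau h2 (ih hκ)
    | vis => cases hκ
  obtain ⟨w, w', h1, h2, h3⟩ := hz.split_vis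
  have h4 : (specSys h L m dec P Z).step (q, some w) none (q', some w') :=
    Or.inr (Or.inr ⟨h, Or.inl ⟨w, w', rfl, rfl, h2⟩, rfl, rfl, hq⟩)
  exact (hτ q rfl h1).trans (.tau h4 (hτ q' rfl h3))

theorem specSys_reach_wait {σ : List Act} (hσ : σ ∈ L.Div) :
    (specSys h L m dec P Z).Weak (specSys h L m dec P Z).init σ
      (.wait (L.after σ), some Z.init) := by
  obtain ⟨s, hs, hd⟩ := hσ
  have h1 : (specSys h L m dec P Z).step (.run s (L.after σ), none) none
      (.wait (L.after σ), some Z.init) :=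
    Or.inr (Or.inr ⟨h, Or.inr ⟨rfl, rfl, rfl⟩, rfl, rfl, .guess _ hd⟩)
  exact (specSys_reach_run hs).trans_nil (.single_tau h1)

theorem specSys_weak_spec {ρ κ : List Act} (hκ : ∀ a ∈ κ, a ∈ L.alphabet)
    (hP : ∀ κ', κ' <+: κ → κ' ≠ [] → P (L.after (ρ ++ κ'))) (z : Option Z.State) (n : ℕ) :
    (specSys h L m dec P Z).Weak (.spec (L.after ρ) (n + κ.length), z) κ
      (.spec (L.after (ρ ++ κ)) n, z) := by
  induction κ using List.reverseRecOn generalizing n with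
  | nil => simpa using Weak.refl _
  | append_singleton κ a ih =>
    have h1 := ih (fun b hb => hκ b (List.mem_append_left _ hb))
      (fun κ' hκ' => hP κ' (hκ'.trans (List.prefix_append _ _))) (n + 1)
    have h2 : (specSys h L m dec P Z).step (.spec (L.after (ρ ++ κ)) (n + 1), z) (some a)
        (.spec (L.after (ρ ++ (κ ++ [a]))) n, z) := by
      have h3 := hP _ List.prefix_rfl (by simp)
      rw [← List.append_assoc, ← post_after] at h3
      have := SpecSolo.spec (dec := dec) (P := P) (n := n + 1) (hκ a (by simp))
        (fun _ => Nat.lt_succ_self n) h3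
      rw [post_after, List.append_assoc] at this
      exact Or.inl ⟨this, rfl⟩
    have he : n + (κ ++ [a]).length = n + 1 + κ.length := by
      rw [List.length_append, List.length_singleton]; omega
    rw [he]
    exact h1.trans (.single h2)

theorem specSys_reach_spec (hm : m ≠ .direct) {ρ κ : List Act} (hρ : ρ ∈ L.Div)
    (hκ : ∀ a ∈ κ, a ∈ L.alphabet)
    (hP : ∀ κ', κ' <+: κ → κ' ≠ [] → P (L.after (ρ ++ κ'))) {z : Z.State}
    (hz : Z.Weak Z.init [h] z) :
    (specSys h L m dec P Z).Weak (specSys h L m dec P Z).init (ρ ++ κ)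
      (.spec (L.after (ρ ++ κ)) 0, some z) := by
  have h1 := (specSys_reach_wait (h := h) (m := m) (dec := dec) (P := P) (Z := Z) hρ).trans_nil
    (specSys_weak_sync (.spec (0 + κ.length) hm) hz)
  exact h1.trans (specSys_weak_spec hκ hP _ 0)

theorem specSys_diverges_of_diverges {z : Z.State} (hz : Z.Diverges z) (q : Phase L.State) :
    (specSys h L m dec P Z).Diverges (q, some z) :=
  Diverges.of_forall_step (fun c : Phase L.State × Option Z.State =>
      c.1 = q ∧ ∃ z, c.2 = some z ∧ Z.Diverges z)
    (fun c hc => by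
      obtain ⟨hq, z, hz, hd⟩ := hc
      obtain ⟨z', h1, h2⟩ := hd.exists_step
      exact ⟨(q, some z'), Or.inr (Or.inl ⟨rfl, Or.inl ⟨z, z', hz, rfl, h1⟩, hq.symm⟩), rfl, z',
        rfl, h2⟩) ⟨rfl, z, rfl, hz⟩

theorem Div_subset_specSys : L.Div ⊆ (specSys h L m dec P Z).Div := by
  rintro σ ⟨s, hs, hd⟩
  refine ⟨_, specSys_reach_run hs, ?_⟩
  refine Diverges.of_forall_step (fun c : Phase L.State × Option Z.State =>
    c.2 = none ∧ ∃ s U, c.1 = .run s U ∧ L.Diverges s) ?_ ⟨rfl, s, _, rfl, hd⟩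
  rintro ⟨q, z⟩ ⟨rfl, s, U, rfl, hd⟩
  obtain ⟨s', h1, h2⟩ := hd.exists_step
  exact ⟨(.run s' (L.post U []), none), Or.inl ⟨.run U h1, rfl⟩, rfl, s', _, rfl, h2⟩

theorem specSys_Div_eq
    (hspec : ∀ σ ∉ L.Div, ∀ U n z, SpecInv h L m P Z σ (.spec U n) (some z) → ¬ Z.Diverges z)
    (hfin : ∀ σ ∉ L.Div, ∀ s z, SpecInv h L m P Z σ (.fin s) (some z) → ¬ Z.Diverges z) :
    (specSys h L m dec P Z).Div = L.Div := by
  refine Set.Subset.antisymm ?_ Div_subset_specSys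
  rintro σ ⟨c, hc, hd⟩
  by_contra hσ
  exact specSys_not_diverges hσ (hspec σ hσ) (hfin σ hσ) (specSys_inv hc) hd

/-! ### Failures of speculation -/

theorem Sf_subset_specSys : L.Sf ⊆ (specSys h L m dec P Z).Sf := by
  rintro ⟨σ, A⟩ ⟨hA, s, hs, hst, hsA⟩
  have key : ∀ x c, (specSys h L m dec P Z).step (.run s (L.after σ), none) x c →
      ∃ s', L.step s x s' := by
    rintro x ⟨q, z⟩ (⟨h1, -⟩ | ⟨-, h1, -⟩ | ⟨a, -, -, rfl, h1⟩)
    · cases h1 with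
      | run U h1 => exact ⟨_, h1⟩
    · rcases h1 with ⟨w', w'', h0, -⟩ | ⟨-, h0, -⟩ <;> exact absurd h0 (by simp)
    · cases h1 with
      | guess U hd =>
        obtain ⟨s', h2, -⟩ := hd.exists_step
        exact ⟨s', h2⟩
  refine ⟨hA, _, specSys_reach_run hs, fun c hc => ?_, fun a ha c hc => ?_⟩
  · obtain ⟨s', h1⟩ := key _ _ hc
    exact hst s' h1
  · obtain ⟨s', h1⟩ := key _ _ hc
    exact hsA a ha s' h1

/-- A stable failure of a speculation is one of `L` or occurs in phase `wait` or `spec`. -/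
theorem specSys_Sf_cases {σ : List Act} {A : Set Act} (hf : (σ, A) ∈ (specSys h L m dec P Z).Sf) :
    (σ, A) ∈ L.Sf ∨
    (∃ U z, SpecInv h L m P Z σ (.wait U) (some z) ∧ ∀ z', ¬ Z.step z none z') ∨
    ∃ U n z, SpecInv h L m P Z σ (.spec U n) (some z) ∧
      ∀ c, ¬ (specSys h L m dec P Z).step (.spec U n, some z) none c := by
  obtain ⟨hA, ⟨q, z⟩, hw, hst, hsA⟩ := hf
  have hI := specSys_inv hw
  cases q with
  | run s U =>
    exact Or.inl ⟨hA, s, hI.2.1, fun s' h1 => hst (_, z) (Or.inl ⟨.run U h1, rfl⟩),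
      fun a ha s' h1 => hsA a ha (_, z) (Or.inl ⟨.run U h1, rfl⟩)⟩
  | wait U =>
    obtain ⟨-, -, z', k, hz, -⟩ := id hI
    obtain rfl : z = some z' := hz
    exact Or.inr (Or.inl ⟨U, z', hI, fun w h1 =>
      hst (.wait U, some w) (Or.inr (Or.inl ⟨rfl, Or.inl ⟨z', w, rfl, rfl, h1⟩, rfl⟩))⟩)
  | spec U n =>
    obtain ⟨-, -, -, -, z', k, hz, -⟩ := id hI
    obtain rfl : z = some z' := hz
    exact Or.inr (Or.inr ⟨U, n, z', hI, hst⟩)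
  | fin s =>
    exact Or.inl ⟨hA, s, hI.1, fun s' h1 => hst (_, z) (Or.inl ⟨.fin h1, rfl⟩),
      fun a ha s' h1 => hsA a ha (_, z) (Or.inl ⟨.fin h1, rfl⟩)⟩

theorem specSys_nF_eq (hD : (specSys h L m dec P Z).Div = L.Div)
    (hspec : ∀ σ ∉ L.Div, ∀ A ⊆ L.alphabet, ∀ U n z, SpecInv h L m P Z σ (.spec U n) (some z) →
      (∀ c, ¬ (specSys h L m dec P Z).step (.spec U n, some z) none c) → (σ, A) ∈ L.Sf) :
    (specSys h L m dec P Z).nF = L.nF := by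
  ext ⟨σ, A⟩
  simp only [nF, Set.mem_ofPred_eq, hD]
  refine and_congr_left fun hσ => ⟨fun hf => ?_, fun hf => Sf_subset_specSys hf⟩
  rcases specSys_Sf_cases hf with h1 | ⟨U, z, h1, -⟩ | ⟨U, n, z, h1, h2⟩
  · exact h1
  · exact absurd h1.2.1 hσ
  · exact hspec σ hσ A hf.1 U n z h1 h2

/-! ### Infinite traces of speculation -/

theorem Inf_subset_specSys : L.Inf ⊆ (specSys h L m dec P Z).Inf := by
  intro ξ hξ
  obtain ⟨p, hp0, hp⟩ := mem_Inf_iff.1 hξ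
  refine mem_Inf_iff.2 ⟨fun i => (.run (p i) (L.after (initSeg ξ i)), none), ?_, fun i => ?_⟩
  · show ((.run (p 0) (L.after (initSeg ξ 0)), none) : Phase L.State × Option Z.State) = _
    rw [hp0]
    rfl
  · have h1 := specSys_weak_run (h := h) (m := m) (dec := dec) (P := P) (Z := Z) (hp i)
      (initSeg ξ i)
    rw [← initSeg_succ] at h1
    exact h1

theorem specSys_weak_of_fin {c c' : (specSys h L m dec P Z).State} {σ : List Act}
    (hw : (specSys h L m dec P Z).Weak c σ c') {s : L.State} (hc : c.1 = .fin s) :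
    ∃ s', c'.1 = .fin s' ∧ L.Weak s σ s' := by
  induction hw generalizing s with
  | refl => exact ⟨s, hc, .refl _⟩
  | @tau c₁ c₂ c₃ σ h1 _ ih =>
    obtain ⟨q, z⟩ := c₁
    obtain ⟨q', z'⟩ := c₂
    obtain rfl : q = .fin s := hc
    rcases h1 with ⟨h1, -⟩ | ⟨-, -, h1⟩ | ⟨a, -, -, -, h1⟩
    · cases h1 with
      | fin h1 =>
        obtain ⟨t, h2, h3⟩ := ih rfl
        exact ⟨t, h2, .tau h1 h3⟩
    · obtain rfl : q' = .fin s := h1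
      exact ih rfl
    · cases h1
  | @vis c₁ c₂ c₃ a σ h1 _ ih =>
    obtain ⟨q, z⟩ := c₁
    obtain ⟨q', z'⟩ := c₂
    obtain rfl : q = .fin s := hc
    rcases h1 with ⟨h1, -⟩ | ⟨h1, -⟩ | ⟨a, -, -, -, h1⟩
    · cases h1 with
      | fin h1 =>
        obtain ⟨t, h2, h3⟩ := ih rfl
        exact ⟨t, h2, .vis h1 h3⟩
    · cases h1
    · cases h1

theorem specSys_weak_to_run {c c' : (specSys h L m dec P Z).State} {σ : List Act}
    (hw : (specSys h L m dec P Z).Weak c σ c') {s' : L.State} {U' : Set L.State}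
    (hc : c'.1 = .run s' U') : ∃ s U, c.1 = .run s U ∧ L.Weak s σ s' := by
  induction hw with
  | refl => exact ⟨s', U', hc, .refl _⟩
  | @tau c₁ c₂ c₃ σ h1 _ ih =>
    obtain ⟨q, z⟩ := c₁
    obtain ⟨q', z'⟩ := c₂
    obtain ⟨s, U, h2, h3⟩ := ih hc
    obtain rfl : q' = .run s U := h2
    rcases h1 with ⟨h1, -⟩ | ⟨-, -, h1⟩ | ⟨a, -, -, -, h1⟩
    · generalize hq : Phase.run s U = q' at h1
      cases h1 with
      | run U₁ h1 =>
        cases hq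
        exact ⟨_, _, rfl, .tau h1 h3⟩
      | fin => cases hq
    · exact ⟨s, U, h1.symm, h3⟩
    · cases h1
  | @vis c₁ c₂ c₃ a σ h1 _ ih =>
    obtain ⟨q, z⟩ := c₁
    obtain ⟨q', z'⟩ := c₂
    obtain ⟨s, U, h2, h3⟩ := ih hc
    obtain rfl : q' = .run s U := h2
    rcases h1 with ⟨h1, -⟩ | ⟨h1, -⟩ | ⟨a, -, -, -, h1⟩
    · generalize hq : Phase.run s U = q' at h1
      cases h1 with
      | run U₁ h1 =>
        cases hq
        exact ⟨_, _, rfl, .vis h1 h3⟩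
      | spec => cases hq
      | fin => cases hq
    · cases h1
    · cases h1

/-- Speculation is under way: the phase is `wait` or `spec`. -/
def Phase.Busy {S : Type v} : Phase S → Prop
  | .wait _ => True
  | .spec _ _ => True
  | _ => False

/-- The bound on the length of the continuation that is being made up. -/
def Phase.bound {S : Type v} : Phase S → ℕ
  | .spec _ n => n
  | _ => 0

/-- An infinite trace of a speculation is one of `L` or ends in speculation that never comes to an
end. -/
theorem specSys_Inf_cases {ξ : ℕ → Act} (hξ : ξ ∈ (specSys h L m dec P Z).Inf) :
    ξ ∈ L.Inf ∨ ∃ (p : ℕ → Phase L.State × Option Z.State) (i : ℕ),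
      (∀ j, (specSys h L m dec P Z).Weak (p j) [ξ j] (p (j + 1))) ∧
      (∀ j, SpecInv h L m P Z (initSeg ξ j) (p j).1 (p j).2) ∧ ∀ j ≥ i, (p j).1.Busy := by
  obtain ⟨p, hp0, hp⟩ := mem_Inf_iff.1 hξ
  have hI : ∀ j, SpecInv h L m P Z (initSeg ξ j) (p j).1 (p j).2 := fun j =>
    specSys_inv (hp0 ▸ InfFrom.weak_initSeg hp j)
  by_cases hfin : ∃ i s, (p i).1 = .fin s
  · left
    obtain ⟨i, s, hi⟩ := hfin
    have h1 := hI i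
    rw [hi] at h1
    refine mem_Inf_of_weak h1.1 (InfFrom.of_forall_weak (n := i)
      (fun n s => (p n).1 = .fin s) (fun n s hs => ?_) hi)
    obtain ⟨s', h2, h3⟩ := specSys_weak_of_fin (hp n) hs
    exact ⟨s', h3, h2⟩
  by_cases hrun : ∀ i, ∃ s U, (p i).1 = .run s U
  · left
    choose s U hs using hrun
    refine mem_Inf_iff.2 ⟨s, ?_, fun i => ?_⟩
    · have := hs 0
      rw [hp0] at this
      exact ((Phase.run.injEq _ _ _ _).mp this).1.symm
    · obtain ⟨s', U', h1, h2⟩ := specSys_weak_to_run (hp i) (hs (i + 1))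
      rw [hs i] at h1
      cases h1
      exact h2
  · right
    push Not at hfin hrun
    obtain ⟨i, hi⟩ := hrun
    refine ⟨p, i, hp, hI, fun j hj => ?_⟩
    have hnr : ∀ s U, (p j).1 ≠ .run s U := by
      induction j, hj using Nat.le_induction with
      | base => exact hi
      | succ j _ ih =>
        intro s U hs
        obtain ⟨s', U', h1, -⟩ := specSys_weak_to_run (hp j) hs
        exact ih s' U' h1
    cases hq : (p j).1 with
    | run s U => exact absurd hq (hnr s U)
    | wait => trivial
    | spec => trivial
    | fin s => exact absurd hq (hfin j s)

theorem specSys_busy_of_weak {c c' : (specSys h L m dec P Z).State} {σ : List Act}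
    {x : Option Act} (hs : c.1.Busy) {c₁ : Phase L.State × Option Z.State}
    (h1 : (specSys h L m dec P Z).step c x c₁) (h2 : (specSys h L m dec P Z).Weak c₁ σ c')
    (hs' : c'.1.Busy) : c₁.1.Busy := by
  obtain ⟨q, z⟩ := c
  obtain ⟨q₁, z₁⟩ := c₁
  cases q₁ with
  | run s U =>
    rcases h1 with ⟨h1, -⟩ | ⟨-, -, h1⟩ | ⟨a, -, -, -, h1⟩
    · generalize hq : Phase.run s U = q' at h1
      cases h1 with
      | run => exact absurd hs id
      | spec => cases hq
      | fin => cases hq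
    · obtain rfl : Phase.run s U = q := h1
      exact absurd hs id
    · cases h1
  | wait => trivial
  | spec => trivial
  | fin s =>
    obtain ⟨s', h3, -⟩ := specSys_weak_of_fin h2 rfl
    rw [h3] at hs'
    exact absurd hs' id

/-- While speculation is under way and no order is given, the bound decreases with every visible
action. -/
theorem specSys_bound {c c' : (specSys h L m dec P Z).State} {σ : List Act} (hdec : dec)
    (hw : (specSys h L m dec P Z).Weak c σ c') (hs : c.1.Busy) (hs' : c'.1.Busy) {z z' : Z.State}
    (hz : c.2 = some z) (hz' : c'.2 = some z') :
    ∃ k, Z.Weak z (List.replicate k h) z' ∧ (k = 0 → c'.1.bound + σ.length ≤ c.1.bound) := by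
  induction hw generalizing z with
  | refl =>
    rw [hz] at hz'
    cases hz'
    exact ⟨0, .refl _, fun _ => le_rfl⟩
  | @tau c₁ c₂ c₃ σ h1 h2 ih =>
    have hb := specSys_busy_of_weak hs h1 h2 hs'
    obtain ⟨q, w⟩ := c₁
    obtain ⟨q', w'⟩ := c₂
    obtain rfl : w = some z := hz
    rcases h1 with ⟨h1, h3⟩ | ⟨-, h1, h3⟩ | ⟨a, h1, rfl, -, h3⟩
    · cases h1 with
      | run => exact absurd hs id
      | fin => exact absurd hs id
    · obtain rfl : q' = q := h3
      rcases h1 with ⟨y, y', hy, hy', h1⟩ | ⟨h0, -⟩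
      · obtain rfl : z = y := Option.some.inj hy
        obtain ⟨k, h4, h5⟩ := ih hb hs' hy' hz'
        exact ⟨k, .tau h1 h4, h5⟩
      · exact absurd h0 (by simp)
    · rcases h1 with ⟨y, y', hy, hy', h1⟩ | ⟨h0, -⟩
      · obtain rfl : z = y := Option.some.inj hy
        obtain ⟨k, h4, -⟩ := ih hb hs' hy' hz'
        exact ⟨k + 1, .vis h1 h4, fun h0 => absurd h0 (Nat.succ_ne_zero k)⟩
      · exact absurd h0 (by simp)
  | @vis c₁ c₂ c₃ a σ h1 h2 ih =>
    have hb := specSys_busy_of_weak hs h1 h2 hs'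
    obtain ⟨q, w⟩ := c₁
    obtain ⟨q', w'⟩ := c₂
    obtain rfl : w = some z := hz
    rcases h1 with ⟨h1, h3⟩ | ⟨h0, -⟩ | ⟨b, -, -, h0, -⟩
    · cases h1 with
      | run => exact absurd hs id
      | @spec U a n n' ha hn hP =>
        obtain rfl : w' = some z := h3
        obtain ⟨k, h4, h5⟩ := ih hb hs' rfl hz'
        refine ⟨k, h4, fun hk => ?_⟩
        have h6 := h5 hk
        have h7 := hn hdec
        simp only [Phase.bound, List.length_cons] at h6 ⊢
        omega
      | fin => exact absurd hs id
    · cases h0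
    · cases h0

/-- A speculation that never comes to an end needs infinitely many orders. -/
theorem const_mem_Inf_of_busy (hdec : dec) {ξ : ℕ → Act}
    {p : ℕ → Phase L.State × Option Z.State} {i : ℕ}
    (hp : ∀ j, (specSys h L m dec P Z).Weak (p j) [ξ j] (p (j + 1)))
    (hI : ∀ j, SpecInv h L m P Z (initSeg ξ j) (p j).1 (p j).2) (hb : ∀ j ≥ i, (p j).1.Busy) :
    (fun _ => h) ∈ Z.Inf := by
  have hz : ∀ j, i ≤ j → ∃ z k, (p j).2 = some z ∧ Z.Weak Z.init (List.replicate k h) z := by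
    intro j hj
    have h1 := hI j
    have h2 := hb j hj
    cases hq : (p j).1 with
    | run s U => rw [hq] at h2; exact absurd h2 id
    | fin s => rw [hq] at h2; exact absurd h2 id
    | wait U =>
      rw [hq] at h1
      obtain ⟨-, -, z, k, h3, h4, -⟩ := h1
      exact ⟨z, k, h3, h4⟩
    | spec U n =>
      rw [hq] at h1
      obtain ⟨-, -, -, -, z, k, h3, h4, -⟩ := h1
      exact ⟨z, k, h3, h4⟩
  -- an order is given sooner or later, as the bound cannot decrease forever
  have hnext : ∀ N j, i ≤ j → (p j).1.bound ≤ N → ∀ z, (p j).2 = some z →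
      ∃ j' ≥ i, ∃ k z', (p j').2 = some z' ∧ Z.Weak z (List.replicate (k + 1) h) z' := by
    intro N
    induction N with
    | zero =>
      intro j hj hN z hzj
      obtain ⟨z', -, hz', -⟩ := hz (j + 1) (by omega)
      obtain ⟨k, h1, h2⟩ := specSys_bound hdec (hp j) (hb j hj) (hb (j + 1) (by omega)) hzj hz'
      cases k with
      | zero =>
        have := h2 rfl
        simp only [List.length_singleton] at this
        omega
      | succ k => exact ⟨j + 1, by omega, k, z', hz', h1⟩
    | succ N ih =>
      intro j hj hN z hzj
      obtain ⟨z', -, hz', -⟩ := hz (j + 1) (by omega)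
      obtain ⟨k, h1, h2⟩ := specSys_bound hdec (hp j) (hb j hj) (hb (j + 1) (by omega)) hzj hz'
      cases k with
      | zero =>
        have := h2 rfl
        simp only [List.length_singleton] at this
        obtain ⟨j', hj', k, z'', h3, h4⟩ := ih (j + 1) (by omega) (by omega) z' hz'
        exact ⟨j', hj', k, z'', h3, h1.trans h4⟩
      | succ k => exact ⟨j + 1, by omega, k, z', hz', h1⟩
  rw [mem_Inf_iff]
  have := InfFrom.of_forall_weak (L := Z) (ξ := fun _ => h) (n := 0) (s := Z.init)
    (fun _ z => ∃ j ≥ i, ∃ k z', (p j).2 = some z' ∧ Z.Weak z (List.replicate k h) z') ?_ ?_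
  · exact this
  · rintro - z ⟨j, hj, k, z', hz', hk⟩
    have h1 : ∃ j' ≥ i, ∃ k z', (p j').2 = some z' ∧ Z.Weak z (List.replicate (k + 1) h) z' := by
      obtain ⟨j', hj', k', z'', h3, h4⟩ := hnext _ j hj le_rfl z' hz'
      refine ⟨j', hj', k + k', z'', h3, ?_⟩
      rw [add_assoc, List.replicate_add]
      exact hk.trans h4
    obtain ⟨j', hj', k', z'', h3, h4⟩ := h1
    rw [List.replicate_succ, ← List.singleton_append] at h4
    obtain ⟨w, hw, hw'⟩ := h4.split
    exact ⟨w, hw, j', hj', k', z'', h3, hw'⟩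
  · obtain ⟨z, k, h1, h2⟩ := hz i le_rfl
    exact ⟨i, le_rfl, k, z, h1, h2⟩

/-- The bound decreases with every visible action unless phase `wait` is passed, which happens only
at divergence traces. -/
theorem specSys_bound_or_Div {c c' : (specSys h L m dec P Z).State} {σ σ₀ : List Act}
    (hdec : dec) (hw : (specSys h L m dec P Z).Weak c σ c') (hs : c.1.Busy) (hs' : c'.1.Busy)
    (hI : SpecInv h L m P Z σ₀ c.1 c.2) :
    (∃ ρ, ρ <+: σ ∧ σ₀ ++ ρ ∈ L.Div) ∨ c'.1.bound + σ.length ≤ c.1.bound := by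
  induction hw generalizing σ₀ with
  | refl => exact Or.inr le_rfl
  | @tau c₁ c₂ c₃ σ h1 h2 ih =>
    have hb := specSys_busy_of_weak hs h1 h2 hs'
    have hI' := specSys_inv_step hI h1
    simp only [Option.toList_none, List.append_nil] at hI'
    rcases ih hb hs' hI' with h3 | h3
    · exact Or.inl h3
    obtain ⟨q, w⟩ := c₁
    obtain ⟨q', w'⟩ := c₂
    rcases h1 with ⟨h1, -⟩ | ⟨-, -, h4⟩ | ⟨a, -, -, -, h1⟩
    · cases h1 with
      | run => exact absurd hs id
      | fin => exact absurd hs id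
    · obtain rfl : q' = q := h4
      exact Or.inr h3
    · cases h1 with
      | guess => exact absurd hs id
      | direct => exact absurd hb id
      | spec => exact Or.inl ⟨[], List.nil_prefix, by simpa using hI.2.1⟩
      | loop => exact Or.inl ⟨[], List.nil_prefix, by simpa using hI'.2.1⟩
      | ret => exact absurd hb id
  | @vis c₁ c₂ c₃ a σ h1 h2 ih =>
    have hb := specSys_busy_of_weak hs h1 h2 hs'
    have hI' := specSys_inv_step hI h1
    rcases ih hb hs' hI' with ⟨ρ, h3, h4⟩ | h3
    · exact Or.inl ⟨a :: ρ, by simpa using h3, by simpa using h4⟩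
    obtain ⟨q, w⟩ := c₁
    obtain ⟨q', w'⟩ := c₂
    rcases h1 with ⟨h1, -⟩ | ⟨h0, -⟩ | ⟨b, -, -, h0, -⟩
    · cases h1 with
      | run => exact absurd hs id
      | @spec U a n n' ha hn hP =>
        have h7 := hn hdec
        simp only [Phase.bound, List.length_cons] at h3 ⊢
        right
        omega
      | fin => exact absurd hs id
    · cases h0
    · cases h0

theorem exists_initSeg_mem_Div_of_busy (hdec : dec) {ξ : ℕ → Act}
    {p : ℕ → Phase L.State × Option Z.State} {i : ℕ}
    (hp : ∀ j, (specSys h L m dec P Z).Weak (p j) [ξ j] (p (j + 1)))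
    (hI : ∀ j, SpecInv h L m P Z (initSeg ξ j) (p j).1 (p j).2) (hb : ∀ j ≥ i, (p j).1.Busy)
    (n : ℕ) : ∃ j ≥ n, initSeg ξ j ∈ L.Div := by
  by_contra! hcon
  have hlt : ∀ j ≥ max i n, (p (j + 1)).1.bound + 1 ≤ (p j).1.bound := by
    intro j hj
    have hi := le_trans (le_max_left i n) hj
    have hn := le_trans (le_max_right i n) hj
    rcases specSys_bound_or_Div hdec (hp j) (hb j hi) (hb (j + 1) (by omega)) (hI j) with
      ⟨ρ, h1, h2⟩ | h1
    · have h3 : initSeg ξ j ++ ρ <+: initSeg ξ (j + 1) := by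
        rw [initSeg_succ]
        exact (List.prefix_append_right_inj _).2 h1
      rw [eq_initSeg_of_prefix h3] at h2
      exact absurd h2 (hcon _ (by rw [List.length_append, length_initSeg]; omega))
    · exact h1
  have hdecr : ∀ k, (p (max i n + k)).1.bound + k ≤ (p (max i n)).1.bound := by
    intro k
    induction k with
    | zero => exact le_rfl
    | succ k ih =>
      have := hlt (max i n + k) (Nat.le_add_right _ _)
      rw [add_assoc] at this
      omega
  have := hdecr ((p (max i n)).1.bound + 1)
  omega

/-- The visible steps of a busy speculation lead to phase `spec`. -/
theorem exists_specInv_of_busy {c c' : (specSys h L m dec P Z).State} {σ : List Act} {a : Act}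
    (hw : (specSys h L m dec P Z).Weak c [a] c') (hI : SpecInv h L m P Z σ c.1 c.2)
    (hs : c.1.Busy) (hs' : c'.1.Busy) :
    ∃ U n z, SpecInv h L m P Z (σ ++ [a]) (.spec U n) (some z) := by
  obtain ⟨t, ⟨q, z⟩, h1, h2, h3⟩ := hw.split_vis
  have h5 := h1.trans (.single h2)
  have hI' := specSys_inv_weak h5 hI
  rcases h2 with ⟨h2, -⟩ | ⟨h2, -⟩ | ⟨b, -, -, h2, -⟩
  · change SpecSolo L dec P t.1 (some a) q at h2
    cases h2' : q with
    | run s U =>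
      subst h2'
      obtain ⟨s₁, U₁, h4, -⟩ : ∃ s₁ U₁, c.1 = .run s₁ U₁ ∧ L.Weak s₁ ([] ++ [a]) s :=
        specSys_weak_to_run h5 rfl
      rw [h4] at hs
      exact absurd hs id
    | wait U => subst h2'; generalize t.1 = q₀ at h2; cases h2
    | spec U n =>
      subst h2'
      obtain ⟨z', k, hz, -⟩ := hI'.2.2.2.2
      obtain rfl : z = some z' := hz
      exact ⟨U, n, z', hI'⟩
    | fin s =>
      subst h2'
      obtain ⟨s', h4, -⟩ := specSys_weak_of_fin h3 rfl
      rw [h4] at hs'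
      exact absurd hs' id
  · cases h2
  · cases h2

/-- In mode `loop`, infinitely many orders let speculation hop from one divergent prefix of `ξ` to
a later one, forever. -/
theorem specSys_mem_Inf_of_frequently_Div (hm : m = .loop) {ξ : ℕ → Act} {n₀ : ℕ}
    (hP : ∀ i ≥ n₀, P (L.after (initSeg ξ i))) (hξ : ∀ n, ∃ j ≥ n, initSeg ξ j ∈ L.Div)
    (hZ : (fun _ => h) ∈ Z.Inf) : ξ ∈ (specSys h L m dec P Z).Inf := by
  obtain ⟨y, hy0, hy⟩ := mem_Inf_iff.1 hZ
  have hmd : m ≠ .direct := by rw [hm]; exact fun h0 => by cases h0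
  have hA : ∀ i, ξ i ∈ L.alphabet := mem_alphabet_of_forall_initSeg fun n => by
    obtain ⟨j, hj, hj'⟩ := hξ n
    exact Tr_of_prefix (initSeg_prefix ξ hj) (L.Div_subset_Tr hj')
  obtain ⟨j₀, hj₀, hd₀⟩ := hξ n₀
  rw [mem_Inf_iff]
  have := InfFrom.of_forall_weak (L := specSys h L m dec P Z) (ξ := ξ) (n := 0)
    (s := (specSys h L m dec P Z).init)
    (fun n c => ∃ j k, n ≤ j ∧ n₀ ≤ j ∧ initSeg ξ j ∈ L.Div ∧
      (specSys h L m dec P Z).Weak c (initSeg (fun i => ξ (n + i)) (j - n))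
        (.wait (L.after (initSeg ξ j)), some (y k))) ?_ ?_
  · simpa using this
  · rintro n c ⟨j, k, hnj, hj, hd, hw⟩
    obtain ⟨j', k', hnj', hj', hd', hw'⟩ : ∃ j k, n < j ∧ n₀ ≤ j ∧ initSeg ξ j ∈ L.Div ∧
        (specSys h L m dec P Z).Weak c (initSeg (fun i => ξ (n + i)) (j - n))
          (.wait (L.after (initSeg ξ j)), some (y k)) := by
      obtain ⟨j', hj', hd'⟩ := hξ (j + 1)
      refine ⟨j', k + 2, by omega, by omega, hd', ?_⟩
      obtain ⟨l, rfl⟩ := Nat.exists_eq_add_of_le (show j ≤ j' by omega)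
      have h1 : (specSys h L m dec P Z).Weak (.wait (L.after (initSeg ξ j)), some (y k)) []
          (.spec (L.after (initSeg ξ j)) (0 + (initSeg (fun i => ξ (j + i)) l).length),
            some (y (k + 1))) := specSys_weak_sync (.spec _ hmd) (hy k)
      have h2 := specSys_weak_spec (h := h) (L := L) (m := m) (dec := dec) (P := P) (Z := Z)
        (ρ := initSeg ξ j) (κ := initSeg (fun i => ξ (j + i)) l) ?_ ?_ (some (y (k + 1))) 0
      · rw [← initSeg_add] at h2
        have h3 : (specSys h L m dec P Z).Weak
            (.spec (L.after (initSeg ξ (j + l))) 0, some (y (k + 1))) []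
            (.wait (L.after (initSeg ξ (j + l))), some (y (k + 2))) :=
          specSys_weak_sync (.loop hm (exists_diverges_mem_after.2 hd')) (hy (k + 1))
        have h4 := hw.trans ((h1.trans h2).trans_nil h3)
        obtain ⟨d, rfl⟩ := Nat.exists_eq_add_of_le hnj
        rw [show n + d + l - n = d + l by omega, initSeg_add]
        rw [show n + d - n = d by omega] at h4
        simpa only [add_assoc, List.nil_append] using h4
      · intro a ha
        simp only [initSeg, List.mem_map] at ha
        obtain ⟨i, -, rfl⟩ := ha
        exact hA _
      · intro κ' hκ' _
        rw [eq_initSeg_of_prefix hκ', ← initSeg_add]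
        exact hP _ (by omega)
    obtain ⟨d, rfl⟩ := Nat.exists_eq_add_of_le (show n + 1 ≤ j' by omega)
    have he : initSeg (fun i => ξ (n + i)) (n + 1 + d - n) =
        [ξ n] ++ initSeg (fun i => ξ (n + 1 + i)) d := by
      rw [show n + 1 + d - n = 1 + d by omega, initSeg_add]
      simp only [← add_assoc]
      rfl
    rw [he] at hw'
    obtain ⟨c', h1, h2⟩ := hw'.split
    exact ⟨c', h1, n + 1 + d, k', by omega, hj', hd', by
      rwa [show n + 1 + d - (n + 1) = d by omega]⟩
  · refine ⟨j₀, 0, Nat.zero_le _, hj₀, hd₀, ?_⟩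
    simpa [hy0] using specSys_reach_wait (h := h) (m := m) (dec := dec) (P := P) (Z := Z) hd₀

end Speculation

/-! ### Adding stable failures at divergences -/

/-- A congruence that is implied by CFFD-equivalence, relates livelock and bothlock, and preserves
`anF`. -/
structure Admissible (r : LTS.{u, v} Act → LTS.{u, v} Act → Prop) : Prop where
  congr : IsCongruence r
  of_CFFD : ∀ L L', CFFD L L' → r L L'
  lock : r (livelock Act) (bothlock Act)
  anF : Preserves r anF

theorem specSys_Inf_eq {h : Act} {L : LTS.{u, v} Act} {m : Mode} {P : Set L.State → Prop}
    {Z : LTS.{u, v} Act} (hZ : (fun _ => h) ∉ Z.Inf) : (specSys h L m True P Z).Inf = L.Inf := by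
  refine Set.Subset.antisymm (fun ξ hξ => ?_) Inf_subset_specSys
  rcases specSys_Inf_cases hξ with h1 | ⟨p, i, hp, hI, hb⟩
  · exact h1
  · exact absurd (const_mem_Inf_of_busy trivial hp hI hb) hZ

theorem CFFD_of_nF_eq {L L' : LTS.{u, v} Act} (hA : L.alphabet = L'.alphabet)
    (hN : L.nF = L'.nF) (hD : L.Div = L'.Div) (hI : L.Inf = L'.Inf)
    (hL : ∀ σ ∈ L.Div, ∀ A ⊆ L.alphabet, (σ, A) ∈ L.Sf)
    (hL' : ∀ σ ∈ L'.Div, ∀ A ⊆ L'.alphabet, (σ, A) ∈ L'.Sf) : CFFD L L' := by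
  refine ⟨hA, ?_, hD, hI⟩
  ext ⟨σ, A⟩
  by_cases hσ : σ ∈ L.Div
  · exact ⟨fun h => hL' σ (hD ▸ hσ) A (hA ▸ h.1), fun h => hL σ hσ A (hA ▸ h.1)⟩
  · have h1 : (σ, A) ∈ L.nF ↔ (σ, A) ∈ L'.nF := by rw [hN]
    exact ⟨fun h => (h1.1 ⟨h, hσ⟩).1, fun h => (h1.2 ⟨h, hD ▸ hσ⟩).1⟩

section Lock

variable {h : Act} {L Z : LTS.{u, v} Act}

/-- If `Z` has no visible action, then speculation never gets beyond phase `wait`. -/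
theorem specSys_of_Tr_eq_nil (hZ : ∀ κ ∈ Z.Tr, κ = []) :
    (specSys h L .lock True (fun _ => True) Z).nF = L.nF ∧
    (specSys h L .lock True (fun _ => True) Z).Div = L.Div ∧
    (specSys h L .lock True (fun _ => True) Z).Inf = L.Inf ∧
    ∀ σ U n z, ¬ SpecInv h L .lock (fun _ => True) Z σ (.spec U n) (some z) := by
  have h1 : ∀ σ U n z, ¬ SpecInv h L .lock (fun _ => True) Z σ (.spec U n) (some z) := by
    rintro σ U n z ⟨-, -, -, -, z', k, -, hk, -, hodd⟩
    have := hZ _ ⟨_, hk⟩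
    rw [List.replicate_eq_nil_iff] at this
    subst this
    exact absurd hodd (by simp)
  have hD := specSys_Div_eq (h := h) (L := L) (m := .lock) (dec := True) (P := fun _ => True)
    (Z := Z) (fun σ _ U n z hI => absurd hI (h1 σ U n z)) (by
      rintro σ - s z ⟨-, -, -, -, -, -, ⟨h0, -⟩ | ⟨h0, -⟩⟩ <;> cases h0)
  refine ⟨specSys_nF_eq hD fun σ _ A _ U n z hI => absurd hI (h1 σ U n z), hD,
    specSys_Inf_eq fun hI => ?_, h1⟩
  have := hZ _ (initSeg_mem_Tr_of_mem_Inf hI 1)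
  simp [initSeg] at this

theorem livelock_Tr {κ : List Act} (hκ : κ ∈ (livelock.{u, v} Act).Tr) : κ = [] :=
  List.eq_nil_iff_forall_not_mem.2 fun a ha => mem_alphabet_of_mem_Tr hκ a ha

theorem bothlock_Tr {κ : List Act} (hκ : κ ∈ (bothlock.{u, v} Act).Tr) : κ = [] :=
  List.eq_nil_iff_forall_not_mem.2 fun a ha => mem_alphabet_of_mem_Tr hκ a ha

/-- Speculation under orders from livelock only adds divergences where there are divergences. -/
theorem CFFD_specSys_livelock :
    CFFD L (specSys h L .lock True (fun _ => True) (livelock Act)) := by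
  obtain ⟨-, hD, hI, h1⟩ := specSys_of_Tr_eq_nil (h := h) (L := L) fun κ => livelock_Tr (κ := κ)
  refine ⟨rfl, Set.Subset.antisymm Sf_subset_specSys ?_, hD.symm, hI.symm⟩
  rintro ⟨σ, A⟩ hf
  rcases specSys_Sf_cases hf with h2 | ⟨U, z, -, h2⟩ | ⟨U, n, z, h2, -⟩
  · exact h2
  · exact absurd rfl (h2 z)
  · exact absurd h2 (h1 _ _ _ _)

/-- Speculation under orders from bothlock adds a deadlock at every divergence. -/
theorem mem_Sf_specSys_bothlock {σ : List Act} (hσ : σ ∈ L.Div) {A : Set Act}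
    (hA : A ⊆ L.alphabet) :
    (σ, A) ∈ (specSys h L .lock True (fun _ => True) (bothlock Act)).Sf := by
  have h1 : (specSys h L .lock True (fun _ => True) (bothlock Act)).step
      (.wait (L.after σ), some ⟨false⟩) none (.wait (L.after σ), some ⟨true⟩) :=
    Or.inr (Or.inl ⟨rfl, Or.inl ⟨⟨false⟩, ⟨true⟩, rfl, rfl, rfl, rfl⟩, rfl⟩)
  have h2 : ∀ x c, ¬ (specSys h L .lock True (fun _ => True) (bothlock Act)).step
      (.wait (L.after σ), some ⟨true⟩) x c := by
    rintro x ⟨q, z⟩ (⟨h3, -⟩ | ⟨-, h3, -⟩ | ⟨a, h3, -⟩)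
    · cases h3
    · rcases h3 with ⟨w, w', hw, -, h3, -⟩ | ⟨h0, -⟩
      · cases hw; cases h3
      · cases h0
    · rcases h3 with ⟨w, w', hw, -, h3, -⟩ | ⟨h0, -⟩
      · cases hw; cases h3
      · cases h0
  exact ⟨hA, _, (specSys_reach_wait hσ).trans_nil (.single_tau h1), fun c => h2 _ c,
    fun a _ c => h2 _ c⟩

end Lock

section Saturation

variable [Infinite Act]

theorem IsCongruence.specSys {r : LTS.{u, v} Act → LTS.{u, v} Act → Prop} (hr : IsCongruence r)
    (h : Act) (L : LTS.{u, v} Act) (m : Mode) (dec : Prop) (P : Set L.State → Prop)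
    {Z Z' : LTS.{u, v} Act} (hA : Z.alphabet = Z'.alphabet) (hZ : r Z Z') :
    r (specSys h L m dec P Z) (specSys h L m dec P Z') :=
  hr.obs _ (by simp only [LTS.actPrefix, hA]) (hr.actPrefix h hZ)

/-- Stable failures after divergence traces do not matter: livelock may be replaced by bothlock
at every divergence. -/
theorem rel_of_nF_eq {r : LTS.{u, v} Act → LTS.{u, v} Act → Prop} (hr : Admissible r)
    {L L' : LTS.{u, v} Act} (hA : L.alphabet = L'.alphabet)
    (hN : L.nF = L'.nF) (hD : L.Div = L'.Div) (hI : L.Inf = L'.Inf) : r L L' := by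
  obtain ⟨h⟩ : Nonempty Act := inferInstance
  have key : ∀ L : LTS.{u, v} Act,
      r L (specSys h L .lock True (fun _ => True) (bothlock Act)) := fun L =>
    hr.congr.equivalence.trans (hr.of_CFFD _ _ (CFFD_specSys_livelock (h := h)))
      (hr.congr.specSys h L .lock True _ rfl hr.lock)
  obtain ⟨n1, d1, i1, -⟩ := specSys_of_Tr_eq_nil (h := h) (L := L) fun κ => bothlock_Tr (κ := κ)
  obtain ⟨n2, d2, i2, -⟩ := specSys_of_Tr_eq_nil (h := h) (L := L') fun κ => bothlock_Tr (κ := κ)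
  refine hr.congr.equivalence.trans (key L) (hr.congr.equivalence.trans (hr.of_CFFD _ _ ?_)
    (hr.congr.equivalence.symm (key L')))
  refine CFFD_of_nF_eq hA (by rw [n1, n2, hN]) (by rw [d1, d2, hD]) (by rw [i1, i2, hI]) ?_ ?_
  · rw [d1]
    exact fun σ hσ A hA => mem_Sf_specSys_bothlock hσ hA
  · rw [d2]
    exact fun σ hσ A hA => mem_Sf_specSys_bothlock hσ hA

end Saturation

/-! ### Normal forms of systems -/

section NormalForm

variable [Infinite Act] {r : LTS.{u, v} Act → LTS.{u, v} Act → Prop}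

/-- If speculation under orders from `Z'` changes nothing, then the effect of the orders from the
related system `Z` is not seen by `r`. -/
theorem rel_specSys (hr : Admissible r) {h : Act} {L : LTS.{u, v} Act} {m : Mode} {dec : Prop}
    {P : Set L.State → Prop} {Z Z' : LTS.{u, v} Act} (hZ : r Z Z')
    (hN : (specSys h L m dec P Z').nF = L.nF) (hD : (specSys h L m dec P Z').Div = L.Div)
    (hI : (specSys h L m dec P Z').Inf = L.Inf) : r L (specSys h L m dec P Z) :=
  hr.congr.equivalence.trans
    (rel_of_nF_eq hr (L' := specSys h L m dec P Z') rfl hN.symm hD.symm hI.symm)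
    (hr.congr.specSys h L m dec P (alphabet_eq_of_preserves_anF hr.congr hr.anF hZ).symm
      (hr.congr.equivalence.symm hZ))

/-- Unless `Tr` is preserved, everything may be added after divergences. -/
theorem exists_rel_chaos (hr : Admissible r) (hT : ¬ Preserves r Tr) (L : LTS.{u, v} Act) :
    ∃ T : LTS.{u, v} Act, r L T ∧ T.alphabet = L.alphabet ∧ T.nF = L.anF ∧ T.Div = L.extT ∧
      T.Inf = L.Inf ∪ L.extI := by
  obtain ⟨h⟩ : Nonempty Act := inferInstance
  obtain ⟨Z, Z', hZ, ⟨z, hz, hzd⟩, hZ'⟩ := exists_witness_Tr hr.congr hr.anF hT h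
  have hm : ∀ {Z : LTS.{u, v} Act} {σ s z},
      ¬ SpecInv h L .lock (fun _ => True) Z σ (.fin s) (some z) := by
    rintro Z σ s z ⟨-, -, -, -, -, -, ⟨h0, -⟩ | ⟨h0, -⟩⟩ <;> cases h0
  -- the order `h` is never given by `Z'`
  have h1 : ∀ σ U n z, ¬ SpecInv h L .lock (fun _ => True) Z' σ (.spec U n) (some z) := by
    rintro σ U n z ⟨-, -, -, -, z', k, -, hk, h0 | rfl, -⟩
    · cases h0
    · exact hZ' ⟨_, hk⟩
  have hD' := specSys_Div_eq (dec := False) (fun σ _ U n z hI => absurd hI (h1 σ U n z))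
    fun σ _ s z hI => absurd hI hm
  have hspec : ∀ σ ∈ L.extT, ∃ U, (specSys h L .lock False (fun _ => True) Z).Weak
      (specSys h L .lock False (fun _ => True) Z).init σ (.spec U 0, some z) := by
    intro σ hσ
    obtain ⟨hA, ρ, ⟨κ, rfl⟩, hρ⟩ := mem_extT_iff.1 hσ
    exact ⟨_, specSys_reach_spec (by simp) hρ (fun a ha => hA a (List.mem_append_right _ ha))
      (fun _ _ _ => trivial) hz⟩
  have hD : (specSys h L .lock False (fun _ => True) Z).Div = L.extT := by
    ext σ
    constructor
    · rintro ⟨c, hc, hd⟩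
      by_contra hσ
      exact specSys_not_diverges (fun h0 => hσ (L.Div_subset_extT h0))
        (fun U n z hI => absurd hI.2.2.1 hσ) (fun s z hI => absurd hI hm) (specSys_inv hc) hd
    · intro hσ
      obtain ⟨U, hw⟩ := hspec σ hσ
      exact ⟨_, hw, specSys_diverges_of_diverges hzd _⟩
  refine ⟨specSys h L .lock False (fun _ => True) Z, rel_specSys hr hZ
    (specSys_nF_eq hD' fun σ _ A _ U n z hI => absurd hI (h1 σ U n z)) hD' ?_, rfl, ?_, hD, ?_⟩
  · refine Set.Subset.antisymm (fun ξ hξ => ?_) Inf_subset_specSys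
    rcases specSys_Inf_cases hξ with h2 | ⟨p, i, hp, hI, hb⟩
    · exact h2
    · obtain ⟨U, n, z, h3⟩ := exists_specInv_of_busy (hp i) (hI i) (hb i le_rfl)
        (hb (i + 1) (by omega))
      exact absurd h3 (h1 _ _ _ _)
  · ext ⟨σ, A⟩
    simp only [nF, anF, Set.mem_ofPred_eq, hD]
    refine and_congr_left fun hσ => ⟨fun hf => ?_, fun hf => Sf_subset_specSys hf⟩
    rcases specSys_Sf_cases hf with h2 | ⟨U, z, h2, -⟩ | ⟨U, n, z, h2, -⟩
    · exact h2
    · exact absurd (L.Div_subset_extT h2.2.1) hσ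
    · exact absurd h2.2.2.1 hσ
  · ext ξ
    constructor
    · intro hξ
      rcases specSys_Inf_cases hξ with h2 | ⟨p, i, hp, hI, hb⟩
      · exact Or.inl h2
      · right
        have hE : ∀ j ≥ i, initSeg ξ j ∈ L.extT := by
          intro j hj
          have h2 := hI j
          have h3 := hb j hj
          cases hq : (p j).1 with
          | run => rw [hq] at h3; exact absurd h3 id
          | fin => rw [hq] at h3; exact absurd h3 id
          | wait => rw [hq] at h2; exact L.Div_subset_extT h2.2.1
          | spec => rw [hq] at h2; exact h2.2.2.1
        refine ⟨fun k => (hE (max i (k + 1)) (le_max_left _ _)).1 _ ?_, ?_⟩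
        · rw [initSeg, List.mem_map]
          exact ⟨k, List.mem_range.2 (lt_of_lt_of_le (Nat.lt_succ_self k) (le_max_right _ _)), rfl⟩
        · obtain ⟨-, ρ, hρ, hd⟩ := hE i le_rfl
          exact ⟨_, eq_initSeg_of_prefix hρ ▸ hd⟩
    · rintro (hξ | hξ)
      · exact Inf_subset_specSys hξ
      · obtain ⟨hA, n, hn⟩ := mem_extI_iff.1 hξ
        obtain ⟨U, hw⟩ := hspec _ (L.Div_subset_extT hn)
        refine mem_Inf_of_weak hw (InfFrom.of_forall_weak
          (fun _ (c : Phase L.State × Option Z.State) => ∃ U, c = (.spec U 0, some z)) ?_ ⟨U, rfl⟩)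
        rintro k _ ⟨U, rfl⟩
        have hs : (specSys h L .lock False (fun _ => True) Z).step (.spec U 0, some z)
            (some (ξ k)) (.spec (L.post U [ξ k]) 0, some z) :=
          Or.inl ⟨.spec (hA k) (fun h0 => h0.elim) trivial, rfl⟩
        exact ⟨_, .single hs, _, rfl⟩

/-- Unless `Div` is preserved, all traces that extend divergence traces may be made divergence
traces. -/
theorem exists_rel_div (hr : Admissible r) (hV : ¬ Preserves r Div) (L : LTS.{u, v} Act) :
    ∃ T : LTS.{u, v} Act, r L T ∧ T.alphabet = L.alphabet ∧ T.nF = L.anF ∧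
      T.Div = L.Tr ∩ L.extT ∧ T.Inf = L.Inf := by
  obtain ⟨h⟩ : Nonempty Act := inferInstance
  obtain ⟨Z, Z', hZ, ⟨z, hz, hzd⟩, hZ', hI, hI'⟩ := exists_witness_Div hr.congr hr.anF hV h
  have hD' := specSys_Div_eq (h := h) (L := L) (m := .direct) (dec := True) (P := fun _ => True)
    (Z := Z') (fun σ _ U n z hI => absurd rfl hI.1) (by
      rintro σ - s z ⟨-, -, z', k, h0, hk, ⟨-, rfl⟩ | ⟨h1, -⟩⟩ hd
      · obtain rfl := Option.some.inj h0
        exact hZ' ⟨_, hk, hd⟩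
      · cases h1)
  have hD : (specSys h L .direct True (fun _ => True) Z).Div = L.Tr ∩ L.extT := by
    ext σ
    constructor
    · rintro ⟨c, hc, hd⟩
      by_contra hσ
      exact specSys_not_diverges
        (fun h0 => hσ ⟨L.Div_subset_Tr h0, L.Div_subset_extT h0⟩)
        (fun U n z hI => absurd rfl hI.1) (fun s z hI => absurd ⟨⟨s, hI.1⟩, hI.2.1⟩ hσ)
        (specSys_inv hc) hd
    · rintro ⟨⟨s, hs⟩, hσ⟩
      obtain ⟨-, ρ, ⟨κ, rfl⟩, hρ⟩ := mem_extT_iff.1 hσ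
      obtain ⟨t, ht, ht'⟩ := hs.split
      exact ⟨_, ((specSys_reach_wait hρ).trans_nil (specSys_weak_sync (.direct rfl ht) hz)).trans
        (specSys_weak_fin ht' _), specSys_diverges_of_diverges hzd _⟩
  refine ⟨specSys h L .direct True (fun _ => True) Z, rel_specSys hr hZ
    (specSys_nF_eq hD' fun σ _ A _ U n z hI => absurd rfl hI.1) hD' (specSys_Inf_eq hI'), rfl, ?_,
    hD, specSys_Inf_eq hI⟩
  ext ⟨σ, A⟩
  simp only [nF, anF, Set.mem_ofPred_eq, hD]
  constructor
  · rintro ⟨hf, hσ⟩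
    rcases specSys_Sf_cases hf with h2 | ⟨U, z, h2, -⟩ | ⟨U, n, z, h2, -⟩
    · exact ⟨h2, fun h0 => hσ ⟨Sf_fst_mem_Tr h2, h0⟩⟩
    · exact absurd ⟨L.Div_subset_Tr h2.2.1, L.Div_subset_extT h2.2.1⟩ hσ
    · exact absurd rfl h2.1
  · rintro ⟨hf, hσ⟩
    exact ⟨Sf_subset_specSys hf, fun h0 => hσ h0.2⟩

/-- Unless `snF` is preserved, all failures may be added to the traces that extend divergence
traces. -/
theorem exists_rel_snF (hr : Admissible r) (hV : Preserves r Div) (hS : ¬ Preserves r snF)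
    (L : LTS.{u, v} Act) :
    ∃ T : LTS.{u, v} Act, r L T ∧ T.alphabet = L.alphabet ∧
      T.nF = L.nF ∪ {f | f.1 ∈ (L.Tr ∩ L.extT) \ L.Div ∧ f.2 ⊆ L.alphabet} ∧
      T.Div = L.Div ∧ T.Inf = L.Inf := by
  obtain ⟨h⟩ : Nonempty Act := inferInstance
  obtain ⟨Z, Z', hZ, ⟨z, hz, hzs, hzh⟩, hz', hnd, hnd'⟩ :=
    exists_witness_snF hr.congr hr.anF hV hS h
  have hDiv : ∀ Z : LTS.{u, v} Act, [h] ∉ Z.Div ∧ [h, h] ∉ Z.Div ∧ (fun _ => h) ∉ Z.Inf →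
      (specSys h L .ret True Set.Nonempty Z).Div = L.Div := by
    rintro Z ⟨h1, h2, -⟩
    refine specSys_Div_eq ?_ ?_
    · rintro σ - U n z ⟨-, -, -, -, z', k, h0, hk, h3 | rfl, -⟩ hd
      · cases h3
      · obtain rfl := Option.some.inj h0
        exact h1 ⟨_, hk, hd⟩
    · rintro σ - s z ⟨-, -, z', k, h0, hk, ⟨h3, -⟩ | ⟨-, rfl⟩⟩ hd
      · cases h3
      · obtain rfl := Option.some.inj h0
        exact h2 ⟨_, hk, hd⟩
  refine ⟨specSys h L .ret True Set.Nonempty Z, rel_specSys hr hZ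
    (specSys_nF_eq (hDiv Z' hnd') ?_) (hDiv Z' hnd') (specSys_Inf_eq hnd'.2.2), rfl, ?_,
    hDiv Z hnd, specSys_Inf_eq hnd.2.2⟩
  · -- a stable state of `Z'` gives the order to return
    rintro σ hσ A - U n z ⟨-, rfl, -, hP, y, k, h0, hk, hk', -⟩ hst
    obtain rfl := Option.some.inj h0
    obtain rfl : k = 1 := by
      rcases hk' with hk' | hk'
      · cases hk'
      · exact hk'
    obtain ⟨t, ht⟩ : (L.after σ).Nonempty := hP.resolve_right hσ
    refine absurd ⟨z, hk, fun z₁ h1 => ?_, fun z₁ h1 => ?_⟩ hz'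
    · exact hst (.spec (L.after σ) n, some z₁)
        (Or.inr (Or.inl ⟨rfl, Or.inl ⟨z, z₁, rfl, rfl, h1⟩, rfl⟩))
    · exact hst (.fin t, some z₁)
        (Or.inr (Or.inr ⟨h, Or.inl ⟨z, z₁, rfl, rfl, h1⟩, rfl, rfl, .ret rfl ht⟩))
  · ext ⟨σ, A⟩
    simp only [nF, Set.mem_ofPred_eq, hDiv Z hnd, Set.mem_union, Set.mem_sdiff, Set.mem_inter_iff]
    constructor
    · rintro ⟨hf, hσ⟩
      rcases specSys_Sf_cases hf with h2 | ⟨U, z, h2, -⟩ | ⟨U, n, z, ⟨-, rfl, h2, h3, -⟩, -⟩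
      · exact Or.inl ⟨h2, hσ⟩
      · exact absurd h2.2.1 hσ
      · exact Or.inr ⟨⟨⟨h3.resolve_right hσ, h2⟩, hσ⟩, hf.1⟩
    · rintro (⟨hf, hσ⟩ | ⟨⟨⟨hT, hE⟩, hσ⟩, hA⟩)
      · exact ⟨Sf_subset_specSys hf, hσ⟩
      · refine ⟨?_, hσ⟩
        obtain ⟨hA', ρ, ⟨κ, rfl⟩, hρ⟩ := mem_extT_iff.1 hE
        have hw := specSys_reach_spec (h := h) (L := L) (m := .ret) (dec := True)
          (P := Set.Nonempty) (by simp) hρ (fun a ha => hA' a (List.mem_append_right _ ha))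
          (fun κ' hκ' _ => Tr_of_prefix ((List.prefix_append_right_inj ρ).2 hκ') hT) hz
        have hno : ∀ x c, ¬ (specSys h L .ret True Set.Nonempty Z).step
            (.spec (L.after (ρ ++ κ)) 0, some z) x c := by
          rintro x ⟨q, w⟩ (⟨h1, -⟩ | ⟨-, h1, -⟩ | ⟨a, h1, rfl, -⟩)
          · cases h1 with
            | spec _ hn => exact absurd (hn trivial) (Nat.not_lt_zero _)
          · rcases h1 with ⟨y, y', hy, -, h1⟩ | ⟨h0, -⟩
            · obtain rfl : z = y := Option.some.inj hy
              exact hzs _ h1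
            · cases h0
          · rcases h1 with ⟨y, y', hy, -, h1⟩ | ⟨h0, -⟩
            · obtain rfl : z = y := Option.some.inj hy
              exact hzh _ h1
            · cases h0
        exact ⟨hA, _, hw, fun c => hno _ c, fun a _ c => hno _ c⟩

/-- Unless `Inf` is preserved, all infinite sequences may be added all but finitely many of whose
prefixes are divergence traces. -/
theorem exists_rel_Inf (hr : Admissible r) (hI : ¬ Preserves r Inf) (L : LTS.{u, v} Act) :
    ∃ T : LTS.{u, v} Act, r L T ∧ T.alphabet = L.alphabet ∧ T.nF = L.nF ∧ T.Div = L.Div ∧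
      T.Inf = L.Inf ∪ {ξ | ∃ n, ∀ i ≥ n, initSeg ξ i ∈ L.Div} := by
  obtain ⟨h⟩ : Nonempty Act := inferInstance
  obtain ⟨Z, Z', hZ, hZI, hZI'⟩ := exists_witness_Inf hr.congr hr.anF hI h
  set P : Set L.State → Prop := fun U => ∃ s ∈ U, L.Diverges s with hP
  have hspec : ∀ {Z : LTS.{u, v} Act} {σ U n z}, SpecInv h L .loop P Z σ (.spec U n) z →
      σ ∈ L.Div := by
    rintro Z σ U n z ⟨-, rfl, -, h1 | h1, -⟩
    · exact exists_diverges_mem_after.1 h1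
    · exact h1
  have hfin : ∀ {Z : LTS.{u, v} Act} {σ s z}, ¬ SpecInv h L .loop P Z σ (.fin s) (some z) := by
    rintro Z σ s z ⟨-, -, -, -, -, -, ⟨h0, -⟩ | ⟨h0, -⟩⟩ <;> cases h0
  have hD : ∀ Z : LTS.{u, v} Act, (specSys h L .loop True P Z).Div = L.Div := fun Z =>
    specSys_Div_eq (fun σ hσ U n z hI => absurd (hspec hI) hσ) fun σ _ s z hI => absurd hI hfin
  have hN : ∀ Z : LTS.{u, v} Act, (specSys h L .loop True P Z).nF = L.nF := fun Z =>
    specSys_nF_eq (hD Z) fun σ hσ A _ U n z hI => absurd (hspec hI) hσ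
  refine ⟨specSys h L .loop True P Z, rel_specSys hr hZ (hN Z') (hD Z') (specSys_Inf_eq hZI'), rfl,
    hN Z, hD Z, ?_⟩
  ext ξ
  constructor
  · intro hξ
    rcases specSys_Inf_cases hξ with h2 | ⟨p, i, hp, hI, hb⟩
    · exact Or.inl h2
    · refine Or.inr ⟨i, fun j hj => ?_⟩
      have h2 := hI j
      have h3 := hb j hj
      cases hq : (p j).1 with
      | run => rw [hq] at h3; exact absurd h3 id
      | fin => rw [hq] at h3; exact absurd h3 id
      | wait => rw [hq] at h2; exact h2.2.1
      | spec => rw [hq] at h2; exact hspec h2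
  · rintro (hξ | ⟨n, hn⟩)
    · exact Inf_subset_specSys hξ
    · exact specSys_mem_Inf_of_frequently_Div rfl (n₀ := n)
        (fun i hi => exists_diverges_mem_after.2 (hn i hi))
        (fun k => ⟨max n k, le_max_right _ _, hn _ (le_max_left _ _)⟩) hZI

/-- Unless `aenI` is preserved, all infinite sequences may be added infinitely many of whose
prefixes are divergence traces, provided that the failures have been saturated before: speculation
may stand still after any trace of `L` that extends a divergence trace. -/
theorem exists_rel_aenI (hr : Admissible r) (hV : Preserves r Div) (hI : ¬ Preserves r aenI)
    (L : LTS.{u, v} Act)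
    (hL : ∀ σ ∈ L.Tr, σ ∈ L.extT → σ ∉ L.Div → ∀ A ⊆ L.alphabet, (σ, A) ∈ L.Sf) :
    ∃ T : LTS.{u, v} Act, r L T ∧ T.alphabet = L.alphabet ∧ T.nF = L.nF ∧ T.Div = L.Div ∧
      T.Inf = L.Inf ∪ {ξ | ∀ n, ∃ i ≥ n, initSeg ξ i ∈ L.Div} := by
  obtain ⟨h⟩ : Nonempty Act := inferInstance
  obtain ⟨Z, Z', hZ, hZI, hZI', hodd, hodd'⟩ := exists_witness_aenI hr.congr hr.anF hV hI h
  have hfin : ∀ {Z : LTS.{u, v} Act} {σ s z},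
      ¬ SpecInv h L .loop Set.Nonempty Z σ (.fin s) (some z) := by
    rintro Z σ s z ⟨-, -, -, -, -, -, ⟨h0, -⟩ | ⟨h0, -⟩⟩ <;> cases h0
  have hD : ∀ Z : LTS.{u, v} Act, (∀ k, Odd k → List.replicate k h ∉ Z.Div) →
      (specSys h L .loop True Set.Nonempty Z).Div = L.Div := by
    intro Z hodd
    refine specSys_Div_eq ?_ fun σ _ s z hI => absurd hI hfin
    rintro σ - U n z ⟨-, -, -, -, z', k, h0, hk, -, hk'⟩ hd
    obtain rfl := Option.some.inj h0
    exact hodd k hk' ⟨_, hk, hd⟩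
  have hN : ∀ Z : LTS.{u, v} Act, (∀ k, Odd k → List.replicate k h ∉ Z.Div) →
      (specSys h L .loop True Set.Nonempty Z).nF = L.nF := by
    intro Z hodd
    refine specSys_nF_eq (hD Z hodd) ?_
    rintro σ hσ A hA U n z ⟨-, rfl, hE, hP, -⟩ -
    exact hL σ (hP.resolve_right hσ) hE hσ A hA
  refine ⟨specSys h L .loop True Set.Nonempty Z, rel_specSys hr hZ (hN Z' hodd') (hD Z' hodd')
    (specSys_Inf_eq hZI'), rfl, hN Z hodd, hD Z hodd, ?_⟩
  ext ξ
  constructor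
  · intro hξ
    rcases specSys_Inf_cases hξ with h2 | ⟨p, i, hp, hI, hb⟩
    · exact Or.inl h2
    · exact Or.inr (exists_initSeg_mem_Div_of_busy trivial hp hI hb)
  · rintro (hξ | hξ)
    · exact Inf_subset_specSys hξ
    · refine specSys_mem_Inf_of_frequently_Div rfl (n₀ := 0) (fun i _ => ?_) hξ hZI
      obtain ⟨j, hj, hj'⟩ := hξ i
      exact Tr_of_prefix (initSeg_prefix ξ hj) (L.Div_subset_Tr hj')

end NormalForm

/-! ### The weakest of the equivalences and the failures-divergences model -/

theorem minD_eq_of_extT (L : LTS.{u, v} Act) :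
    L.minD = {σ | σ ∈ L.extT ∧ ∀ ρ, ρ <+: σ → ρ ≠ σ → ρ ∉ L.extT} := by
  ext σ
  constructor
  · intro hσ
    refine ⟨L.Div_subset_extT hσ.1, fun ρ hρ hne hE => ?_⟩
    obtain ⟨-, κ, hκ, hd⟩ := mem_extT_iff.1 hE
    refine hσ.2 κ (hκ.trans hρ) ?_ hd
    rintro rfl
    exact hne (hρ.eq_of_length (le_antisymm hρ.length_le hκ.length_le))
  · rintro ⟨⟨-, κ, hκ, hm⟩, hσ⟩
    by_cases hne : κ = σ
    · exact hne ▸ hm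
    · exact absurd (L.Div_subset_extT hm.1) (hσ κ hκ hne)

theorem CFail_eq (L : LTS.{u, v} Act) :
    L.CFail = L.anF ∪ {f | f.1 ∈ L.extT ∧ f.2 ⊆ L.alphabet} := by
  ext f
  simp only [CFail, CDiv, anF, Set.mem_union, Set.mem_ofPred_eq]
  constructor
  · rintro (hf | hf)
    · by_cases hE : f.1 ∈ L.extT
      · exact Or.inr ⟨hE, hf.1⟩
      · exact Or.inl ⟨hf, hE⟩
    · exact Or.inr hf
  · rintro (hf | hf)
    · exact Or.inl hf.1
    · exact Or.inr hf

theorem anF_eq_of_CFail (L : LTS.{u, v} Act) : L.anF = {f | f ∈ L.CFail ∧ f.1 ∉ L.CDiv} := by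
  ext f
  simp only [CFail_eq, anF, CDiv, Set.mem_union, Set.mem_ofPred_eq]
  tauto

theorem FDEquiv_iff {L L' : LTS.{u, v} Act} :
    FDEquiv L L' ↔ L.alphabet = L'.alphabet ∧ L.anF = L'.anF ∧ L.minD = L'.minD := by
  constructor
  · rintro ⟨hA, hF, hD⟩
    refine ⟨hA, by rw [anF_eq_of_CFail, anF_eq_of_CFail, hF, hD], ?_⟩
    rw [minD_eq_of_extT, minD_eq_of_extT, show L.extT = L'.extT from hD]
  · rintro ⟨hA, hF, hM⟩
    have hE := extT_eq_of_minD_eq hA hM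
    exact ⟨hA, by rw [CFail_eq, CFail_eq, hF, hE, hA], hE⟩

/-- Kőnig's lemma for systems: the infinite execution stays in states from which arbitrarily long
parts of the rest of `ξ` can be executed. Such a state has a successor of the same kind by finite
branching, and absence of divergence ensures that the next visible action comes. -/
theorem mem_Inf_of_finitelyBranching {L : LTS.{u, v} Act} (hL : L.FinitelyBranching) {ξ : ℕ → Act}
    (hT : ∀ n, initSeg ξ n ∈ L.Tr) (hD : ∀ n, initSeg ξ n ∉ L.Div) : ξ ∈ L.Inf := by
  let Run : ℕ → L.State → ℕ → Prop := fun n s k =>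
    ∃ t, L.Weak s (initSeg (fun i => ξ (n + i)) k) t
  have hmono : ∀ n s k l, k ≤ l → Run n s l → Run n s k := by
    rintro n s k l hkl ⟨t, ht⟩
    obtain ⟨d, rfl⟩ := Nat.exists_eq_add_of_le hkl
    rw [initSeg_add] at ht
    obtain ⟨w, hw, -⟩ := ht.split
    exact ⟨w, hw⟩
  have hstep : ∀ n s, (∀ k, Run n s k) → (∃ s', L.step s none s' ∧ ∀ k, Run n s' k) ∨
      ∃ s', L.step s (some (ξ n)) s' ∧ ∀ k, Run (n + 1) s' k := by
    intro n s hs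
    by_contra! hcon
    obtain ⟨h1, h2⟩ := hcon
    -- by finite branching there is a length that is too much for all successors
    have hev : ∀ᶠ K in Filter.atTop, ∀ s' ∈ {s' | ∃ x, L.step s x s'},
        (L.step s none s' → ¬ Run n s' K) ∧ (L.step s (some (ξ n)) s' → ¬ Run (n + 1) s' K) := by
      rw [Filter.eventually_all_finite (hL s)]
      intro s' _
      refine Filter.Eventually.and ?_ ?_
      · by_cases h3 : L.step s none s'
        · obtain ⟨k, hk⟩ := h1 s' h3
          filter_upwards [Filter.eventually_ge_atTop k] with K hK _ hr
          exact hk (hmono _ _ _ _ hK hr)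
        · exact Filter.Eventually.of_forall fun K h4 => absurd h4 h3
      · by_cases h3 : L.step s (some (ξ n)) s'
        · obtain ⟨k, hk⟩ := h2 s' h3
          filter_upwards [Filter.eventually_ge_atTop k] with K hK _ hr
          exact hk (hmono _ _ _ _ hK hr)
        · exact Filter.Eventually.of_forall fun K h4 => absurd h4 h3
    obtain ⟨K, hK⟩ := hev.exists
    obtain ⟨t, ht⟩ := hs (K + 1)
    have he : initSeg (fun i => ξ (n + i)) (K + 1) =
        ξ n :: initSeg (fun i => ξ (n + 1 + i)) K := by
      rw [add_comm K 1, initSeg_add]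
      simp only [← add_assoc]
      rfl
    generalize hκ : initSeg (fun i => ξ (n + i)) (K + 1) = κ at ht
    cases ht with
    | refl => rw [he] at hκ; cases hκ
    | @tau s s' _ _ h3 h4 =>
      exact (hK s' ⟨_, h3⟩).1 h3 (hmono _ _ _ _ (Nat.le_succ K) ⟨t, hκ ▸ h4⟩)
    | @vis s s' _ a σ h3 h4 =>
      rw [he] at hκ
      cases hκ
      exact (hK s' ⟨_, h3⟩).2 h3 ⟨t, h4⟩
  rw [mem_Inf_iff]
  have := InfFrom.of_forall_weak (L := L) (ξ := ξ) (n := 0) (s := L.init)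
    (fun n s => L.Weak L.init (initSeg ξ n) s ∧ ∀ k, Run n s k) ?_ ⟨.refl _, fun k => ?_⟩
  · simpa using this
  · rintro n s ⟨hs, hr⟩
    have key : ∃ s', L.Weak s [ξ n] s' ∧ ∀ k, Run (n + 1) s' k := by
      have hacc := not_diverges_iff_acc.1 fun hd => hD n ⟨s, hs, hd⟩
      clear hs
      induction hacc with
      | intro s _ ih =>
        rcases hstep n s hr with ⟨s', h1, h2⟩ | ⟨s', h1, h2⟩
        · obtain ⟨t, h3, h4⟩ := ih s' h1 h2
          exact ⟨t, .tau h1 h3, h4⟩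
        · exact ⟨s', .single h1, h2⟩
    obtain ⟨s', h1, h2⟩ := key
    exact ⟨s', h1, by rw [initSeg_succ]; exact hs.trans h1, h2⟩
  · simpa [Run, Tr] using hT k

theorem anI_eq_of_FDEquiv {L L' : LTS.{u, v} Act} (hL : L.FinitelyBranching)
    (hL' : L'.FinitelyBranching) (h : FDEquiv L L') : L.anI = L'.anI := by
  have key : ∀ {L L' : LTS.{u, v} Act}, L'.FinitelyBranching → FDEquiv L L' → L.anI ⊆ L'.anI := by
    rintro L L' hL' h ξ ⟨hξ, hE⟩
    obtain ⟨hA, hF, hM⟩ := FDEquiv_iff.1 h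
    have hT := initSeg_mem_Tr_of_mem_Inf hξ
    have hnd : ∀ n, initSeg ξ n ∉ L.extT := by
      intro n hn
      obtain ⟨-, ρ, hρ, hd⟩ := hn
      exact hE ⟨mem_alphabet_of_forall_initSeg hT, ρ.length, eq_initSeg_of_prefix hρ ▸ hd⟩
    refine ⟨mem_Inf_of_finitelyBranching hL' (fun n => ?_) fun n hn => hnd n ?_,
      extI_eq_of_minD_eq hA hM ▸ hE⟩
    · have h1 : (initSeg ξ n, (∅ : Set Act)) ∈ L.anF :=
        ⟨mem_Sf_empty_of_not_mem_Div (hT n) fun h0 => hnd n (L.Div_subset_extT h0), hnd n⟩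
      rw [hF] at h1
      exact Sf_fst_mem_Tr h1.1
    · rw [extT_eq_of_minD_eq hA hM]
      exact L'.Div_subset_extT hn
  exact (key hL' h).antisymm (key hL ⟨h.1.symm, h.2.1.symm, h.2.2.symm⟩)

/-! ### Two systems that only differ beyond a divergence -/

/-- The one-state system with alphabet `{h}` that has a `τ`-loop, and an `h`-loop if `b` holds. -/
def loopSys (h : Act) (b : Prop) : LTS.{u, v} Act where
  State := PUnit
  alphabet := {h}
  step _ x _ := x = none ∨ (b ∧ x = some h)
  init := PUnit.unit
  step_alphabet := by
    rintro - a - (h0 | ⟨-, h0⟩)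
    · exact absurd h0 (by simp)
    · exact Option.some.inj h0

theorem loopSys_diverges (h : Act) (b : Prop) (s : (loopSys.{u, v} h b).State) :
    (loopSys.{u, v} h b).Diverges s := ⟨fun _ => s, rfl, fun _ => Or.inl rfl⟩

theorem nil_mem_minD_loopSys (h : Act) (b : Prop) : [] ∈ (loopSys.{u, v} h b).minD :=
  ⟨⟨_, .refl _, loopSys_diverges _ _ _⟩, fun _ hρ hne => absurd (List.prefix_nil.1 hρ) hne⟩

theorem RowEquiv_zero_loopSys (h : Act) (b b' : Prop) :
    RowEquiv 0 (loopSys.{u, v} h b) (loopSys h b') := by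
  have hF : ∀ b, (loopSys.{u, v} h b).anF = ∅ := fun b =>
    Set.eq_empty_of_forall_notMem fun f hf => by
      obtain ⟨-, s, -, hs, -⟩ := hf.1
      exact hs PUnit.unit (Or.inl rfl)
  have hM : ∀ b, (loopSys.{u, v} h b).minD = {[]} := fun b => by
    ext σ
    refine ⟨fun hσ => ?_, fun hσ => hσ ▸ nil_mem_minD_loopSys h b⟩
    by_contra hne
    exact hσ.2 [] List.nil_prefix (fun h0 => hne h0.symm) (nil_mem_minD_loopSys h b).1
  have hI : ∀ b, (loopSys.{u, v} h b).anI = ∅ := fun b =>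
    Set.eq_empty_of_forall_notMem fun ξ hξ => hξ.2
      ⟨mem_alphabet_of_forall_initSeg (initSeg_mem_Tr_of_mem_Inf hξ.1), 0,
        nil_mem_minD_loopSys h b⟩
  exact ⟨rfl, by rw [hF, hF], by rw [hM, hM], by rw [hI, hI]⟩

theorem loopSys_Tr {h : Act} {b : Prop} : [h] ∈ (loopSys.{u, v} h b).Tr ↔ b := by
  constructor
  · rintro ⟨s, hs⟩
    obtain ⟨t, t', -, h0 | ⟨hb, -⟩, -⟩ := hs.split_vis
    · cases h0
    · exact hb
  · exact fun hb => ⟨PUnit.unit, .single (Or.inr ⟨hb, rfl⟩)⟩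

theorem loopSys_Div {h : Act} {b : Prop} : [h] ∈ (loopSys.{u, v} h b).Div ↔ b :=
  ⟨fun hd => loopSys_Tr.1 (Div_subset_Tr _ hd), fun hb => by
    obtain ⟨s, hs⟩ := (loopSys_Tr (h := h)).2 hb
    exact ⟨s, hs, loopSys_diverges _ _ _⟩⟩

theorem loopSys_Inf {h : Act} {b : Prop} : (fun _ => h) ∈ (loopSys.{u, v} h b).Inf ↔ b := by
  constructor
  · exact fun hI => loopSys_Tr.1 (initSeg_mem_Tr_of_mem_Inf hI 1)
  · exact fun hb => ⟨fun _ => PUnit.unit, fun _ => PUnit.unit, rfl,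
      fun _ => ⟨.refl _, Or.inr ⟨hb, rfl⟩⟩⟩

theorem not_RowEquiv_loopSys (h : Act) {i : Fin 6} (hi : i ≠ 0) :
    ¬ RowEquiv i (loopSys.{u, v} h False) (loopSys h True) := by
  intro hR
  have hT : (loopSys.{u, v} h False).Tr = (loopSys.{u, v} h True).Tr := by
    fin_cases i
    · exact absurd rfl hi
    all_goals exact hR.2.1
  exact loopSys_Tr.1 (hT ▸ loopSys_Tr.2 trivial : [h] ∈ (loopSys.{u, v} h False).Tr)

/-! ### Comparison of the equivalences -/

theorem Inf_union_extI (L : LTS.{u, v} Act) : L.Inf ∪ L.extI = L.anI ∪ L.extI := by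
  rw [anI, Set.sdiff_union_self]

theorem anI_subset_eanI (L : LTS.{u, v} Act) : L.anI ⊆ L.eanI ∩ L.aenI := by
  rintro ξ ⟨hξ, hE⟩
  have hnd : ∀ n, initSeg ξ n ∉ L.Div := fun n hn =>
    hE (mem_extI_iff.2 ⟨mem_alphabet_of_forall_initSeg (initSeg_mem_Tr_of_mem_Inf hξ), n, hn⟩)
  exact ⟨⟨hξ, 0, fun i _ => hnd i⟩, hξ, fun n => ⟨n, le_rfl, hnd n⟩⟩

/-- The set `anI` is determined by any set of infinite traces between `anI` and `Inf`. -/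
theorem anI_eq_of_between {L L' : LTS.{u, v} Act} (X X' : Set (ℕ → Act)) (hX : X = X')
    (hE : L.extI = L'.extI) (h1 : L.anI ⊆ X) (h2 : X ⊆ L.Inf) (h1' : L'.anI ⊆ X')
    (h2' : X' ⊆ L'.Inf) : L.anI = L'.anI := by
  subst hX
  exact Set.Subset.antisymm (fun ξ hξ => ⟨h2' (h1 hξ), hE ▸ hξ.2⟩)
    fun ξ hξ => ⟨h2 (h1' hξ), hE ▸ hξ.2⟩

theorem RowEquiv.zero {i : Fin 6} {L L' : LTS.{u, v} Act} (h : RowEquiv i L L') :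
    RowEquiv 0 L L' := by
  fin_cases i
  · exact h
  · exact ⟨h.1, h.2.2⟩
  · obtain ⟨hA, -, hF, hM, hI⟩ := h
    exact ⟨hA, hF, hM, anI_eq_of_between _ _ hI (extI_eq_of_minD_eq hA hM) Set.sdiff_subset
      subset_rfl Set.sdiff_subset subset_rfl⟩
  all_goals
    obtain ⟨hA, -, hF, hD, hI⟩ := h
    have hM := minD_eq_of_Div_eq hD
    refine ⟨hA, hF, hM, anI_eq_of_between _ _ hI (extI_eq_of_minD_eq hA hM) ?_ ?_ ?_ ?_⟩
  · exact fun ξ hξ => (L.anI_subset_eanI hξ).1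
  · exact fun ξ hξ => hξ.1
  · exact fun ξ hξ => (L'.anI_subset_eanI hξ).1
  · exact fun ξ hξ => hξ.1
  · exact fun ξ hξ => (L.anI_subset_eanI hξ).2
  · exact fun ξ hξ => hξ.1
  · exact fun ξ hξ => (L'.anI_subset_eanI hξ).2
  · exact fun ξ hξ => hξ.1
  · exact Set.sdiff_subset
  · exact subset_rfl
  · exact Set.sdiff_subset
  · exact subset_rfl

/-! ### The six equivalences are contained in the congruences -/

/-- The nondivergent failures of a system in which all failures have been added to those traces that
extend a divergence trace but are not divergence traces themselves. -/
def satF (L : LTS.{u, v} Act) : Set (List Act × Set Act) :=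
  L.anF ∪ {f | f.1 ∈ (L.Tr ∩ L.extT) \ L.Div ∧ f.2 ⊆ L.alphabet}

theorem satF_eq_of {L L' : LTS.{u, v} Act} (hA : L.alphabet = L'.alphabet) (hT : L.Tr = L'.Tr)
    (hF : L.anF = L'.anF) (hD : L.Div = L'.Div) : L.satF = L'.satF := by
  simp only [satF, hA, hT, hF, hD, extT_eq_of_minD_eq hA (minD_eq_of_Div_eq hD)]

section Rows

variable [Infinite Act] {r : LTS.{u, v} Act → LTS.{u, v} Act → Prop}

/-- Two systems are related if their normal forms agree. -/
theorem rel_of_normal_forms (hr : Admissible r) {L L' T T' : LTS.{u, v} Act} (h : r L T)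
    (h' : r L' T') (hA : T.alphabet = T'.alphabet) (hN : T.nF = T'.nF) (hD : T.Div = T'.Div)
    (hI : T.Inf = T'.Inf) : r L L' :=
  hr.congr.equivalence.trans h (hr.congr.equivalence.trans (rel_of_nF_eq hr hA hN hD hI)
    (hr.congr.equivalence.symm h'))

theorem rel_of_RowEquiv_zero (hr : Admissible r) (hT : ¬ Preserves r Tr) {L L' : LTS.{u, v} Act}
    (h : RowEquiv 0 L L') : r L L' := by
  obtain ⟨hA, hF, hM, hI⟩ := h
  obtain ⟨T, h1, a1, n1, d1, i1⟩ := exists_rel_chaos hr hT L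
  obtain ⟨T', h2, a2, n2, d2, i2⟩ := exists_rel_chaos hr hT L'
  refine rel_of_normal_forms hr h1 h2 (by rw [a1, a2, hA]) (by rw [n1, n2, hF]) ?_ ?_
  · rw [d1, d2, extT_eq_of_minD_eq hA hM]
  · rw [i1, i2, Inf_union_extI, Inf_union_extI, hI, extI_eq_of_minD_eq hA hM]

/-- Otherwise `r` contains the weakest of the equivalences, which does not preserve `Div`. -/
theorem preserves_Tr_of_Div (hr : Admissible r) (hD : Preserves r Div) : Preserves r Tr := by
  by_contra hT
  obtain ⟨h⟩ : Nonempty Act := inferInstance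
  have h1 := hD _ _ (rel_of_RowEquiv_zero hr hT (RowEquiv_zero_loopSys h False True))
  exact loopSys_Div.1 (h1 ▸ loopSys_Div.2 trivial : [h] ∈ (loopSys.{u, v} h False).Div)

/-- Otherwise `r` contains the weakest of the equivalences, which does not preserve `Inf`. -/
theorem preserves_Tr_of_Inf (hr : Admissible r) (hI : Preserves r Inf) : Preserves r Tr := by
  by_contra hT
  obtain ⟨h⟩ : Nonempty Act := inferInstance
  have h1 := hI _ _ (rel_of_RowEquiv_zero hr hT (RowEquiv_zero_loopSys h False True))
  exact loopSys_Inf.1 (h1 ▸ loopSys_Inf.2 trivial : (fun _ => h) ∈ (loopSys.{u, v} h False).Inf)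

theorem rel_of_RowEquiv_one (hr : Admissible r) (hD : ¬ Preserves r Div) (hI : ¬ Preserves r Inf)
    {L L' : LTS.{u, v} Act} (h : RowEquiv 1 L L') : r L L' := by
  obtain ⟨hA, hT, hF, hM, hanI⟩ := h
  have hE := extT_eq_of_minD_eq hA hM
  have key : ∀ L : LTS.{u, v} Act, ∃ T : LTS.{u, v} Act, r L T ∧ T.alphabet = L.alphabet ∧
      T.nF = L.anF ∧ T.Div = L.Tr ∩ L.extT ∧
      T.Inf = L.anI ∪ {ξ | ∃ n, ∀ i ≥ n, initSeg ξ i ∈ L.Tr ∩ L.extT} := by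
    intro L
    obtain ⟨T₁, h1, a1, n1, d1, i1⟩ := exists_rel_div hr hD L
    obtain ⟨T₂, h2, a2, n2, d2, i2⟩ := exists_rel_Inf hr hI T₁
    refine ⟨T₂, hr.congr.equivalence.trans h1 h2, by rw [a2, a1], by rw [n2, n1],
      by rw [d2, d1], ?_⟩
    rw [i2, i1, d1]
    refine Set.Subset.antisymm (Set.union_subset (fun ξ hξ => ?_) Set.subset_union_right)
      (Set.union_subset_union_left _ Set.sdiff_subset)
    by_cases hξE : ξ ∈ L.extI
    · right
      obtain ⟨hξA, n, hn⟩ := hξE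
      refine ⟨n, fun i hi => ⟨initSeg_mem_Tr_of_mem_Inf hξ i, fun a ha => ?_, _,
        initSeg_prefix ξ hi, hn⟩⟩
      exact mem_alphabet_of_mem_Tr (initSeg_mem_Tr_of_mem_Inf hξ i) a ha
    · exact Or.inl ⟨hξ, hξE⟩
  obtain ⟨T, h1, a1, n1, d1, i1⟩ := key L
  obtain ⟨T', h2, a2, n2, d2, i2⟩ := key L'
  exact rel_of_normal_forms hr h1 h2 (by rw [a1, a2, hA]) (by rw [n1, n2, hF])
    (by rw [d1, d2, hT, hE]) (by rw [i1, i2, hT, hE, hanI])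

theorem rel_of_RowEquiv_two (hr : Admissible r) (hD : ¬ Preserves r Div)
    {L L' : LTS.{u, v} Act} (h : RowEquiv 2 L L') : r L L' := by
  obtain ⟨hA, hT, hF, hM, hI⟩ := h
  obtain ⟨T, h1, a1, n1, d1, i1⟩ := exists_rel_div hr hD L
  obtain ⟨T', h2, a2, n2, d2, i2⟩ := exists_rel_div hr hD L'
  exact rel_of_normal_forms hr h1 h2 (by rw [a1, a2, hA]) (by rw [n1, n2, hF])
    (by rw [d1, d2, hT, extT_eq_of_minD_eq hA hM]) (by rw [i1, i2, hI])

theorem exists_rel_satF (hr : Admissible r) (hV : Preserves r Div) (hS : ¬ Preserves r snF)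
    (L : LTS.{u, v} Act) : ∃ T : LTS.{u, v} Act, r L T ∧ T.alphabet = L.alphabet ∧
      T.nF = L.satF ∧ T.Div = L.Div ∧ T.Inf = L.Inf := by
  obtain ⟨T, h1, a1, n1, d1, i1⟩ := exists_rel_snF hr hV hS L
  refine ⟨T, h1, a1, ?_, d1, i1⟩
  rw [n1]
  refine Set.Subset.antisymm (Set.union_subset (fun f hf => ?_) Set.subset_union_right)
    (Set.union_subset_union_left _ fun f hf => ⟨hf.1, fun h0 => hf.2 (L.Div_subset_extT h0)⟩)
  by_cases hE : f.1 ∈ L.extT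
  · exact Or.inr ⟨⟨⟨Sf_fst_mem_Tr hf.1, hE⟩, hf.2⟩, hf.1.1⟩
  · exact Or.inl ⟨hf.1, hE⟩

theorem rel_of_RowEquiv_three (hr : Admissible r) (hD : Preserves r Div)
    (hS : ¬ Preserves r snF) (hI : ¬ Preserves r aenI)
    {L L' : LTS.{u, v} Act} (h : RowEquiv 3 L L') : r L L' := by
  obtain ⟨hA, hT, hF, hDL, hean⟩ := h
  have key : ∀ L : LTS.{u, v} Act, ∃ T : LTS.{u, v} Act, r L T ∧ T.alphabet = L.alphabet ∧
      T.nF = L.satF ∧ T.Div = L.Div ∧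
      T.Inf = L.eanI ∪ {ξ | ∀ n, ∃ i ≥ n, initSeg ξ i ∈ L.Div} := by
    intro L
    obtain ⟨T₁, h1, a1, n1, d1, i1⟩ := exists_rel_satF hr hD hS L
    have hsat : ∀ σ ∈ T₁.Tr, σ ∈ T₁.extT → σ ∉ T₁.Div → ∀ A ⊆ T₁.alphabet, (σ, A) ∈ T₁.Sf := by
      intro σ hσ hE hσD A hAs
      rw [a1] at hAs
      rw [extT_eq_of_minD_eq a1 (minD_eq_of_Div_eq d1)] at hE
      have h0 : (σ, (∅ : Set Act)) ∈ T₁.nF := ⟨mem_Sf_empty_of_not_mem_Div hσ hσD, hσD⟩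
      have hσT : σ ∈ L.Tr := by
        rw [n1] at h0
        rcases h0 with h0 | h0
        · exact Sf_fst_mem_Tr h0.1
        · exact h0.1.1.1
      have h3 : (σ, A) ∈ T₁.nF := by
        rw [n1]
        exact Or.inr ⟨⟨⟨hσT, hE⟩, d1 ▸ hσD⟩, hAs⟩
      exact h3.1
    obtain ⟨T₂, h2, a2, n2, d2, i2⟩ := exists_rel_aenI hr hD hI T₁ hsat
    refine ⟨T₂, hr.congr.equivalence.trans h1 h2, by rw [a2, a1], by rw [n2, n1],
      by rw [d2, d1], ?_⟩
    rw [i2, i1, d1]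
    refine Set.Subset.antisymm (Set.union_subset (fun ξ hξ => ?_) Set.subset_union_right)
      (Set.union_subset_union_left _ fun ξ hξ => hξ.1)
    by_cases hfr : ∀ n, ∃ i ≥ n, initSeg ξ i ∈ L.Div
    · exact Or.inr hfr
    · push Not at hfr
      exact Or.inl ⟨hξ, hfr⟩
  obtain ⟨T, h1, a1, n1, d1, i1⟩ := key L
  obtain ⟨T', h2, a2, n2, d2, i2⟩ := key L'
  exact rel_of_normal_forms hr h1 h2 (by rw [a1, a2, hA])
    (by rw [n1, n2, satF_eq_of hA hT hF hDL]) (by rw [d1, d2, hDL]) (by rw [i1, i2, hean, hDL])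

theorem rel_of_RowEquiv_four (hr : Admissible r) (hD : Preserves r Div)
    (hS : ¬ Preserves r snF) (hI : ¬ Preserves r Inf)
    {L L' : LTS.{u, v} Act} (h : RowEquiv 4 L L') : r L L' := by
  obtain ⟨hA, hT, hF, hDL, haen⟩ := h
  have key : ∀ L : LTS.{u, v} Act, ∃ T : LTS.{u, v} Act, r L T ∧ T.alphabet = L.alphabet ∧
      T.nF = L.satF ∧ T.Div = L.Div ∧
      T.Inf = L.aenI ∪ {ξ | ∃ n, ∀ i ≥ n, initSeg ξ i ∈ L.Div} := by
    intro L
    obtain ⟨T₁, h1, a1, n1, d1, i1⟩ := exists_rel_satF hr hD hS L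
    obtain ⟨T₂, h2, a2, n2, d2, i2⟩ := exists_rel_Inf hr hI T₁
    refine ⟨T₂, hr.congr.equivalence.trans h1 h2, by rw [a2, a1], by rw [n2, n1],
      by rw [d2, d1], ?_⟩
    rw [i2, i1, d1]
    refine Set.Subset.antisymm (Set.union_subset (fun ξ hξ => ?_) Set.subset_union_right)
      (Set.union_subset_union_left _ fun ξ hξ => hξ.1)
    by_cases hev : ∃ n, ∀ i ≥ n, initSeg ξ i ∈ L.Div
    · exact Or.inr hev
    · push Not at hev
      exact Or.inl ⟨hξ, hev⟩
  obtain ⟨T, h1, a1, n1, d1, i1⟩ := key L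
  obtain ⟨T', h2, a2, n2, d2, i2⟩ := key L'
  exact rel_of_normal_forms hr h1 h2 (by rw [a1, a2, hA])
    (by rw [n1, n2, satF_eq_of hA hT hF hDL]) (by rw [d1, d2, hDL]) (by rw [i1, i2, haen, hDL])

theorem rel_of_RowEquiv_five (hr : Admissible r) (hD : Preserves r Div)
    (hS : ¬ Preserves r snF) {L L' : LTS.{u, v} Act} (h : RowEquiv 5 L L') : r L L' := by
  obtain ⟨hA, hT, hF, hDL, hI⟩ := h
  obtain ⟨T, h1, a1, n1, d1, i1⟩ := exists_rel_satF hr hD hS L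
  obtain ⟨T', h2, a2, n2, d2, i2⟩ := exists_rel_satF hr hD hS L'
  exact rel_of_normal_forms hr h1 h2 (by rw [a1, a2, hA])
    (by rw [n1, n2, satF_eq_of hA hT hF hDL]) (by rw [d1, d2, hDL]) (by rw [i1, i2, hI])

end Rows

end LTS

/-! ### The classification of the congruences -/

theorem mainTheorem12 (Act : Type u) [Infinite Act] :
    -- the classification of the congruences
    (∀ r : LTS.{u, v} Act → LTS.{u, v} Act → Prop,
      LTS.IsCongruence r →
      (∀ L L', LTS.CFFD L L' → r L L') →
      r (LTS.livelock Act) (LTS.bothlock Act) →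
        (LTS.Preserves r LTS.anF → LTS.Preserves r LTS.minD →
          ¬ LTS.Preserves r LTS.Tr →
          ∀ L L', r L L' ↔ LTS.RowEquiv 0 L L') ∧
        (LTS.Preserves r LTS.Tr → LTS.Preserves r LTS.anF → LTS.Preserves r LTS.minD →
          ¬ LTS.Preserves r LTS.Div → ¬ LTS.Preserves r LTS.Inf →
          ∀ L L', r L L' ↔ LTS.RowEquiv 1 L L') ∧
        (LTS.Preserves r LTS.anF → LTS.Preserves r LTS.minD → LTS.Preserves r LTS.Inf →
          ¬ LTS.Preserves r LTS.Div →
          ∀ L L', r L L' ↔ LTS.RowEquiv 2 L L') ∧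
        (LTS.Preserves r LTS.anF → LTS.Preserves r LTS.Div →
          ¬ LTS.Preserves r LTS.snF → ¬ LTS.Preserves r LTS.aenI →
          ∀ L L', r L L' ↔ LTS.RowEquiv 3 L L') ∧
        (LTS.Preserves r LTS.anF → LTS.Preserves r LTS.Div → LTS.Preserves r LTS.aenI →
          ¬ LTS.Preserves r LTS.snF → ¬ LTS.Preserves r LTS.Inf →
          ∀ L L', r L L' ↔ LTS.RowEquiv 4 L L') ∧
        (LTS.Preserves r LTS.anF → LTS.Preserves r LTS.Div → LTS.Preserves r LTS.Inf →
          ¬ LTS.Preserves r LTS.snF →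
          ∀ L L', r L L' ↔ LTS.RowEquiv 5 L L') ∧
        -- the six rows exhaust the congruences that preserve `anF` but not `snF`
        (LTS.Preserves r LTS.anF → ¬ LTS.Preserves r LTS.snF →
          ∃ i : Fin 6, ∀ L L', r L L' ↔ LTS.RowEquiv i L L')) ∧
    -- the first equivalence is strictly weaker than each of the other five
    (∀ i : Fin 6, i ≠ 0 →
      (∀ L L' : LTS.{u, v} Act, LTS.RowEquiv i L L' → LTS.RowEquiv 0 L L') ∧
      ¬ ∀ L L' : LTS.{u, v} Act, LTS.RowEquiv 0 L L' → LTS.RowEquiv i L L') ∧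
    -- the first equivalence is the failures-divergences equivalence of CSP
    (∀ L L' : LTS.{u, v} Act, LTS.RowEquiv 0 L L' ↔ LTS.FDEquiv L L' ∧ L.anI = L'.anI) ∧
    (∀ L L' : LTS.{u, v} Act, L.FinitelyBranching → L'.FinitelyBranching →
      (LTS.RowEquiv 0 L L' ↔ LTS.FDEquiv L L')) := by
  refine ⟨fun r hr hC hl => ?_, ?_, ?_, ?_⟩
  · have hadm : LTS.Preserves r LTS.anF → LTS.Admissible r := fun hF => ⟨hr, hC, hl, hF⟩
    have hAlph : LTS.Preserves r LTS.anF → ∀ {L L'}, r L L' → L.alphabet = L'.alphabet :=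
      fun hF _ _ h => LTS.alphabet_eq_of_preserves_anF hr hF h
    have row0 : LTS.Preserves r LTS.anF → LTS.Preserves r LTS.minD → ¬ LTS.Preserves r LTS.Tr →
        ∀ L L', r L L' ↔ LTS.RowEquiv 0 L L' := fun hF hM hT L L' =>
      ⟨fun h => ⟨hAlph hF h, hF _ _ h, hM _ _ h, LTS.preserves_anI hr hF _ _ h⟩,
        LTS.rel_of_RowEquiv_zero (hadm hF) hT⟩
    have row1 : LTS.Preserves r LTS.Tr → LTS.Preserves r LTS.anF → LTS.Preserves r LTS.minD →
        ¬ LTS.Preserves r LTS.Div → ¬ LTS.Preserves r LTS.Inf →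
        ∀ L L', r L L' ↔ LTS.RowEquiv 1 L L' := fun hT hF hM hD hI L L' =>
      ⟨fun h => ⟨hAlph hF h, hT _ _ h, hF _ _ h, hM _ _ h, LTS.preserves_anI hr hF _ _ h⟩,
        LTS.rel_of_RowEquiv_one (hadm hF) hD hI⟩
    have row2 : LTS.Preserves r LTS.anF → LTS.Preserves r LTS.minD → LTS.Preserves r LTS.Inf →
        ¬ LTS.Preserves r LTS.Div →
        ∀ L L', r L L' ↔ LTS.RowEquiv 2 L L' := fun hF hM hI hD L L' =>
      ⟨fun h => ⟨hAlph hF h, LTS.preserves_Tr_of_Inf (hadm hF) hI _ _ h, hF _ _ h, hM _ _ h,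
        hI _ _ h⟩, LTS.rel_of_RowEquiv_two (hadm hF) hD⟩
    have row3 : LTS.Preserves r LTS.anF → LTS.Preserves r LTS.Div →
        ¬ LTS.Preserves r LTS.snF → ¬ LTS.Preserves r LTS.aenI →
        ∀ L L', r L L' ↔ LTS.RowEquiv 3 L L' := fun hF hD hS hI L L' =>
      ⟨fun h => ⟨hAlph hF h, LTS.preserves_Tr_of_Div (hadm hF) hD _ _ h, hF _ _ h, hD _ _ h,
        LTS.preserves_eanI_of_Div hr hF hD _ _ h⟩, LTS.rel_of_RowEquiv_three (hadm hF) hD hS hI⟩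
    have row4 : LTS.Preserves r LTS.anF → LTS.Preserves r LTS.Div → LTS.Preserves r LTS.aenI →
        ¬ LTS.Preserves r LTS.snF → ¬ LTS.Preserves r LTS.Inf →
        ∀ L L', r L L' ↔ LTS.RowEquiv 4 L L' := fun hF hD ha hS hI L L' =>
      ⟨fun h => ⟨hAlph hF h, LTS.preserves_Tr_of_Div (hadm hF) hD _ _ h, hF _ _ h, hD _ _ h,
        ha _ _ h⟩, LTS.rel_of_RowEquiv_four (hadm hF) hD hS hI⟩
    have row5 : LTS.Preserves r LTS.anF → LTS.Preserves r LTS.Div → LTS.Preserves r LTS.Inf →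
        ¬ LTS.Preserves r LTS.snF →
        ∀ L L', r L L' ↔ LTS.RowEquiv 5 L L' := fun hF hD hI hS L L' =>
      ⟨fun h => ⟨hAlph hF h, LTS.preserves_Tr_of_Div (hadm hF) hD _ _ h, hF _ _ h, hD _ _ h,
        hI _ _ h⟩, LTS.rel_of_RowEquiv_five (hadm hF) hD hS⟩
    refine ⟨row0, row1, row2, row3, row4, row5, fun hF hS => ?_⟩
    have hM := LTS.preserves_minD_of_anF hr hF
    by_cases hT : LTS.Preserves r LTS.Tr
    · by_cases hD : LTS.Preserves r LTS.Div
      · by_cases hI : LTS.Preserves r LTS.Inf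
        · exact ⟨5, row5 hF hD hI hS⟩
        · by_cases ha : LTS.Preserves r LTS.aenI
          · exact ⟨4, row4 hF hD ha hS hI⟩
          · exact ⟨3, row3 hF hD hS ha⟩
      · by_cases hI : LTS.Preserves r LTS.Inf
        · exact ⟨2, row2 hF hM hI hD⟩
        · exact ⟨1, row1 hT hF hM hD hI⟩
    · exact ⟨0, row0 hF hM hT⟩
  · intro i hi
    obtain ⟨h⟩ : Nonempty Act := inferInstance
    exact ⟨fun L L' => LTS.RowEquiv.zero, fun hcon => LTS.not_RowEquiv_loopSys h hi
      (hcon _ _ (LTS.RowEquiv_zero_loopSys h False True))⟩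
  · intro L L'
    rw [LTS.FDEquiv_iff]
    exact ⟨fun ⟨hA, hF, hM, hI⟩ => ⟨⟨hA, hF, hM⟩, hI⟩, fun ⟨⟨hA, hF, hM⟩, hI⟩ => ⟨hA, hF, hM, hI⟩⟩
  · intro L L' hL hL'
    constructor
    · rintro ⟨hA, hF, hM, -⟩
      exact LTS.FDEquiv_iff.2 ⟨hA, hF, hM⟩
    · intro h
      obtain ⟨hA, hF, hM⟩ := LTS.FDEquiv_iff.1 h
      exact ⟨hA, hF, hM, LTS.anI_eq_of_FDEquiv hL hL' h⟩
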